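/- Let $K$ be a number field, $\nu$ a place of $K$ (finite or infinite), $K_\nu$ the completion, and $|\cdot|$ the normalized module of $K_\nu$ (the usual absolute value if $K_\nu=\mathbb R$, $|z|=z\bar z$ if $K_\nu=\mathbb C$, and $|\pi|=1/q$ for a uniformizer $\pi$ at a finite place with residue field of cardinality $q$). Let $\lambda(x)=e^{-2\pi i\,\mathrm{Tr}_{K_\nu/\mathbb R}(x)}$ at an infinite place and $\lambda(x)=e^{2\pi i\{\mathrm{Tr}_{K_\nu/\mathbb Q_p}(x)\}}$ at a finite place above $p$, where $\{a\}\in\mathbb Z[1/p]$ is the polar part of $a\in\mathbb Q_p$, so that $a-\{a\}\in\mathbb Z_p$. Let $\mathcal S$ be the space of Schwartz--Bruhat functions on $K_\nu$ (Schwartz functions if $\nu$ is infinite; locally constant functions with compact support if $\nu$ is finite), and $\mathcal S_0\subset\mathcal S$ the subspace of functions having compact support and vanishing identically in a neighbourhood of $0$. Put $\mathcal F(\varphi)(y)=\int_{K_\nu}\varphi(x)\lambda(-yx)\,dx$, where $dx$ is the self-dual additive Haar measure, i.e. $\mathcal F\mathcal F(\varphi)(x)=\varphi(-x)$ for $\varphi\in\mathcal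 S$ (such a measure exists), and $\mathcal F^{-1}(\varphi)(x)=\int_{K_\nu}\varphi(y)\lambda(xy)\,dy$. For $\varphi\in\mathcal S$ let $$H(\varphi)(x)=\log|x|\,\varphi(x)+\mathcal F\bigl(\log|y|\,\mathcal F^{-1}(\varphi)(y)\bigr)(x).$$ **Theorem E2.** The formula defines a linear operator $H:\mathcal S\to L^2(K_\nu,dx)$ (the conductor operator). The operator $H$ with initial domain $\mathcal S_0$ is essentially self-adjoint on $L^2(K_\nu,dx)$. It is unbounded, but bounded below: there is a real $c$ with $\langle H\varphi,\varphi\rangle\ge c\|\varphi\|^2$ for all $\varphi\in\mathcal S_0$. It commutes with the unitary dilations $U(t):\varphi(x)\mapsto|t|^{-1/2}\varphi(x/t)$ ($t\in K_\nu^\times$), with the Fourier transform, and with the Inversion $I:\varphi(x)\mapsto|x|^{-1}\varphi(1/x)$. More precisely, $U(t)$, $I$ and (the extension from $\mathcal S$ to $L^2$ of) $\mathcal F$ are unitary operators on $L^2(K_\nu,dx)$; each of them maps the domain of the self-adjoint closure $\overline H$ of $(H,\mathcal S_0)$ onto itself and commutes with $\overline H$; moreover $U(t)$ and $I$ map $\mathcal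 S_0$ onto itself and commute with $H$ on $\mathcal S_0$, and $\mathcal F$ maps $\mathcal S$ onto itself and commutes with $H$ on $\mathcal S$. -/

import Mathlib

open MeasureTheory Topology NumberField IsDedekindDomain
open scoped SchwartzMap WithZero

noncomputable section

namespace Conductor

/-! ### Unbounded operators on a Hilbert space -/

section Operators

variable {E : Type*} [NormedAddCommGroup E] [InnerProductSpace ℂ E]

/-- Essential self-adjointness: densely defined, symmetric, with self-adjoint closure. -/
def IsEssentiallySelfAdjoint [CompleteSpace E] (T : E →ₗ.[ℂ] E) : Prop :=
  Dense (T.domain : Set E) ∧ T.IsFormalAdjoint T ∧ IsSelfAdjoint T.closure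

/-- `T` is bounded on its domain. -/
def IsBoundedOperator (T : E →ₗ.[ℂ] E) : Prop :=
  ∃ C : ℝ, ∀ x : T.domain, ‖T x‖ ≤ C * ‖x‖

/-- `T` is bounded below (semibounded): `c ‖x‖² ≤ ⟨T x, x⟩` on the domain. -/
def IsBoundedBelow (T : E →ₗ.[ℂ] E) : Prop :=
  ∃ c : ℝ, ∀ x : T.domain, c * ‖x‖ ^ 2 ≤ (inner ℂ (T x) (x : E)).re

/-- `T` commutes with the unitary `U`, that is `U T U⁻¹ = T`, including equality of domains. -/
def CommutesWith (T : E →ₗ.[ℂ] E) (U : E ≃ₗᵢ[ℂ] E) : Prop :=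
  (∀ x : E, U x ∈ T.domain ↔ x ∈ T.domain) ∧
  ∀ (x : E) (hx : x ∈ T.domain) (hUx : U x ∈ T.domain), T ⟨U x, hUx⟩ = U (T ⟨x, hx⟩)

end Operators

/-! ### The conductor operator over a topological field

The following record only bundles the three explicit objects attached to a completion of a number
field which enter the formulas: it is used below for one explicitly built term at each place. -/

/-- The normalized module `x ↦ |x|`, the basic additive character `λ`, and the space of
Schwartz-Bruhat functions. -/
structure LocalData (F : Type*) where
  /-- The module `|x|`. -/
  module : F → ℝ
  /-- The additive character `λ`. -/
  character : F → ℂ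
  /-- The Schwartz-Bruhat functions. -/
  schwartz : Set (F → ℂ)

namespace LocalData

variable {F : Type*} [Field F] [TopologicalSpace F] [MeasurableSpace F] (D : LocalData F)

/-- The functions in `𝒮₀`: Schwartz-Bruhat functions with compact support which vanish
identically in a neighbourhood of the origin. -/
def schwartzZero : Set (F → ℂ) :=
  {φ | φ ∈ D.schwartz ∧ HasCompactSupport φ ∧ ∀ᶠ x in 𝓝 (0 : F), φ x = 0}

/-- The Fourier transform `ℱ(φ)(y) = ∫ φ(x) λ(-yx) dx`. -/
def fourier (μ : Measure F) (φ : F → ℂ) : F → ℂ :=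
  fun y ↦ ∫ x, φ x * D.character (-(y * x)) ∂μ

/-- The inverse Fourier transform `ℱ⁻¹(φ)(x) = ∫ φ(y) λ(xy) dy`. -/
def fourierInv (μ : Measure F) (φ : F → ℂ) : F → ℂ :=
  fun x ↦ ∫ y, φ y * D.character (x * y) ∂μ

/-- `μ` is the self-dual additive Haar measure: `ℱℱ(φ)(x) = φ(-x)`. -/
structure IsSelfDual (μ : Measure F) : Prop where
  isAddHaarMeasure : μ.IsAddHaarMeasure
  fourier_fourier : ∀ φ ∈ D.schwartz, ∀ x, D.fourier μ (D.fourier μ φ) x = φ (-x)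

/-- The operator `A` of multiplication with `log |x|`. -/
def logMul (φ : F → ℂ) : F → ℂ :=
  fun x ↦ (Real.log (D.module x) : ℂ) * φ x

/-- The formula for the conductor operator,
`H(φ)(x) = log |x| φ(x) + ℱ(log |y| ℱ⁻¹(φ)(y))(x)`. -/
def conductor (μ : Measure F) (φ : F → ℂ) : F → ℂ :=
  fun x ↦ D.logMul φ x + D.fourier μ (D.logMul (D.fourierInv μ φ)) x

/-- The dilation `U(t) : φ(x) ↦ |t|^(-1/2) φ(x/t)`. -/
def dilation (t : F) (φ : F → ℂ) : F → ℂ :=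
  fun x ↦ ((Real.sqrt (D.module t))⁻¹ : ℂ) * φ (x / t)

/-- The Inversion `φ(x) ↦ |x|⁻¹ φ(1/x)`. -/
def inversion (φ : F → ℂ) : F → ℂ :=
  fun x ↦ ((D.module x)⁻¹ : ℂ) * φ (1 / x)

end LocalData

/-- `T` is the operator on `L²(F, μ)` whose domain consists of the classes of the functions in
`S`, and which maps the class of `φ ∈ S` to the class of `Φ φ`. Such a `T` is unique. -/
structure IsOperatorOf {F : Type*} [MeasurableSpace F] {μ : Measure F}
    (T : Lp ℂ 2 μ →ₗ.[ℂ] Lp ℂ 2 μ) (S : Set (F → ℂ)) (Φ : (F → ℂ) → (F → ℂ)) : Prop where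
  memLp : ∀ φ ∈ S, MemLp φ 2 μ
  mem_domain_iff : ∀ f : Lp ℂ 2 μ, f ∈ T.domain ↔ ∃ φ ∈ S, f =ᵐ[μ] φ
  apply_eq : ∀ f : T.domain, ∀ φ ∈ S, (f : Lp ℂ 2 μ) =ᵐ[μ] φ → T f =ᵐ[μ] Φ φ

/-- The properties of the conductor operator on `L²(F, dx)`, where `dx = μ`: the formula for `H`
defines operators `H` on `𝒮` and `H₀` on `𝒮₀` with values in `L²`; `H₀` is essentially
self-adjoint, unbounded, and bounded below; and the dilations, the Inversion and the Fourier
transform are (extend to) unitary operators on `L²` which commute with the self-adjoint closure of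
`H₀`, and with the operator on test functions itself (`H₀` for the dilations and the Inversion,
which preserve `𝒮₀`, and `H` for the Fourier transform, which preserves `𝒮`). -/
def ConductorProperties {F : Type*} [Field F] [TopologicalSpace F] [MeasurableSpace F]
    (D : LocalData F) (μ : Measure F) : Prop :=
  ∃ H H₀ : Lp ℂ 2 μ →ₗ.[ℂ] Lp ℂ 2 μ,
    IsOperatorOf H D.schwartz (D.conductor μ) ∧
    IsOperatorOf H₀ D.schwartzZero (D.conductor μ) ∧
    IsEssentiallySelfAdjoint H₀ ∧
    ¬ IsBoundedOperator H₀ ∧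
    IsBoundedBelow H₀ ∧
    (∀ t : F, t ≠ 0 → ∃ U : Lp ℂ 2 μ ≃ₗᵢ[ℂ] Lp ℂ 2 μ,
      (∀ f : Lp ℂ 2 μ, U f =ᵐ[μ] D.dilation t f) ∧
      CommutesWith H₀ U ∧ CommutesWith H₀.closure U) ∧
    (∃ I : Lp ℂ 2 μ ≃ₗᵢ[ℂ] Lp ℂ 2 μ,
      (∀ f : Lp ℂ 2 μ, I f =ᵐ[μ] D.inversion f) ∧
      CommutesWith H₀ I ∧ CommutesWith H₀.closure I) ∧
    (∃ 𝓕 : Lp ℂ 2 μ ≃ₗᵢ[ℂ] Lp ℂ 2 μ,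
      (∀ φ ∈ D.schwartz, ∀ f : Lp ℂ 2 μ, f =ᵐ[μ] φ → 𝓕 f =ᵐ[μ] D.fourier μ φ) ∧
      CommutesWith H 𝓕 ∧ CommutesWith H₀.closure 𝓕)

/-! ### Infinite places -/

section Infinite

variable {K : Type*} [Field K]

/-- The trace of the completion at an infinite place down to `ℝ`: it is `x` at a real place
(multiplicity `1`, real embedding) and `z + conj z = 2 Re z` at a complex place. -/
def infiniteTrace (v : InfinitePlace K) (x : v.Completion) : ℝ :=
  v.mult * (InfinitePlace.Completion.extensionEmbedding v x).re

/-- Schwartz functions on the completion, identified with `ℝ` or `ℂ`. -/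
def infiniteSchwartz (v : InfinitePlace K) : Set (v.Completion → ℂ) :=
  {φ | (∃ hv : v.IsReal, ∃ f : 𝓢(ℝ, ℂ), ∀ x,
          φ x = f (InfinitePlace.Completion.extensionEmbeddingOfIsReal hv x)) ∨
       (v.IsComplex ∧ ∃ f : 𝓢(ℂ, ℂ), ∀ x,
          φ x = f (InfinitePlace.Completion.extensionEmbedding v x))}

/-- The data at an infinite place: `|x|` at a real place, `|z| = z * conj z` at a complex place,
and `λ(x) = exp(-2πi Tr x)`. -/
def infiniteData (v : InfinitePlace K) : LocalData v.Completion where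
  module x := ‖x‖ ^ v.mult
  character x := Complex.exp (2 * Real.pi * Complex.I * (-infiniteTrace v x : ℝ))
  schwartz := infiniteSchwartz v

end Infinite

/-! ### Finite places -/

section Finite

/-- Every `p`-adic number is congruent modulo `ℤ_p` to an element of `ℤ[1/p]`. -/
theorem exists_polar (p : ℕ) [hp : Fact p.Prime] (a : ℚ_[p]) :
    ∃ r : ℚ, (∃ m k : ℕ, r = m / (p : ℚ) ^ k) ∧ ‖a - r‖ ≤ 1 := by
  have hp1 : (1 : ℝ) < p := by exact_mod_cast hp.out.one_lt
  have hp0 : (p : ℚ_[p]) ≠ 0 := by exact_mod_cast hp.out.ne_zero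
  obtain ⟨k, hk⟩ := pow_unbounded_of_one_lt ‖a‖ hp1
  have hu : ‖(p : ℚ_[p]) ^ k * a‖ ≤ 1 := by
    rw [norm_mul, norm_pow, Padic.norm_p, inv_pow]
    exact inv_mul_le_one_of_le₀ hk.le (by positivity)
  obtain ⟨u, hu'⟩ : ∃ u : ℤ_[p], (u : ℚ_[p]) = (p : ℚ_[p]) ^ k * a := ⟨⟨_, hu⟩, rfl⟩
  obtain ⟨c, hc⟩ := Ideal.mem_span_singleton'.1 (PadicInt.appr_spec k u)
  refine ⟨(u.appr k : ℚ) / (p : ℚ) ^ k, ⟨_, k, rfl⟩, ?_⟩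
  have h := congrArg (fun z : ℤ_[p] ↦ (z : ℚ_[p])) hc
  simp only [PadicInt.coe_mul, PadicInt.coe_pow, PadicInt.coe_natCast, PadicInt.coe_sub, hu'] at h
  have : a - (((u.appr k : ℚ) / (p : ℚ) ^ k : ℚ) : ℚ_[p]) = (c : ℚ_[p]) := by
    push_cast
    field_simp
    linear_combination -h
  rw [this]
  exact c.2

/-- A polar part `{a}` of a `p`-adic number: an element of `ℤ[1/p]` with `a - {a} ∈ ℤ_p`. It is
unique up to adding an integer, so that `exp(2πi{a})` does not depend on the choice. -/
def polarPart (p : ℕ) [Fact p.Prime] (a : ℚ_[p]) : ℚ :=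
  (exists_polar p a).choose

variable {K : Type*} [Field K] [NumberField K] (v : HeightOneSpectrum (𝓞 K))

theorem norm_intCast_le_one (n : ℤ) : ‖(n : v.adicCompletion K)‖ ≤ 1 := by
  simpa using FinitePlace.norm_le_one K v (n : 𝓞 K)

theorem norm_prime_lt_one (p : ℕ) (hv : (p : 𝓞 K) ∈ v.asIdeal) :
    ‖(p : v.adicCompletion K)‖ < 1 := by
  simpa using (FinitePlace.norm_lt_one_iff_mem K v (p : 𝓞 K)).2 hv

theorem norm_natCast_eq_one (p : ℕ) [hp : Fact p.Prime] (hv : (p : 𝓞 K) ∈ v.asIdeal) (n : ℕ)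
    (hn : ¬ p ∣ n) : ‖(n : v.adicCompletion K)‖ = 1 := by
  have h : (n : 𝓞 K) ∉ v.asIdeal := by
    intro hmem
    obtain ⟨a, b, hab⟩ := Nat.isCoprime_iff_coprime.2
      ((Nat.Prime.coprime_iff_not_dvd hp.out).2 hn)
    refine v.isPrime.ne_top ((Ideal.eq_top_iff_one _).2 ?_)
    have h1 : (a : 𝓞 K) * (p : 𝓞 K) + (b : 𝓞 K) * (n : 𝓞 K) = 1 := by exact_mod_cast hab
    rw [← h1]
    exact v.asIdeal.add_mem (v.asIdeal.mul_mem_left _ hv) (v.asIdeal.mul_mem_left _ hmem)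
  simpa using (FinitePlace.norm_eq_one_iff_notMem K v (n : 𝓞 K)).2 h

theorem norm_ratCast_le_one (p : ℕ) [hp : Fact p.Prime] (hv : (p : 𝓞 K) ∈ v.asIdeal) (q : ℚ)
    (hq : ‖(q : ℚ_[p])‖ ≤ 1) : ‖algebraMap ℚ (v.adicCompletion K) q‖ ≤ 1 := by
  have hd : ¬ p ∣ q.den := by
    rw [Padic.norm_rat_le_one_iff_padicValuation_le_one, Rat.padicValuation_le_one_iff] at hq
    exact hq
  have h1 := norm_natCast_eq_one v p hv q.den hd
  have h2 := norm_intCast_le_one v q.num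
  rw [← Rat.num_div_den q, map_div₀, map_intCast, map_natCast, norm_div, h1, div_one]
  exact h2

/-- The inclusion of `ℚ`, with the `p`-adic topology, in the completion at a place above `p`. -/
def ratHom (p : ℕ) [Fact p.Prime] :
    WithVal (Rat.padicValuation p) →+* v.adicCompletion K :=
  (algebraMap ℚ (v.adicCompletion K)).comp (WithVal.equiv (Rat.padicValuation p)).toRingHom

theorem continuous_ratHom (p : ℕ) [hp : Fact p.Prime] (hv : (p : 𝓞 K) ∈ v.asIdeal) :
    Continuous (ratHom v p) := by
  have hp0 : (0 : ℝ) < p := by exact_mod_cast hp.out.pos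
  have hpQ : (p : ℚ) ≠ 0 := by exact_mod_cast hp.out.ne_zero
  refine continuous_of_continuousAt_zero (ratHom v p) ?_
  have hnhds : 𝓝 (0 : v.adicCompletion K) = Filter.comap norm (𝓝 0) := by
    simp
  rw [ContinuousAt, map_zero, hnhds, Filter.tendsto_comap_iff,
    Padic.isUniformInducing_cast_withVal.isInducing.nhds_eq_comap 0, map_zero,
    (Metric.nhds_basis_ball.comap _).tendsto_iff Metric.nhds_basis_ball]
  intro ε hε
  obtain ⟨n, hn⟩ := exists_pow_lt_of_lt_one hε (norm_prime_lt_one v p hv)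
  refine ⟨((p : ℝ) ^ n)⁻¹, by positivity, fun x hx ↦ ?_⟩
  obtain ⟨q, rfl⟩ := (WithVal.equiv (Rat.padicValuation p)).symm.surjective x
  have hq : ‖(q : ℚ_[p])‖ < ((p : ℝ) ^ n)⁻¹ := by simpa using hx
  have hq' : ‖((q / (p : ℚ) ^ n : ℚ) : ℚ_[p])‖ ≤ 1 := by
    push_cast
    rw [norm_div, norm_pow, Padic.norm_p, inv_pow]
    exact (div_le_one (by positivity)).2 hq.le
  have h1 := norm_ratCast_le_one v p hv _ hq'
  have h2 : algebraMap ℚ (v.adicCompletion K) q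
      = algebraMap ℚ (v.adicCompletion K) (q / (p : ℚ) ^ n) * (p : v.adicCompletion K) ^ n := by
    rw [← map_natCast (algebraMap ℚ (v.adicCompletion K)) p, ← map_pow, ← map_mul,
      div_mul_cancel₀ _ (pow_ne_zero _ hpQ)]
  have h3 : ‖algebraMap ℚ (v.adicCompletion K) q‖ < ε := by
    rw [h2, norm_mul, norm_pow]
    exact (mul_le_of_le_one_left (by positivity) h1).trans_lt hn
  simpa [ratHom] using h3

/-- The canonical embedding of `ℚ_p` in the completion at a place above `p`: the continuous
extension of the inclusion of `ℚ`. -/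
def padicHom (p : ℕ) [Fact p.Prime] (hv : (p : 𝓞 K) ∈ v.asIdeal) :
    ℚ_[p] →+* v.adicCompletion K :=
  (UniformSpace.Completion.extensionHom (ratHom v p) (continuous_ratHom v p hv)).comp
    (Padic.withValRingEquiv (p := p)).symm.toRingHom

/-- The trace of the completion at a place above `p` down to `ℚ_p`. -/
def finiteTrace (p : ℕ) [Fact p.Prime] (hv : (p : 𝓞 K) ∈ v.asIdeal) (x : v.adicCompletion K) :
    ℚ_[p] :=
  letI : Algebra ℚ_[p] (v.adicCompletion K) := (padicHom v p hv).toAlgebra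
  Algebra.trace ℚ_[p] (v.adicCompletion K) x

/-- The data at a finite place above `p`: the absolute value for which a uniformizer has module
`1/q` with `q` the cardinality of the residue field, the character `λ(x) = exp(2πi{Tr x})`, and the
locally constant functions with compact support. -/
def finiteData (p : ℕ) [Fact p.Prime] (hv : (p : 𝓞 K) ∈ v.asIdeal) :
    LocalData (v.adicCompletion K) where
  module x := ‖x‖
  character x := Complex.exp (2 * Real.pi * Complex.I * (polarPart p (finiteTrace v p hv x) : ℚ))
  schwartz := {φ | IsLocallyConstant φ ∧ HasCompactSupport φ}

end Finite

end Conductor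

end

noncomputable section

namespace Conductor

set_option linter.unusedSectionVars false

/-! ### Closures of symmetric operators -/

section Operators

variable {E : Type*} [NormedAddCommGroup E] [InnerProductSpace ℂ E]

/-! Write `H = A + ℱ A ℱ⁻¹`, with `A` the multiplication by `log |x|`. A dilation shifts `log |x|`
by a constant on the one side and by the opposite constant on the Fourier side, so `H` commutes with
all `U(t)` (`conductor_dilation`). It should therefore be a multiplicative convolution operator, and
the heart of the proof is to find its kernel. Frullani's integral expresses `log |y|` as an average
of `G(t) - G(ty)` over `d*t`, for a radial test function `G`. Fubini's theorem and the
multiplication formula then show that the Fourier transform of `log |y|` is `-κ/|u|` away from the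
origin, with `κ ≥ 0` (`exists_integral_logMul`). Evaluating `H` at `x = 1`, and transporting the
result by dilations, gives on `𝒮₀` `H = c + κ ∫ k(t) (1 - U(t)) d*t`, where `k(t) = |t|^(1/2) / |1 -
t|` (`exists_conductor_eq`, and `exists_inner_conductorL2_eq` in weak form). The singularity of `k`
at `t = 1` is harmless on test functions because `k(t) min(1, |1 - t|)` is integrable for `d*t`.

The main properties follow from this formula. As `k` and `κ` are nonnegative and `1 - U(t)` has
nonnegative real part, `H` is bounded below. As `k(1/t) = k(t)` and `I U(t) I = U(1/t)`, `H`
commutes with the Inversion. For essential self-adjointness, let `R` be an average of the `U(t)`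
over a bump near `t = 1`. Then `‖R (1 - U(s))‖ = O(min(1, |1 - s|))`, so `R H` is bounded; `R`
commutes with `H` and its adjoint, and tends strongly to the identity as the bump shrinks. Hence
every vector of the domain of the adjoint is approximated in graph norm from the domain of the
closure (`isEssentiallySelfAdjoint_of_regularizing`).

The operator is unbounded because a translation far away makes the `log |x|` term large and only
multiplies the inverse Fourier transform by a character. The Fourier transform commutes with `H` on
`𝒮` since `ℱ²` is the reflection and `log |x|` is even. It need not preserve `𝒮₀`, but `H` on `𝒮` is
a symmetric extension of an essentially self-adjoint operator and has the same closure.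

All this is done for abstract data satisfying `LocalData.Admissible`. These axioms, and the
existence of a self-dual measure, are then checked at infinite places through `ℝ` or `ℂ`
(`IsArchimedeanModel`), and at finite places by ultrametric geometry (`IsUltrametricModel`). -/

theorem mem_graph_iff_exists {T : E →ₗ.[ℂ] E} {x y : E} :
    (x, y) ∈ T.graph ↔ ∃ hx : x ∈ T.domain, T ⟨x, hx⟩ = y := by
  rw [LinearPMap.mem_graph_iff]
  constructor
  · rintro ⟨z, h1, h2⟩
    dsimp at h1 h2
    subst h1
    exact ⟨z.2, h2⟩
  · rintro ⟨hx, h⟩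
    exact ⟨⟨x, hx⟩, rfl, h⟩

/-- In terms of graphs, domains and values are treated together, and the passage to the closure
becomes purely topological. -/
theorem commutesWith_iff_graph {T : E →ₗ.[ℂ] E} {U : E ≃ₗᵢ[ℂ] E} :
    CommutesWith T U ↔ ∀ x y, (U x, U y) ∈ T.graph ↔ (x, y) ∈ T.graph := by
  simp only [mem_graph_iff_exists]
  constructor
  · rintro ⟨h1, h2⟩ x y
    constructor
    · rintro ⟨hx, h⟩
      refine ⟨(h1 x).1 hx, U.injective ?_⟩
      rw [← h2 x ((h1 x).1 hx) hx, h]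
    · rintro ⟨hx, h⟩
      exact ⟨(h1 x).2 hx, by rw [h2 x hx, h]⟩
  · intro h
    refine ⟨fun x ↦ ⟨fun hx ↦ ?_, fun hx ↦ ?_⟩, fun x hx hUx ↦ ?_⟩
    · exact ((h x (U.symm (T ⟨U x, hx⟩))).1 ⟨hx, by simp⟩).1
    · exact ((h x (T ⟨x, hx⟩)).2 ⟨hx, rfl⟩).1
    · exact ((h x (T ⟨x, hx⟩)).2 ⟨hx, rfl⟩).2

/-- The map `U × U` is a homeomorphism of `E × E` preserving the graph, hence also the closure of
the graph. -/
theorem CommutesWith.closure {T : E →ₗ.[ℂ] E} {U : E ≃ₗᵢ[ℂ] E} (h : CommutesWith T U)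
    (hT : T.IsClosable) : CommutesWith T.closure U := by
  rw [commutesWith_iff_graph] at h ⊢
  intro x y
  rw [← hT.graph_closure_eq_closure_graph, ← SetLike.mem_coe, ← SetLike.mem_coe,
    Submodule.topologicalClosure_coe]
  let V : E × E ≃ₜ E × E := U.toHomeomorph.prodCongr U.toHomeomorph
  have hpre : V ⁻¹' (T.graph : Set (E × E)) = T.graph := by
    ext ⟨a, b⟩
    exact h a b
  have := V.preimage_closure (T.graph : Set (E × E))
  rw [hpre] at this
  exact Set.ext_iff.1 this (x, y)

variable [CompleteSpace E] {T : E →ₗ.[ℂ] E}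

theorem isClosable_of_symmetric (hd : Dense (T.domain : Set E)) (hs : T.IsFormalAdjoint T) :
    T.IsClosable :=
  LinearPMap.isClosable_iff_exists_closed_extension.2
    ⟨_, LinearPMap.adjoint_isClosed hd, hs.le_adjoint hd⟩

theorem adjoint_antitone {S T : E →ₗ.[ℂ] E} (hd : Dense (S.domain : Set E)) (h : S ≤ T) :
    T.adjoint ≤ S.adjoint := by
  have hT : Dense (T.domain : Set E) := hd.mono h.1
  refine LinearPMap.IsFormalAdjoint.le_adjoint hd fun x y ↦ ?_
  have h1 : S x = T ⟨x, h.1 x.2⟩ := h.2 rfl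
  rw [h1]
  exact (LinearPMap.adjoint_isFormalAdjoint hT).symm ⟨x, h.1 x.2⟩ y

theorem closure_le_adjoint (hd : Dense (T.domain : Set E)) (hs : T.IsFormalAdjoint T) :
    T.closure ≤ T.adjoint := by
  refine LinearPMap.le_of_le_graph ?_
  rw [← (isClosable_of_symmetric hd hs).graph_closure_eq_closure_graph]
  exact T.graph.topologicalClosure_minimal (LinearPMap.le_graph_of_le (hs.le_adjoint hd))
    (LinearPMap.adjoint_isClosed hd)

/-- For fixed `y`, the relation `⟨Tx, y⟩ = ⟨x, T†y⟩` is a closed condition on the pair `(x, Tx)`, so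
it persists on the closure of the graph. -/
theorem adjoint_closure (hd : Dense (T.domain : Set E)) (hs : T.IsFormalAdjoint T) :
    T.closure.adjoint = T.adjoint := by
  refine le_antisymm (adjoint_antitone hd T.le_closure) ?_
  refine LinearPMap.IsFormalAdjoint.le_adjoint (hd.mono T.le_closure.1) fun x y ↦ ?_
  have hx : ((x : E), T.closure x) ∈ T.graph.topologicalClosure := by
    rw [(isClosable_of_symmetric hd hs).graph_closure_eq_closure_graph]
    exact LinearPMap.mem_graph _ x
  rw [← SetLike.mem_coe, Submodule.topologicalClosure_coe] at hx
  have hc : _root_.IsClosed {p : E × E | inner ℂ p.2 (y : E) = inner ℂ p.1 (T.adjoint y)} :=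
    isClosed_eq (by fun_prop) (by fun_prop)
  refine closure_minimal (fun p hp ↦ ?_) hc hx
  obtain ⟨h1, h2⟩ := mem_graph_iff_exists.1 (show (p.1, p.2) ∈ T.graph from hp)
  have := (LinearPMap.adjoint_isFormalAdjoint hd).symm ⟨p.1, h1⟩ y
  rwa [h2] at this

theorem isEssentiallySelfAdjoint_of_adjoint_le (hd : Dense (T.domain : Set E))
    (hs : T.IsFormalAdjoint T) (h : T.adjoint ≤ T.closure) : IsEssentiallySelfAdjoint T :=
  ⟨hd, hs, by
    rw [LinearPMap.isSelfAdjoint_def, adjoint_closure hd hs]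
    exact le_antisymm h (closure_le_adjoint hd hs)⟩

/-- A symmetric extension of an essentially self-adjoint operator has the same closure. -/
theorem IsEssentiallySelfAdjoint.closure_eq {T₀ : E →ₗ.[ℂ] E} (h₀ : IsEssentiallySelfAdjoint T₀)
    (hle : T₀ ≤ T) (hs : T.IsFormalAdjoint T) : T.closure = T₀.closure := by
  have hd : Dense (T.domain : Set E) := h₀.1.mono hle.1
  refine le_antisymm ?_ ((isClosable_of_symmetric hd hs).closure_mono hle)
  -- The chain is: closure of `T` ≤ `T†` ≤ `T₀†` = adjoint of the closure of `T₀` = closure of `T₀`.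
  refine (closure_le_adjoint hd hs).trans ((adjoint_antitone h₀.1 hle).trans ?_)
  rw [← adjoint_closure h₀.1 h₀.2.1, LinearPMap.isSelfAdjoint_def.1 h₀.2.2]

/-- A symmetric operator is essentially self-adjoint if there are regularizing operators which
commute with it and its adjoint and converge strongly to the identity. -/
theorem isEssentiallySelfAdjoint_of_regularizing (hd : Dense (T.domain : Set E))
    (hs : T.IsFormalAdjoint T) (R : ℕ → E →L[ℂ] E)
    (hR : ∀ x, Filter.Tendsto (fun m ↦ R m x) Filter.atTop (𝓝 x))
    (hcl : ∀ m, ∀ f : T.domain, (R m f, R m (T f)) ∈ T.graph.topologicalClosure)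
    (hbd : ∀ m, ∃ C : ℝ, ∀ f : T.domain, ‖R m (T f)‖ ≤ C * ‖(f : E)‖)
    (hadj : ∀ m, ∀ x : T.adjoint.domain, ∀ f : T.domain,
      inner ℂ (R m (T.adjoint x)) (f : E) = inner ℂ (R m x) (T f)) :
    IsEssentiallySelfAdjoint T := by
  refine isEssentiallySelfAdjoint_of_adjoint_le hd hs (LinearPMap.le_of_le_graph ?_)
  rintro ⟨x, y⟩ hxy
  obtain ⟨hx, rfl⟩ := mem_graph_iff_exists.1 hxy
  rw [← (isClosable_of_symmetric hd hs).graph_closure_eq_closure_graph]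
  have hclosed : _root_.IsClosed (T.graph.topologicalClosure : Set (E × E)) :=
    T.graph.isClosed_topologicalClosure
  have key : ∀ m, (R m x, R m (T.adjoint ⟨x, hx⟩)) ∈ T.graph.topologicalClosure := by
    intro m
    obtain ⟨C, hC⟩ := hbd m
    obtain ⟨f, hf, hfx⟩ := mem_closure_iff_seq_limit.1 (hd x)
    -- The sequence `T (f j)` need not converge, but `R m ∘ T` is bounded, so its values along `f j
    -- → x` form a Cauchy sequence.
    let g : ℕ → E := fun j ↦ R m (T ⟨f j, hf j⟩)
    have hdiff : ∀ i j, ‖g i - g j‖ ≤ C * ‖f i - f j‖ := by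
      intro i j
      have h1 := hC (⟨f i, hf i⟩ - ⟨f j, hf j⟩)
      rw [LinearPMap.map_sub, map_sub] at h1
      exact h1
    have hcau : CauchySeq g := by
      have h1 : CauchySeq f := hfx.cauchySeq
      rw [Metric.cauchySeq_iff] at h1 ⊢
      intro ε hε
      obtain ⟨N, hN⟩ := h1 (ε / (|C| + 1)) (by positivity)
      refine ⟨N, fun i hi j hj ↦ ?_⟩
      have h2 := hN i hi j hj
      rw [dist_eq_norm] at h2 ⊢
      calc ‖g i - g j‖ ≤ C * ‖f i - f j‖ := hdiff i j
        _ ≤ (|C| + 1) * ‖f i - f j‖ := by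
            gcongr
            linarith [le_abs_self C]
        _ < (|C| + 1) * (ε / (|C| + 1)) := by gcongr
        _ = ε := by field_simp
    obtain ⟨η, hη⟩ := cauchySeq_tendsto_of_complete hcau
    have hmem : (R m x, η) ∈ T.graph.topologicalClosure :=
      hclosed.mem_of_tendsto ((((R m).continuous.tendsto x).comp hfx).prodMk_nhds hη)
        (Filter.Eventually.of_forall fun j ↦ hcl m ⟨f j, hf j⟩)
    -- The closure is contained in the adjoint, so `η` is the adjoint applied to `R m x`; tested
    -- against the dense domain this agrees with `R m (T† x)` by `hadj`.
    have hη' : η = R m (T.adjoint ⟨x, hx⟩) := by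
      refine hd.eq_of_inner_left ℂ fun v hv ↦ ?_
      rw [hadj m ⟨x, hx⟩ ⟨v, hv⟩]
      have h3 := LinearPMap.le_graph_of_le (closure_le_adjoint hd hs)
        ((isClosable_of_symmetric hd hs).graph_closure_eq_closure_graph ▸ hmem)
      obtain ⟨h4, h5⟩ := mem_graph_iff_exists.1 h3
      have h6 := LinearPMap.adjoint_isFormalAdjoint hd ⟨R m x, h4⟩ ⟨v, hv⟩
      rwa [h5] at h6
    rwa [← hη']
  exact hclosed.mem_of_tendsto ((hR x).prodMk_nhds (hR _)) (Filter.Eventually.of_forall key)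

end Operators

/-! ### The multiplicative Haar measure of a normed field -/

section MulHaar

variable {F : Type*} [NormedField F] [ProperSpace F] [MeasurableSpace F] [BorelSpace F]

/-- The measure `μ` is an additive Haar measure of a nontrivially normed field, for which the
multiplication with `a` has the module `‖a‖ ^ n`. -/
structure HasModule (μ : Measure F) (n : ℕ) : Prop where
  isAddHaarMeasure : μ.IsAddHaarMeasure
  n_pos : 0 < n
  exists_one_lt_norm : ∃ x : F, 1 < ‖x‖
  map_mul : ∀ a : F, a ≠ 0 → μ.map (fun x ↦ a * x) = ENNReal.ofReal ((‖a‖ ^ n)⁻¹) • μ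

/-- The multiplicative Haar measure `d*t = dt / |t|`, as a measure on the field. -/
def mulHaar (μ : Measure F) (n : ℕ) : Measure F :=
  μ.withDensity fun t ↦ ENNReal.ofReal ((‖t‖ ^ n)⁻¹)

instance (μ : Measure F) [SFinite μ] (n : ℕ) : SFinite (mulHaar μ n) := by
  unfold mulHaar; infer_instance

theorem measurable_density (n : ℕ) : Measurable fun t : F ↦ ENNReal.ofReal ((‖t‖ ^ n)⁻¹) := by
  fun_prop

theorem lintegral_mulHaar (μ : Measure F) (n : ℕ) {f : F → ENNReal} (hf : Measurable f) :
    ∫⁻ t, f t ∂(mulHaar μ n) = ∫⁻ t, ENNReal.ofReal ((‖t‖ ^ n)⁻¹) * f t ∂μ := by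
  rw [mulHaar, lintegral_withDensity_eq_lintegral_mul _ (measurable_density n) hf]
  rfl

theorem integrable_mulHaar_iff {μ : Measure F} {n : ℕ} {E : Type*} [NormedAddCommGroup E]
    [NormedSpace ℝ E] {f : F → E} :
    Integrable f (mulHaar μ n) ↔ Integrable (fun t ↦ (‖t‖ ^ n)⁻¹ • f t) μ := by
  rw [mulHaar, integrable_withDensity_iff_integrable_smul' (measurable_density n)
    (Filter.Eventually.of_forall fun _ ↦ ENNReal.ofReal_lt_top)]
  refine integrable_congr (Filter.Eventually.of_forall fun t ↦ ?_)
  simp only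
  rw [ENNReal.toReal_ofReal (by positivity)]

theorem integral_mulHaar (μ : Measure F) (n : ℕ) {E : Type*} [NormedAddCommGroup E]
    [NormedSpace ℝ E] (f : F → E) :
    ∫ t, f t ∂(mulHaar μ n) = ∫ t, (‖t‖ ^ n)⁻¹ • f t ∂μ := by
  rw [mulHaar, integral_withDensity_eq_integral_toReal_smul (measurable_density n)
    (Filter.Eventually.of_forall fun _ ↦ ENNReal.ofReal_lt_top)]
  refine integral_congr_ae (Filter.Eventually.of_forall fun t ↦ ?_)
  simp only
  rw [ENNReal.toReal_ofReal (by positivity)]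

namespace HasModule

variable {μ : Measure F} {n : ℕ} (h : HasModule μ n)
include h

theorem lintegral_mul_left {a : F} (ha : a ≠ 0) {f : F → ENNReal} (hf : Measurable f) :
    ∫⁻ x, f (a * x) ∂μ = ENNReal.ofReal ((‖a‖ ^ n)⁻¹) * ∫⁻ x, f x ∂μ := by
  rw [← smul_eq_mul, ← lintegral_smul_measure, ← h.map_mul a ha,
    lintegral_map hf (measurable_const_mul a)]

theorem integral_mul_left {E : Type*} [NormedAddCommGroup E] [NormedSpace ℝ E] {a : F}
    (ha : a ≠ 0) (f : F → E) : ∫ x, f (a * x) ∂μ = (‖a‖ ^ n)⁻¹ • ∫ x, f x ∂μ := by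
  have h1 : ∫ x, f x ∂(μ.map (fun x ↦ a * x)) = ∫ x, f (a * x) ∂μ :=
    (Homeomorph.mulLeft₀ a ha).measurableEmbedding.integral_map f
  rw [← h1, h.map_mul a ha, integral_smul_measure, ENNReal.toReal_ofReal (by positivity)]

/-- A dilation by `a` with `1 < ‖a‖` fixes the origin, but multiplies its finite measure by a factor
less than `1`. -/
theorem measure_zero : μ {0} = 0 := by
  have := h.isAddHaarMeasure
  obtain ⟨a, ha⟩ := h.exists_one_lt_norm
  have ha0 : a ≠ 0 := norm_pos_iff.1 (by linarith)
  have h1 : μ.map (fun x ↦ a * x) {0} = μ {0} := by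
    rw [Measure.map_apply (measurable_const_mul a) (MeasurableSet.singleton 0)]
    congr 1
    ext x
    simp [ha0]
  rw [h.map_mul a ha0, Measure.smul_apply, smul_eq_mul] at h1
  by_contra h0
  have hfin : μ {0} ≠ ⊤ := isCompact_singleton.measure_ne_top
  have h2 : ENNReal.ofReal ((‖a‖ ^ n)⁻¹) < 1 := by
    rw [← ENNReal.ofReal_one]
    exact (ENNReal.ofReal_lt_ofReal_iff one_pos).2
      (inv_lt_one_of_one_lt₀ (one_lt_pow₀ ha h.n_pos.ne'))
  have h3 := (ENNReal.mul_lt_mul_iff_left h0 hfin).2 h2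
  rw [one_mul] at h3
  exact h3.ne h1

theorem ae_ne_zero : ∀ᵐ x ∂μ, x ≠ 0 := by
  rw [ae_iff]
  simpa using h.measure_zero

theorem mulHaar_absolutelyContinuous : mulHaar μ n ≪ μ := withDensity_absolutelyContinuous _ _

theorem absolutelyContinuous_mulHaar : μ ≪ mulHaar μ n := by
  refine withDensity_absolutelyContinuous' (measurable_density n).aemeasurable ?_
  filter_upwards [h.ae_ne_zero] with x hx
  simp [hx]

theorem ae_mulHaar_ne_zero : ∀ᵐ x ∂(mulHaar μ n), x ≠ 0 :=
  h.mulHaar_absolutelyContinuous h.ae_ne_zero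

theorem sigmaFinite : SigmaFinite μ := by
  have := h.isAddHaarMeasure
  infer_instance

theorem lintegral_mulHaar_mul_left {a : F} (ha : a ≠ 0) {f : F → ENNReal} (hf : Measurable f) :
    ∫⁻ x, f (a * x) ∂(mulHaar μ n) = ∫⁻ x, f x ∂(mulHaar μ n) := by
  have ha' : 0 < ‖a‖ := norm_pos_iff.2 ha
  have h1 : ∀ x, ENNReal.ofReal ((‖x‖ ^ n)⁻¹) * f (a * x)
      = ENNReal.ofReal (‖a‖ ^ n) * (ENNReal.ofReal ((‖a * x‖ ^ n)⁻¹) * f (a * x)) := by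
    intro x
    rw [← mul_assoc, ← ENNReal.ofReal_mul (by positivity), norm_mul, mul_pow, mul_inv,
      mul_inv_cancel_left₀ (by positivity)]
  rw [lintegral_mulHaar _ _ (f := fun x ↦ f (a * x)) (by fun_prop), lintegral_mulHaar _ _ hf]
  simp_rw [h1]
  rw [lintegral_const_mul _ (by fun_prop), h.lintegral_mul_left ha
    (f := fun x ↦ ENNReal.ofReal ((‖x‖ ^ n)⁻¹) * f x) (by fun_prop), ← mul_assoc,
    ← ENNReal.ofReal_mul (by positivity), mul_inv_cancel₀ (by positivity), ENNReal.ofReal_one,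
    one_mul]

theorem measurePreserving_mul_left {a : F} (ha : a ≠ 0) :
    MeasurePreserving (fun x ↦ a * x) (mulHaar μ n) (mulHaar μ n) := by
  refine ⟨measurable_const_mul a, Measure.ext fun s hs ↦ ?_⟩
  rw [← lintegral_indicator_one hs, ← lintegral_indicator_one hs,
    lintegral_map (by fun_prop (disch := assumption)) (measurable_const_mul a)]
  exact h.lintegral_mulHaar_mul_left ha (measurable_const.indicator hs)

theorem mulHaar_closedBall_diff_lt_top {r : ℝ} (hr : 0 < r) (R : ℝ) :
    mulHaar μ n {x | r ≤ ‖x‖ ∧ ‖x‖ ≤ R} < ⊤ := by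
  have := h.isAddHaarMeasure
  have hm : MeasurableSet {x : F | r ≤ ‖x‖ ∧ ‖x‖ ≤ R} := by measurability
  rw [mulHaar, withDensity_apply _ hm]
  calc _ ≤ ∫⁻ _ in {x : F | r ≤ ‖x‖ ∧ ‖x‖ ≤ R}, ENNReal.ofReal ((r ^ n)⁻¹) ∂μ := by
        refine setLIntegral_mono measurable_const fun x hx ↦ ENNReal.ofReal_le_ofReal ?_
        exact inv_anti₀ (by positivity) (by gcongr; exact hx.1)
    _ = ENNReal.ofReal ((r ^ n)⁻¹) * μ {x : F | r ≤ ‖x‖ ∧ ‖x‖ ≤ R} := by simp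
    _ < ⊤ := ENNReal.mul_lt_top ENNReal.ofReal_lt_top
        ((measure_mono fun x hx ↦ mem_closedBall_zero_iff.2 hx.2).trans_lt
          (isCompact_closedBall (0 : F) R).measure_lt_top)

/-- Provides a factor that can be cancelled in `lintegral_mulHaar_inv`. -/
theorem exists_annulus : ∃ g : F → ENNReal, Measurable g ∧ ∫⁻ x, g x ∂(mulHaar μ n) ≠ 0 ∧
    ∫⁻ x, g x ∂(mulHaar μ n) ≠ ⊤ := by
  have := h.isAddHaarMeasure
  have hm : MeasurableSet {x : F | 1 / 2 ≤ ‖x‖ ∧ ‖x‖ ≤ 2} := by measurability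
  refine ⟨_, measurable_one.indicator hm, ?_, ?_⟩
  · rw [lintegral_indicator_one hm]
    intro h0
    have h1 := h.absolutelyContinuous_mulHaar h0
    have ho : IsOpen {x : F | 1 / 2 < ‖x‖ ∧ ‖x‖ < 2} :=
      (isOpen_lt continuous_const continuous_norm).inter (isOpen_lt continuous_norm continuous_const)
    refine (ho.measure_pos μ ⟨1, by norm_num⟩).ne' (measure_mono_null (fun x hx ↦ ?_) h1)
    exact ⟨hx.1.le, hx.2.le⟩
  · rw [lintegral_indicator_one hm]
    exact (h.mulHaar_closedBall_diff_lt_top (by norm_num) _).ne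

/-- The usual proof that an abelian group is unimodular under inversion: Tonelli's theorem and
invariance in each variable give `key`, from which a common factor is cancelled. -/
theorem lintegral_mulHaar_inv {f : F → ENNReal} (hf : Measurable f) :
    ∫⁻ x, f x⁻¹ ∂(mulHaar μ n) = ∫⁻ x, f x ∂(mulHaar μ n) := by
  have := h.sigmaFinite
  set ν := mulHaar μ n
  have key : ∀ f g : F → ENNReal, Measurable f → Measurable g →
      (∫⁻ x, f x⁻¹ ∂ν) * ∫⁻ x, g x ∂ν = (∫⁻ x, f x⁻¹ ∂ν) * ∫⁻ x, g x⁻¹ ∂ν := by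
    intro f g hf hg
    calc (∫⁻ x, f x⁻¹ ∂ν) * ∫⁻ x, g x ∂ν
        = ∫⁻ t, ∫⁻ s, f t⁻¹ * g s ∂ν ∂ν := by
          rw [← lintegral_mul_const _ (by fun_prop)]
          refine lintegral_congr fun t ↦ ?_
          rw [lintegral_const_mul _ hg]
      _ = ∫⁻ t, ∫⁻ s, f t⁻¹ * g (t⁻¹ * s) ∂ν ∂ν := by
          refine lintegral_congr_ae ?_
          filter_upwards [h.ae_mulHaar_ne_zero] with t ht
          exact (h.lintegral_mulHaar_mul_left (inv_ne_zero ht)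
            (f := fun s ↦ f t⁻¹ * g s) (by fun_prop)).symm
      _ = ∫⁻ s, ∫⁻ t, f t⁻¹ * g (t⁻¹ * s) ∂ν ∂ν :=
          lintegral_lintegral_swap (by fun_prop)
      _ = ∫⁻ s, ∫⁻ t, f (s * t)⁻¹ * g ((s * t)⁻¹ * s) ∂ν ∂ν := by
          refine lintegral_congr_ae ?_
          filter_upwards [h.ae_mulHaar_ne_zero] with s hs
          exact (h.lintegral_mulHaar_mul_left hs
            (f := fun t ↦ f t⁻¹ * g (t⁻¹ * s)) (by fun_prop)).symm
      _ = ∫⁻ s, ∫⁻ t, f (s * t)⁻¹ * g t⁻¹ ∂ν ∂ν := by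
          refine lintegral_congr_ae ?_
          filter_upwards [h.ae_mulHaar_ne_zero] with s hs
          refine lintegral_congr fun t ↦ ?_
          congr 2
          field_simp
      _ = ∫⁻ t, ∫⁻ s, f (s * t)⁻¹ * g t⁻¹ ∂ν ∂ν :=
          lintegral_lintegral_swap (by fun_prop)
      _ = ∫⁻ t, ∫⁻ s, f s⁻¹ * g t⁻¹ ∂ν ∂ν := by
          refine lintegral_congr_ae ?_
          filter_upwards [h.ae_mulHaar_ne_zero] with t ht
          simp_rw [mul_comm _ t]
          exact h.lintegral_mulHaar_mul_left ht (f := fun s ↦ f s⁻¹ * g t⁻¹) (by fun_prop)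
      _ = (∫⁻ x, f x⁻¹ ∂ν) * ∫⁻ x, g x⁻¹ ∂ν := by
          rw [← lintegral_const_mul _ (by fun_prop)]
          refine lintegral_congr fun t ↦ ?_
          rw [lintegral_mul_const _ (by fun_prop)]
  obtain ⟨g, hg, hg0, hgt⟩ := h.exists_annulus
  -- With `g ∘ inv` in the first place, the common factor is `∫ g`, which is neither `0` nor `∞`.
  have h1 := key (fun x ↦ g x⁻¹) f (by fun_prop) hf
  simp only [inv_inv] at h1
  exact ((ENNReal.mul_right_inj hg0 hgt).1 h1).symm

theorem measurePreserving_inv :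
    MeasurePreserving (fun x : F ↦ x⁻¹) (mulHaar μ n) (mulHaar μ n) := by
  refine ⟨measurable_inv, Measure.ext fun s hs ↦ ?_⟩
  rw [← lintegral_indicator_one hs, ← lintegral_indicator_one hs,
    lintegral_map (measurable_one.indicator hs) measurable_inv]
  exact h.lintegral_mulHaar_inv (measurable_one.indicator hs)

end HasModule

end MulHaar

/-! ### An integrable weight -/

section Weight

variable {F : Type*} [NormedField F] [ProperSpace F] [MeasurableSpace F] [BorelSpace F]

/-- The weight `min (|t|, 1/|t|) ^ (1/2)`. -/
def weight (t : F) : ℝ := min √‖t‖ (√‖t‖)⁻¹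

theorem measurable_weight : Measurable (weight : F → ℝ) := by
  unfold weight; fun_prop

theorem weight_nonneg (t : F) : 0 ≤ weight t := by
  unfold weight; positivity

theorem weight_inv (t : F) : weight t⁻¹ = weight t := by
  simp [weight, min_comm]

theorem weight_of_le_one {t : F} (h0 : t ≠ 0) (h : ‖t‖ ≤ 1) : weight t = √‖t‖ := by
  have h1 : √‖t‖ ≤ 1 := Real.sqrt_le_one.2 h
  have h2 : 0 < √‖t‖ := Real.sqrt_pos.2 (norm_pos_iff.2 h0)
  exact min_eq_left (h1.trans ((one_le_inv₀ h2).2 h1))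

theorem weight_of_one_le {t : F} (h : 1 ≤ ‖t‖) : weight t = (√‖t‖)⁻¹ := by
  have h1 : 1 ≤ √‖t‖ := Real.one_le_sqrt.2 h
  exact min_eq_right ((inv_le_one_of_one_le₀ h1).trans h1)

theorem weight_le_one (t : F) : weight t ≤ 1 := by
  rcases le_total ‖t‖ 1 with h | h
  · exact (min_le_left _ _).trans (Real.sqrt_le_one.2 h)
  · rw [weight_of_one_le h]
    exact inv_le_one_of_one_le₀ (Real.one_le_sqrt.2 h)

theorem weight_sq_of_le_one {t : F} (h0 : t ≠ 0) (h : ‖t‖ ≤ 1) : weight t ^ 2 = ‖t‖ := by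
  rw [weight_of_le_one h0 h, Real.sq_sqrt (norm_nonneg _)]

theorem weight_sq_of_one_le {t : F} (h : 1 ≤ ‖t‖) : weight t ^ 2 = ‖t‖⁻¹ := by
  rw [weight_of_one_le h, inv_pow, Real.sq_sqrt (norm_nonneg _)]

/-- From `log r = 4 log r^(1/4) ≤ 4 r^(1/4)` one gets `log² r ≤ 16 r^(1/2)` for `r ≥ 1`; the
symmetry `t ↦ t⁻¹` does the rest. -/
theorem log_sq_mul_weight_le (t : F) : Real.log ‖t‖ ^ 2 * weight t ≤ 16 := by
  have key : ∀ r : ℝ, 1 ≤ r → Real.log r ^ 2 * (√r)⁻¹ ≤ 16 := by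
    intro r hr
    have h1 : 0 < √r := Real.sqrt_pos.2 (by linarith)
    have h2 : Real.log √√r = Real.log r / 4 := by
      rw [Real.log_sqrt (by positivity), Real.log_sqrt (by linarith)]
      ring
    have h3 : Real.log √√r ≤ √√r := Real.log_le_self (by positivity)
    have h4 : 0 ≤ Real.log r := Real.log_nonneg hr
    have h5 : √√r ^ 2 = √r := Real.sq_sqrt h1.le
    rw [mul_inv_le_iff₀ h1, ← h5]
    have h6 : Real.log r ≤ 4 * √√r := by linarith
    calc Real.log r ^ 2 ≤ (4 * √√r) ^ 2 := by gcongr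
      _ = 16 * √√r ^ 2 := by ring
  rcases eq_or_ne t 0 with rfl | h0
  · simp
  rcases le_total ‖t‖ 1 with h | h
  · rw [← weight_inv, weight_of_one_le (by rw [norm_inv]; exact (one_le_inv₀ (norm_pos_iff.2 h0)).2 h)]
    have := key ‖t⁻¹‖ (by rw [norm_inv]; exact (one_le_inv₀ (norm_pos_iff.2 h0)).2 h)
    rwa [norm_inv, Real.log_inv, neg_sq, ← norm_inv] at this
  · rw [weight_of_one_le h]
    exact key _ h

namespace HasModule

variable {μ : Measure F} {n : ℕ} (h : HasModule μ n)
include h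

/-- The punctured unit ball is covered by the shells `a⁻ᵏ A`, all of the same finite measure, and on
the `k`-th one `√‖x‖ ≤ ρ^(k/2)`; the geometric series converges. The outside of the ball follows by
inversion. -/
theorem integrable_weight : Integrable (weight : F → ℝ) (mulHaar μ n) := by
  obtain ⟨a, ha⟩ := h.exists_one_lt_norm
  have ha0 : a ≠ 0 := norm_pos_iff.1 (by linarith)
  set ρ : ℝ := ‖a‖⁻¹
  have hρ0 : 0 < ρ := by positivity
  have hρ1 : ρ < 1 := inv_lt_one_of_one_lt₀ ha
  let A : Set F := {x | ρ < ‖x‖ ∧ ‖x‖ ≤ 1}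
  have hA : MeasurableSet A := by measurability
  have hAfin : mulHaar μ n A < ⊤ :=
    (measure_mono (t := {x | ρ ≤ ‖x‖ ∧ ‖x‖ ≤ 1}) fun x hx ↦ ⟨hx.1.le, hx.2⟩).trans_lt
      (h.mulHaar_closedBall_diff_lt_top hρ0 1)
  let s : ENNReal := ENNReal.ofReal √ρ
  have hs : s < 1 := by
    rw [← ENNReal.ofReal_one]
    exact (ENNReal.ofReal_lt_ofReal_iff one_pos).2 (by
      rw [Real.sqrt_lt' one_pos]; simpa using hρ1)
  let f : F → ENNReal := fun x ↦ ∑' k : ℕ, s ^ k * A.indicator 1 (a ^ k * x)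
  have hterm : ∀ k : ℕ, Measurable fun x : F ↦ A.indicator (1 : F → ENNReal) (a ^ k * x) :=
    fun k ↦ (measurable_one.indicator hA).comp (measurable_const_mul _)
  have hf : Measurable f :=
    Measurable.tsum fun k ↦ (hterm k).const_mul _
  have hfin : ∫⁻ x, f x ∂(mulHaar μ n) < ⊤ := by
    have h1 : ∀ k : ℕ, ∫⁻ x, s ^ k * A.indicator 1 (a ^ k * x) ∂(mulHaar μ n)
        = s ^ k * mulHaar μ n A := by
      intro k
      rw [lintegral_const_mul _ (hterm k), h.lintegral_mulHaar_mul_left (pow_ne_zero _ ha0)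
        (measurable_one.indicator hA), lintegral_indicator_one hA]
    rw [lintegral_tsum fun k ↦ ((hterm k).const_mul _).aemeasurable]
    simp_rw [h1]
    rw [ENNReal.tsum_mul_right, ENNReal.tsum_geometric]
    refine ENNReal.mul_lt_top ?_ hAfin
    rw [ENNReal.inv_lt_top]
    exact tsub_pos_of_lt hs
  have hle : ∀ x : F, x ≠ 0 → ‖x‖ ≤ 1 → ENNReal.ofReal √‖x‖ ≤ f x := by
    intro x hx0 hx
    obtain ⟨k, hk1, hk2⟩ := exists_nat_pow_near_of_lt_one (norm_pos_iff.2 hx0) hx hρ0 hρ1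
    have hmem : a ^ k * x ∈ A := by
      have h1 : ‖a ^ k * x‖ = (ρ ^ k)⁻¹ * ‖x‖ := by
        rw [norm_mul, norm_pow, inv_pow, inv_inv]
      constructor
      · rw [h1, lt_inv_mul_iff₀ (by positivity), ← pow_succ]
        exact hk1
      · rw [h1, inv_mul_le_iff₀ (by positivity), mul_one]
        exact hk2
    calc ENNReal.ofReal √‖x‖ ≤ s ^ k * A.indicator 1 (a ^ k * x) := by
          rw [Set.indicator_of_mem hmem, Pi.one_apply, mul_one,
            ← ENNReal.ofReal_pow (Real.sqrt_nonneg _)]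
          refine ENNReal.ofReal_le_ofReal ?_
          rw [Real.sqrt_le_left (by positivity), ← pow_mul, mul_comm, pow_mul,
            Real.sq_sqrt hρ0.le]
          exact hk2
      _ ≤ f x := ENNReal.le_tsum k
  refine ⟨measurable_weight.aestronglyMeasurable, ?_⟩
  rw [hasFiniteIntegral_iff_ofReal (Filter.Eventually.of_forall weight_nonneg)]
  calc ∫⁻ x, ENNReal.ofReal (weight x) ∂(mulHaar μ n)
      ≤ ∫⁻ x, f x + f x⁻¹ ∂(mulHaar μ n) := by
        refine lintegral_mono_ae ?_
        filter_upwards [h.ae_mulHaar_ne_zero] with x hx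
        rcases le_total ‖x‖ 1 with h1 | h1
        · rw [weight_of_le_one hx h1]
          exact (hle x hx h1).trans le_self_add
        · rw [weight_of_one_le h1, ← Real.sqrt_inv, ← norm_inv]
          refine (hle x⁻¹ (inv_ne_zero hx) ?_).trans le_add_self
          rw [norm_inv]
          exact inv_le_one_of_one_le₀ h1
    _ = ∫⁻ x, f x ∂(mulHaar μ n) + ∫⁻ x, f x ∂(mulHaar μ n) := by
        rw [lintegral_add_left hf, h.lintegral_mulHaar_inv hf]
    _ < ⊤ := ENNReal.add_lt_top.2 ⟨hfin, hfin⟩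

theorem integrable_mulHaar_of_le_weight {E : Type*} [NormedAddCommGroup E] {f : F → E} {C : ℝ}
    (hf : AEStronglyMeasurable f (mulHaar μ n)) (hC : ∀ t : F, t ≠ 0 → ‖f t‖ ≤ C * weight t) :
    Integrable f (mulHaar μ n) := by
  refine (h.integrable_weight.const_mul C).mono' hf ?_
  filter_upwards [h.ae_mulHaar_ne_zero] with t ht
  exact hC t ht

theorem integrable_iff_mulHaar {E : Type*} [NormedAddCommGroup E] [NormedSpace ℝ E] {f : F → E} :
    Integrable f μ ↔ Integrable (fun t ↦ ‖t‖ ^ n • f t) (mulHaar μ n) := by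
  rw [integrable_mulHaar_iff]
  refine integrable_congr ?_
  filter_upwards [h.ae_ne_zero] with t ht
  rw [inv_smul_smul₀ (pow_ne_zero _ (norm_ne_zero_iff.2 ht))]

theorem integral_eq_mulHaar {E : Type*} [NormedAddCommGroup E] [NormedSpace ℝ E] (f : F → E) :
    ∫ t, f t ∂μ = ∫ t, ‖t‖ ^ n • f t ∂(mulHaar μ n) := by
  rw [integral_mulHaar]
  refine integral_congr_ae ?_
  filter_upwards [h.ae_ne_zero] with t ht
  rw [inv_smul_smul₀ (pow_ne_zero _ (norm_ne_zero_iff.2 ht))]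

/-- The rapidly decreasing measurable functions are integrable, with room for a logarithm. -/
theorem integrable_log_sq_mul {φ : F → ℂ} (hm : Measurable φ)
    (hd : ∀ N : ℕ, ∃ C : ℝ, ∀ x, ‖x‖ ^ N * ‖φ x‖ ≤ C) :
    Integrable (fun x ↦ (1 + Real.log ‖x‖ ^ 2) * ‖φ x‖) μ := by
  obtain ⟨C₀, hC₀⟩ := hd 0
  -- Of the `n + 1` powers, `n` compensate the density of `μ` with respect to `d*t`, and one gives
  -- the decay `‖t‖⁻¹` at infinity.
  obtain ⟨C₁, hC₁⟩ := hd (n + 1)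
  have hC₀' : 0 ≤ C₀ := le_trans (by positivity) (hC₀ 0)
  have hC₁' : 0 ≤ C₁ := le_trans (by positivity) (hC₁ 0)
  rw [h.integrable_iff_mulHaar]
  refine h.integrable_mulHaar_of_le_weight (C := 17 * (C₀ + C₁)) (by fun_prop) fun t ht ↦ ?_
  have hw0 := weight_nonneg t
  have hw1 := weight_le_one t
  -- One factor `weight t` absorbs `1 + log²`, at the cost of `17 = 1 + 16`; the other one is
  -- integrable.
  have h1 : ‖t‖ ^ n * ‖φ t‖ ≤ (C₀ + C₁) * weight t ^ 2 := by
    have htp : 0 < ‖t‖ := norm_pos_iff.2 ht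
    rcases le_total ‖t‖ 1 with h1 | h1
    · rw [weight_sq_of_le_one ht h1]
      have h2 : ‖t‖ ^ n ≤ ‖t‖ := pow_le_of_le_one htp.le h1 h.n_pos.ne'
      have h3 := hC₀ t
      rw [pow_zero, one_mul] at h3
      calc ‖t‖ ^ n * ‖φ t‖ ≤ ‖t‖ * C₀ := by gcongr
        _ ≤ (C₀ + C₁) * ‖t‖ := by nlinarith
    · rw [weight_sq_of_one_le h1, ← div_eq_mul_inv, le_div_iff₀ htp]
      have h3 := hC₁ t
      rw [pow_succ] at h3
      linarith
  have h2 : (1 + Real.log ‖t‖ ^ 2) * weight t ≤ 17 := by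
    have := log_sq_mul_weight_le t
    linarith
  rw [norm_smul, norm_mul, norm_norm, norm_pow, norm_norm, Real.norm_of_nonneg (by positivity)]
  calc ‖t‖ ^ n * ((1 + Real.log ‖t‖ ^ 2) * ‖φ t‖)
      = (1 + Real.log ‖t‖ ^ 2) * (‖t‖ ^ n * ‖φ t‖) := by ring
    _ ≤ (1 + Real.log ‖t‖ ^ 2) * ((C₀ + C₁) * weight t ^ 2) := by gcongr
    _ = ((1 + Real.log ‖t‖ ^ 2) * weight t) * ((C₀ + C₁) * weight t) := by ring
    _ ≤ 17 * ((C₀ + C₁) * weight t) := by gcongr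
    _ = 17 * (C₀ + C₁) * weight t := by ring

end HasModule

end Weight

/-! ### Admissible local data -/

section Admissible

variable {F : Type*} [NormedField F] [ProperSpace F] [MeasurableSpace F] [BorelSpace F]

/-- The elementary properties of the module, the character, and the Schwartz-Bruhat functions which
are used in the study of the conductor operator. -/
structure LocalData.Admissible (D : LocalData F) (μ : Measure F) (n : ℕ) : Prop
    extends HasModule μ n where
  module_eq : ∀ x, D.module x = ‖x‖ ^ n
  character_add : ∀ x y, D.character (x + y) = D.character x * D.character y
  norm_character : ∀ x, ‖D.character x‖ = 1
  continuous_character : Continuous D.character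
  add_mem : ∀ φ ∈ D.schwartz, ∀ ψ ∈ D.schwartz, (fun x ↦ φ x + ψ x) ∈ D.schwartz
  smul_mem : ∀ c : ℂ, ∀ φ ∈ D.schwartz, (fun x ↦ c * φ x) ∈ D.schwartz
  lipschitz : ∀ φ ∈ D.schwartz, ∃ C : ℝ, ∀ x y, ‖φ x - φ y‖ ≤ C * ‖x - y‖
  decay : ∀ φ ∈ D.schwartz, ∀ N : ℕ, ∃ C : ℝ, ∀ x, ‖x‖ ^ N * ‖φ x‖ ≤ C
  translate_mem : ∀ φ ∈ D.schwartz, ∀ a, (fun x ↦ φ (x + a)) ∈ D.schwartz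
  dilate_mem : ∀ φ ∈ D.schwartz, ∀ a, a ≠ 0 → (fun x ↦ φ (a * x)) ∈ D.schwartz
  fourier_mem : ∀ φ ∈ D.schwartz, D.fourier μ φ ∈ D.schwartz
  inversion_mem : ∀ φ ∈ D.schwartzZero, D.inversion φ ∈ D.schwartz
  separates : ∀ g : F → ℂ, LocallyIntegrable g μ →
    (∀ ψ ∈ D.schwartzZero, ∫ x, g x * ψ x ∂μ = 0) → g =ᵐ[μ] 0
  exists_radial : ∃ G : F → ℝ, (fun x ↦ (G x : ℂ)) ∈ D.schwartz ∧ G 0 = 1 ∧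
    ∀ x y, ‖x‖ ≤ ‖y‖ → G y ≤ G x

namespace LocalData.Admissible

variable {D : LocalData F} {μ : Measure F} {n : ℕ} (h : D.Admissible μ n)
include h

theorem character_zero : D.character 0 = 1 := by
  have h1 := h.character_add 0 0
  rw [add_zero] at h1
  have h2 : D.character 0 ≠ 0 := norm_ne_zero_iff.1 (by rw [h.norm_character]; exact one_ne_zero)
  exact (mul_eq_left₀ h2).1 h1.symm

theorem conj_character (x : F) : (starRingEnd ℂ) (D.character x) = D.character (-x) := by
  have h1 : D.character x * D.character (-x) = 1 := by
    rw [← h.character_add, add_neg_cancel, h.character_zero]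
  rw [← Complex.inv_eq_conj (h.norm_character x)]
  exact inv_eq_of_mul_eq_one_right h1

theorem continuous_of_mem {φ : F → ℂ} (hφ : φ ∈ D.schwartz) : Continuous φ := by
  obtain ⟨C, hC⟩ := h.lipschitz φ hφ
  refine (LipschitzWith.of_dist_le_mul (K := C.toNNReal) fun x y ↦ ?_).continuous
  rw [dist_eq_norm, dist_eq_norm]
  exact (hC x y).trans (by gcongr; exact Real.le_coe_toNNReal C)

theorem exists_bound {φ : F → ℂ} (hφ : φ ∈ D.schwartz) : ∃ C : ℝ, 0 ≤ C ∧ ∀ x, ‖φ x‖ ≤ C := by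
  obtain ⟨C, hC⟩ := h.decay φ hφ 0
  simp only [pow_zero, one_mul] at hC
  exact ⟨C, (norm_nonneg _).trans (hC 0), hC⟩

theorem integrable_log_sq_mul_of_mem {φ : F → ℂ} (hφ : φ ∈ D.schwartz) :
    Integrable (fun x ↦ (1 + Real.log ‖x‖ ^ 2) * ‖φ x‖) μ :=
  h.integrable_log_sq_mul (h.continuous_of_mem hφ).measurable (h.decay φ hφ)

theorem integrable_of_mem {φ : F → ℂ} (hφ : φ ∈ D.schwartz) : Integrable φ μ := by
  refine (h.integrable_log_sq_mul_of_mem hφ).mono'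
    (h.continuous_of_mem hφ).aestronglyMeasurable (Filter.Eventually.of_forall fun x ↦ ?_)
  have : 0 ≤ Real.log ‖x‖ ^ 2 := sq_nonneg _
  nlinarith [norm_nonneg (φ x)]

theorem measurable_logMul {φ : F → ℂ} (hφ : Measurable φ) : Measurable (D.logMul φ) := by
  unfold LocalData.logMul
  simp_rw [h.module_eq]
  fun_prop

theorem logMul_apply (φ : F → ℂ) (x : F) :
    D.logMul φ x = (n * Real.log ‖x‖ : ℝ) * φ x := by
  rw [LocalData.logMul, h.module_eq, Real.log_pow]

theorem norm_logMul_le (φ : F → ℂ) (x : F) :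
    ‖D.logMul φ x‖ ≤ n * ((1 + Real.log ‖x‖ ^ 2) * ‖φ x‖) := by
  rw [h.logMul_apply, norm_mul, Complex.norm_real, norm_mul, Real.norm_natCast, mul_assoc]
  gcongr
  rw [Real.norm_eq_abs, abs_le]
  constructor <;> nlinarith [sq_nonneg (Real.log ‖x‖ - 1), sq_nonneg (Real.log ‖x‖ + 1)]

theorem integrable_logMul {φ : F → ℂ} (hφ : φ ∈ D.schwartz) : Integrable (D.logMul φ) μ :=
  ((h.integrable_log_sq_mul_of_mem hφ).const_mul (n : ℝ)).mono'
    (h.measurable_logMul (h.continuous_of_mem hφ).measurable).aestronglyMeasurable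
    (Filter.Eventually.of_forall (h.norm_logMul_le φ))

theorem memLp_of_mem {φ : F → ℂ} (hφ : φ ∈ D.schwartz) : MemLp φ 2 μ := by
  obtain ⟨C, hC0, hC⟩ := h.exists_bound hφ
  rw [memLp_two_iff_integrable_sq_norm (h.continuous_of_mem hφ).aestronglyMeasurable]
  refine ((h.integrable_of_mem hφ).norm.const_mul C).mono'
    ((h.continuous_of_mem hφ).norm.pow 2).aestronglyMeasurable
    (Filter.Eventually.of_forall fun x ↦ ?_)
  rw [norm_pow, norm_norm, sq]
  exact mul_le_mul_of_nonneg_right (hC x) (norm_nonneg _)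

theorem memLp_logMul {φ : F → ℂ} (hφ : φ ∈ D.schwartz) : MemLp (D.logMul φ) 2 μ := by
  obtain ⟨C, hC0, hC⟩ := h.exists_bound hφ
  have hm := h.measurable_logMul (h.continuous_of_mem hφ).measurable
  rw [memLp_two_iff_integrable_sq_norm hm.aestronglyMeasurable]
  refine ((h.integrable_log_sq_mul_of_mem hφ).const_mul (n ^ 2 * C)).mono'
    (hm.norm.pow_const 2).aestronglyMeasurable
    (Filter.Eventually.of_forall fun x ↦ ?_)
  rw [h.logMul_apply, norm_pow, norm_norm, norm_mul, Complex.norm_real, Real.norm_eq_abs, mul_pow,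
    sq_abs, mul_pow]
  calc (n : ℝ) ^ 2 * Real.log ‖x‖ ^ 2 * ‖φ x‖ ^ 2
      = n ^ 2 * (Real.log ‖x‖ ^ 2 * ‖φ x‖ * ‖φ x‖) := by ring
    _ ≤ n ^ 2 * ((1 + Real.log ‖x‖ ^ 2) * ‖φ x‖ * C) := by
        gcongr
        · linarith
        · exact hC x
    _ = n ^ 2 * C * ((1 + Real.log ‖x‖ ^ 2) * ‖φ x‖) := by ring

/-! #### The Fourier transform of integrable functions -/

theorem integrable_mul_character {g : F → ℂ} (hg : Integrable g μ) {u : F → F}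
    (hu : Measurable u) : Integrable (fun x ↦ g x * D.character (u x)) μ :=
  hg.mul_bdd (h.continuous_character.measurable.comp hu).aestronglyMeasurable
    (c := 1) (Filter.Eventually.of_forall fun _ ↦ (h.norm_character _).le)

theorem fourierInv_eq (g : F → ℂ) (x : F) : D.fourierInv μ g x = D.fourier μ g (-x) := by
  simp [LocalData.fourierInv, LocalData.fourier]

theorem fourier_add {g k : F → ℂ} (hg : Integrable g μ) (hk : Integrable k μ)
    (y : F) : D.fourier μ (fun x ↦ g x + k x) y = D.fourier μ g y + D.fourier μ k y := by
  simp only [LocalData.fourier, add_mul]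
  exact integral_add (h.integrable_mul_character hg (by fun_prop))
    (h.integrable_mul_character hk (by fun_prop))

theorem fourier_const_mul (c : ℂ) (g : F → ℂ) (y : F) :
    D.fourier μ (fun x ↦ c * g x) y = c * D.fourier μ g y := by
  simp only [LocalData.fourier, mul_assoc]
  exact integral_const_mul _ _

theorem norm_fourier_le (g : F → ℂ) (y : F) : ‖D.fourier μ g y‖ ≤ ∫ x, ‖g x‖ ∂μ := by
  refine (norm_integral_le_integral_norm _).trans_eq ?_
  simp [h.norm_character]

theorem continuous_fourier {g : F → ℂ} (hg : Integrable g μ) : Continuous (D.fourier μ g) := by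
  refine continuous_of_dominated (bound := fun x ↦ ‖g x‖) (fun y ↦ ?_) (fun y ↦ ?_) hg.norm ?_
  · exact (h.integrable_mul_character hg (by fun_prop)).aestronglyMeasurable
  · exact Filter.Eventually.of_forall fun x ↦ by rw [norm_mul, h.norm_character, mul_one]
  · refine Filter.Eventually.of_forall fun x ↦ ?_
    exact continuous_const.mul (h.continuous_character.comp (by fun_prop))

theorem fourier_comp_neg (g : F → ℂ) (y : F) :
    D.fourier μ (fun x ↦ g (-x)) y = D.fourier μ g (-y) := by
  have := h.isAddHaarMeasure
  simp only [LocalData.fourier]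
  rw [← integral_neg_eq_self]
  simp

/-- The multiplication formula. -/
theorem integral_fourier_mul {g k : F → ℂ} (hg : Integrable g μ) (hk : Integrable k μ) :
    ∫ y, D.fourier μ g y * k y ∂μ = ∫ x, g x * D.fourier μ k x ∂μ := by
  have := h.sigmaFinite
  have hint : Integrable (fun p : F × F ↦ g p.1 * k p.2 * D.character (-(p.2 * p.1)))
      (μ.prod μ) :=
    (hg.mul_prod hk).mul_bdd (c := 1) (h.continuous_character.measurable.comp
      (by fun_prop)).aestronglyMeasurable (Filter.Eventually.of_forall fun _ ↦
        (h.norm_character _).le)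
  calc ∫ y, D.fourier μ g y * k y ∂μ
      = ∫ y, ∫ x, g x * k y * D.character (-(y * x)) ∂μ ∂μ := by
        refine integral_congr_ae (Filter.Eventually.of_forall fun y ↦ ?_)
        simp only [LocalData.fourier]
        rw [← integral_mul_const]
        congr 1
        ext x
        ring
    _ = ∫ x, ∫ y, g x * k y * D.character (-(y * x)) ∂μ ∂μ :=
        (integral_integral_swap hint).symm
    _ = ∫ x, g x * D.fourier μ k x ∂μ := by
        refine integral_congr_ae (Filter.Eventually.of_forall fun x ↦ ?_)
        simp only [LocalData.fourier]
        rw [← integral_const_mul]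
        congr 1
        ext y
        rw [mul_comm y x]
        ring

theorem fourier_translate (g : F → ℂ) (a y : F) :
    D.fourier μ (fun x ↦ g (x + a)) y = D.character (y * a) * D.fourier μ g y := by
  have := h.isAddHaarMeasure
  simp only [LocalData.fourier]
  rw [← integral_add_right_eq_self (fun x ↦ g x * D.character (-(y * x))) a, ← integral_const_mul]
  congr 1
  ext x
  have : D.character (-(y * x)) = D.character (y * a) * D.character (-(y * (x + a))) := by
    rw [← h.character_add]
    congr 1
    ring
  rw [this]
  ring

theorem fourier_dilate (g : F → ℂ) {a : F} (ha : a ≠ 0) (y : F) :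
    D.fourier μ (fun x ↦ g (a * x)) y = ((‖a‖ ^ n)⁻¹ : ℝ) * D.fourier μ g (y / a) := by
  simp only [LocalData.fourier]
  have := h.integral_mul_left ha (fun x ↦ g x * D.character (-(y / a * x)))
  rw [Complex.real_smul] at this
  rw [← this]
  congr 1
  ext x
  congr 3
  field_simp

/-! #### The Fourier transform of Schwartz-Bruhat functions -/

/-- The space of Schwartz-Bruhat functions. -/
def space : Submodule ℂ (F → ℂ) where
  carrier := D.schwartz
  zero_mem' := by
    obtain ⟨G, hG, -⟩ := h.exists_radial
    have := h.smul_mem 0 _ hG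
    simpa [← Pi.zero_def] using this
  add_mem' := fun {a b} ha hb ↦ h.add_mem a ha b hb
  smul_mem' := fun c φ hφ ↦ h.smul_mem c φ hφ

theorem neg_mem {φ : F → ℂ} (hφ : φ ∈ D.schwartz) : (fun x ↦ φ (-x)) ∈ D.schwartz := by
  simpa using h.dilate_mem φ hφ (-1) (by simp)

theorem fourierInv_mem {φ : F → ℂ} (hφ : φ ∈ D.schwartz) : D.fourierInv μ φ ∈ D.schwartz := by
  have : D.fourierInv μ φ = fun x ↦ D.fourier μ φ (-x) := funext (h.fourierInv_eq φ)
  rw [this]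
  exact h.neg_mem (h.fourier_mem φ hφ)

variable (hd : D.IsSelfDual μ)
include hd

theorem fourierInv_fourier {φ : F → ℂ} (hφ : φ ∈ D.schwartz) :
    D.fourierInv μ (D.fourier μ φ) = φ := by
  ext x
  rw [h.fourierInv_eq, hd.fourier_fourier φ hφ, neg_neg]

theorem fourier_fourierInv {φ : F → ℂ} (hφ : φ ∈ D.schwartz) :
    D.fourier μ (D.fourierInv μ φ) = φ := by
  have : D.fourierInv μ φ = fun x ↦ D.fourier μ φ (-x) := funext (h.fourierInv_eq φ)
  ext x
  rw [this, h.fourier_comp_neg, hd.fourier_fourier φ hφ, neg_neg]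

/-- Parseval's formula. -/
theorem integral_conj_fourier_mul {φ ψ : F → ℂ} (hφ : φ ∈ D.schwartz) (hψ : ψ ∈ D.schwartz) :
    ∫ y, D.fourier μ ψ y * (starRingEnd ℂ) (D.fourier μ φ y) ∂μ
      = ∫ x, ψ x * (starRingEnd ℂ) (φ x) ∂μ := by
  have hc : Integrable (fun y ↦ (starRingEnd ℂ) (D.fourier μ φ y)) μ :=
    Complex.conjCLE.toContinuousLinearMap.integrable_comp
      (h.integrable_of_mem (h.fourier_mem φ hφ))
  rw [h.integral_fourier_mul (h.integrable_of_mem hψ) hc]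
  congr 1
  ext x
  congr 1
  -- Conjugation turns `λ` into `λ⁻¹`, so the transform of the conjugate of `ℱφ` is the conjugate of
  -- `ℱ⁻¹ℱφ = φ`.
  have h1 := congrFun (h.fourierInv_fourier hd hφ) x
  rw [← h1]
  simp only [LocalData.fourier, LocalData.fourierInv]
  rw [← integral_conj]
  congr 1
  ext y
  rw [map_mul, h.conj_character]

end LocalData.Admissible

end Admissible

/-! ### The Fourier transform and the conductor operator on `L²` -/

section LTwo

variable {F : Type*} [NormedField F] [ProperSpace F] [MeasurableSpace F] [BorelSpace F]

theorem inner_eq_integral {μ : Measure F} {f g : Lp ℂ 2 μ} {φ ψ : F → ℂ} (hf : f =ᵐ[μ] φ)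
    (hg : g =ᵐ[μ] ψ) : inner ℂ f g = ∫ x, ψ x * (starRingEnd ℂ) (φ x) ∂μ := by
  rw [L2.inner_def]
  refine integral_congr_ae ?_
  filter_upwards [hf, hg] with x h1 h2
  rw [h1, h2, RCLike.inner_apply]

namespace LocalData.Admissible

variable {D : LocalData F} {μ : Measure F} {n : ℕ} (h : D.Admissible μ n)
include h

theorem zero_mem_schwartzZero : (fun _ ↦ 0 : F → ℂ) ∈ D.schwartzZero :=
  ⟨h.space.zero_mem, HasCompactSupport.zero, Filter.Eventually.of_forall fun _ ↦ rfl⟩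

/-- The space of the functions in `𝒮₀`. -/
def spaceZero : Submodule ℂ (F → ℂ) where
  carrier := D.schwartzZero
  zero_mem' := h.zero_mem_schwartzZero
  add_mem' := fun {a b} ha hb ↦ ⟨h.add_mem a ha.1 b hb.1, ha.2.1.add hb.2.1, by
    filter_upwards [ha.2.2, hb.2.2] with x h1 h2
    simp [h1, h2]⟩
  smul_mem' := fun c φ hφ ↦ ⟨h.smul_mem c φ hφ.1, hφ.2.1.smul_left (f := fun _ ↦ c), by
    filter_upwards [hφ.2.2] with x h1
    simp [h1]⟩

/-- The class in `L²` of a Schwartz-Bruhat function. -/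
def toL2 : h.space →ₗ[ℂ] Lp ℂ 2 μ where
  toFun φ := (h.memLp_of_mem φ.2).toLp φ.1
  map_add' _ _ := MemLp.toLp_add _ _
  map_smul' _ _ := MemLp.toLp_const_smul _ _

theorem coeFn_toL2 (φ : h.space) : h.toL2 φ =ᵐ[μ] φ.1 :=
  MemLp.coeFn_toLp (h.memLp_of_mem φ.2)

/-- Continuous functions equal almost everywhere for a Haar measure are equal. This allows an
operator given on functions to be read on classes. -/
theorem toL2_injective : Function.Injective h.toL2 := by
  have := h.isAddHaarMeasure
  intro φ ψ hφψ
  have h1 : φ.1 =ᵐ[μ] ψ.1 :=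
    (h.coeFn_toL2 φ).symm.trans (hφψ ▸ h.coeFn_toL2 ψ)
  exact Subtype.ext ((h.continuous_of_mem φ.2).ae_eq_iff_eq μ (h.continuous_of_mem ψ.2) |>.1 h1)

theorem eq_toL2 {f : Lp ℂ 2 μ} {φ : F → ℂ} (hφ : φ ∈ D.schwartz) (hf : f =ᵐ[μ] φ) :
    f = h.toL2 ⟨φ, hφ⟩ :=
  Lp.ext (hf.trans (h.coeFn_toL2 ⟨φ, hφ⟩).symm)

theorem inner_toL2 (f : Lp ℂ 2 μ) (φ : h.space) :
    inner ℂ f (h.toL2 φ) = ∫ x, φ.1 x * (starRingEnd ℂ) (f x) ∂μ :=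
  inner_eq_integral Filter.EventuallyEq.rfl (h.coeFn_toL2 φ)

/-- The classes of the functions in `𝒮₀`. -/
def domainZero : Submodule ℂ (Lp ℂ 2 μ) := (h.spaceZero.comap h.space.subtype).map h.toL2

theorem mem_domainZero {f : Lp ℂ 2 μ} :
    f ∈ h.domainZero ↔ ∃ φ, ∃ hφ : φ ∈ D.schwartzZero, h.toL2 ⟨φ, hφ.1⟩ = f := by
  constructor
  · rintro ⟨φ, hφ, rfl⟩
    exact ⟨φ.1, hφ, rfl⟩
  · rintro ⟨φ, hφ, rfl⟩
    exact ⟨⟨φ, hφ.1⟩, hφ, rfl⟩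

theorem locallyIntegrable (f : Lp ℂ 2 μ) : LocallyIntegrable f μ := by
  have := h.isAddHaarMeasure
  exact (Lp.memLp f).locallyIntegrable (by norm_num)

theorem eq_zero_of_forall_inner {f : Lp ℂ 2 μ} (hf : ∀ g ∈ h.domainZero, inner ℂ f g = 0) :
    f = 0 := by
  have h1 : (fun x ↦ (starRingEnd ℂ) (f x)) =ᵐ[μ] 0 := by
    refine h.separates _ ?_ fun ψ hψ ↦ ?_
    · intro x
      obtain ⟨s, hs, hs'⟩ := h.locallyIntegrable f x
      exact ⟨s, hs, Complex.conjCLE.toContinuousLinearMap.integrable_comp hs'⟩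
    · rw [← hf _ (h.mem_domainZero.2 ⟨ψ, hψ, rfl⟩), h.inner_toL2]
      simp_rw [mul_comm]
  refine (Lp.eq_zero_iff_ae_eq_zero).2 ?_
  filter_upwards [h1] with x hx
  simpa using hx

theorem dense_domainZero : Dense (h.domainZero : Set (Lp ℂ 2 μ)) := by
  rw [Submodule.dense_iff_topologicalClosure_eq_top, Submodule.topologicalClosure_eq_top_iff,
    Submodule.eq_bot_iff]
  intro f hf
  refine h.eq_zero_of_forall_inner fun g hg ↦ ?_
  rw [Submodule.mem_orthogonal] at hf
  rw [← inner_conj_symm, hf g hg, map_zero]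

theorem denseRange_toL2 : DenseRange h.toL2 := by
  refine h.dense_domainZero.mono ?_
  rintro f hf
  obtain ⟨φ, hφ, rfl⟩ := h.mem_domainZero.1 hf
  exact ⟨_, rfl⟩

variable (hd : D.IsSelfDual μ)

/-- The Fourier transform on the space of Schwartz-Bruhat functions. -/
def fourierEquiv : h.space ≃ₗ[ℂ] h.space where
  toFun φ := ⟨D.fourier μ φ.1, h.fourier_mem _ φ.2⟩
  invFun φ := ⟨D.fourierInv μ φ.1, h.fourierInv_mem φ.2⟩
  map_add' φ ψ := Subtype.ext <| funext <|
    h.fourier_add (h.integrable_of_mem φ.2) (h.integrable_of_mem ψ.2)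
  map_smul' c φ := Subtype.ext (funext (h.fourier_const_mul c φ.1))
  left_inv φ := Subtype.ext (h.fourierInv_fourier hd φ.2)
  right_inv φ := Subtype.ext (h.fourier_fourierInv hd φ.2)

theorem norm_toL2_fourierEquiv (φ : h.space) : ‖h.toL2 (h.fourierEquiv hd φ)‖ = ‖h.toL2 φ‖ := by
  have h1 : inner ℂ (h.toL2 (h.fourierEquiv hd φ)) (h.toL2 (h.fourierEquiv hd φ))
      = inner ℂ (h.toL2 φ) (h.toL2 φ) := by
    rw [inner_eq_integral (h.coeFn_toL2 _) (h.coeFn_toL2 _),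
      inner_eq_integral (h.coeFn_toL2 _) (h.coeFn_toL2 _)]
    exact h.integral_conj_fourier_mul hd φ.2 φ.2
  rw [inner_self_eq_norm_sq_to_K, inner_self_eq_norm_sq_to_K] at h1
  have h2 : ‖h.toL2 (h.fourierEquiv hd φ)‖ ^ 2 = ‖h.toL2 φ‖ ^ 2 := by exact_mod_cast h1
  exact (sq_eq_sq₀ (norm_nonneg _) (norm_nonneg _)).1 h2

/-- The unitary extension of the Fourier transform. -/
def fourierL2 : Lp ℂ 2 μ ≃ₗᵢ[ℂ] Lp ℂ 2 μ :=
  (h.fourierEquiv hd).extendOfIsometry h.toL2 h.toL2 h.denseRange_toL2 h.denseRange_toL2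
    (h.norm_toL2_fourierEquiv hd)

theorem fourierL2_toL2 (φ : h.space) :
    h.fourierL2 hd (h.toL2 φ) = h.toL2 (h.fourierEquiv hd φ) :=
  LinearEquiv.extendOfIsometry_eq ..

theorem fourierL2_symm_toL2 (φ : h.space) :
    (h.fourierL2 hd).symm (h.toL2 φ) = h.toL2 ((h.fourierEquiv hd).symm φ) :=
  LinearEquiv.extendOfIsometry_symm_eq ..

/-- The multiplication formula on `L²`. -/
theorem integral_fourierL2_mul (f : Lp ℂ 2 μ) {ψ : F → ℂ} (hψ : ψ ∈ D.schwartz) :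
    ∫ x, h.fourierL2 hd f x * ψ x ∂μ = ∫ x, f x * D.fourier μ ψ x ∂μ := by
  have key : ∀ (f : Lp ℂ 2 μ) {φ : F → ℂ} (hφ : MemLp φ 2 μ),
      inner ℂ ((hφ.star).toLp (star φ)) f = ∫ x, f x * φ x ∂μ := by
    intro f φ hφ
    rw [inner_eq_integral (MemLp.coeFn_toLp _) Filter.EventuallyEq.rfl]
    simp
  rw [← key _ (h.memLp_of_mem hψ), ← key _ (h.memLp_of_mem (h.fourier_mem ψ hψ))]
  refine h.denseRange_toL2.induction_on f ?_ fun φ ↦ ?_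
  · exact isClosed_eq (by fun_prop) (by fun_prop)
  · rw [key _ (h.memLp_of_mem hψ), key _ (h.memLp_of_mem (h.fourier_mem ψ hψ)), h.fourierL2_toL2]
    have h1 := h.integral_fourier_mul (h.integrable_of_mem φ.2) (h.integrable_of_mem hψ)
    refine ((integral_congr_ae ?_).trans h1).trans (integral_congr_ae ?_)
    · filter_upwards [h.coeFn_toL2 (h.fourierEquiv hd φ)] with x hx
      rw [hx]
      rfl
    · filter_upwards [h.coeFn_toL2 φ] with x hx
      rw [hx]

/-- On integrable functions, the unitary Fourier transform is given by the integral. -/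
theorem fourierL2_ae_eq {g : F → ℂ} (hg : Integrable g μ) {f : Lp ℂ 2 μ} (hf : f =ᵐ[μ] g) :
    h.fourierL2 hd f =ᵐ[μ] D.fourier μ g := by
  have := h.isAddHaarMeasure
  -- Both versions of the transform satisfy the multiplication formula, so they agree when tested
  -- against `𝒮₀`. The result is needed for `log |y| ℱ⁻¹φ(y)`, which is integrable and square
  -- integrable but need not be a Schwartz-Bruhat function.
  have h1 : (fun x ↦ h.fourierL2 hd f x - D.fourier μ g x) =ᵐ[μ] 0 := by
    refine h.separates _ ((h.locallyIntegrable _).sub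
      (h.continuous_fourier hg).locallyIntegrable) fun ψ hψ ↦ ?_
    have hψi := h.integrable_of_mem hψ.1
    simp_rw [sub_mul]
    rw [integral_sub, h.integral_fourierL2_mul hd f hψ.1, h.integral_fourier_mul hg hψi, sub_eq_zero]
    · refine integral_congr_ae ?_
      filter_upwards [hf] with x hx
      rw [hx]
    · exact (Lp.memLp (h.fourierL2 hd f)).integrable_mul (h.memLp_of_mem hψ.1)
    · exact hψi.bdd_mul (c := ∫ x, ‖g x‖ ∂μ) (h.continuous_fourier hg).aestronglyMeasurable
        (Filter.Eventually.of_forall fun x ↦ h.norm_fourier_le g x)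
  filter_upwards [h1] with x hx
  simpa [sub_eq_zero] using hx

/-- Both transforms are moved to a test function, where self-duality applies. -/
theorem fourierL2_fourierL2 (f : Lp ℂ 2 μ) :
    h.fourierL2 hd (h.fourierL2 hd f) =ᵐ[μ] fun x ↦ f (-x) := by
  have := h.isAddHaarMeasure
  have h1 : (fun x ↦ h.fourierL2 hd (h.fourierL2 hd f) x - f (-x)) =ᵐ[μ] 0 := by
    have hneg : MemLp (fun x ↦ f (-x)) 2 μ :=
      (Lp.memLp f).comp_measurePreserving (Measure.measurePreserving_neg μ)
    refine h.separates _ ((h.locallyIntegrable _).sub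
      (hneg.locallyIntegrable (by norm_num))) fun ψ hψ ↦ ?_
    simp_rw [sub_mul]
    rw [integral_sub, h.integral_fourierL2_mul hd _ hψ.1,
      h.integral_fourierL2_mul hd _ (h.fourier_mem _ hψ.1), sub_eq_zero,
      ← integral_neg_eq_self]
    · refine integral_congr_ae (Filter.Eventually.of_forall fun x ↦ ?_)
      simp only
      rw [hd.fourier_fourier ψ hψ.1, neg_neg]
    · exact (Lp.memLp _).integrable_mul (h.memLp_of_mem hψ.1)
    · exact hneg.integrable_mul (h.memLp_of_mem hψ.1)
  filter_upwards [h1] with x hx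
  simpa [sub_eq_zero] using hx

/-- The multiplication with `log |x|` on Schwartz-Bruhat functions, with values in `L²`. -/
def logL2 : h.space →ₗ[ℂ] Lp ℂ 2 μ where
  toFun φ := (h.memLp_logMul φ.2).toLp (D.logMul φ.1)
  map_add' φ ψ := by
    rw [← MemLp.toLp_add]
    congr 1
    ext x
    simp [LocalData.logMul, mul_add]
  map_smul' c φ := by
    rw [RingHom.id_apply, ← MemLp.toLp_const_smul]
    congr 1
    ext x
    simp [LocalData.logMul, mul_left_comm]

theorem coeFn_logL2 (φ : h.space) : h.logL2 φ =ᵐ[μ] D.logMul φ.1 :=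
  MemLp.coeFn_toLp (h.memLp_logMul φ.2)

/-- The conductor operator on Schwartz-Bruhat functions, with values in `L²`. -/
def conductorL2 : h.space →ₗ[ℂ] Lp ℂ 2 μ :=
  h.logL2 + (h.fourierL2 hd).toLinearEquiv.toLinearMap ∘ₗ h.logL2 ∘ₗ
    (h.fourierEquiv hd).symm.toLinearMap

theorem conductorL2_apply (φ : h.space) : h.conductorL2 hd φ
    = h.logL2 φ + h.fourierL2 hd (h.logL2 ((h.fourierEquiv hd).symm φ)) := rfl

theorem coeFn_conductorL2 (φ : h.space) : h.conductorL2 hd φ =ᵐ[μ] D.conductor μ φ.1 := by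
  rw [h.conductorL2_apply]
  have hm : D.fourierInv μ φ.1 ∈ D.schwartz := h.fourierInv_mem φ.2
  have h2 := h.fourierL2_ae_eq hd (h.integrable_logMul hm)
    (h.coeFn_logL2 ((h.fourierEquiv hd).symm φ))
  filter_upwards [Lp.coeFn_add (h.logL2 φ) (h.fourierL2 hd (h.logL2 ((h.fourierEquiv hd).symm φ))),
    h.coeFn_logL2 φ, h2] with x h3 h4 h5
  rw [h3, Pi.add_apply, h4, h5]
  rfl

theorem inner_logL2 (φ ψ : h.space) :
    inner ℂ (h.logL2 φ) (h.toL2 ψ) = inner ℂ (h.toL2 φ) (h.logL2 ψ) := by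
  rw [inner_eq_integral (h.coeFn_logL2 φ) (h.coeFn_toL2 ψ),
    inner_eq_integral (h.coeFn_toL2 φ) (h.coeFn_logL2 ψ)]
  congr 1
  ext x
  simp only [LocalData.logMul, map_mul, Complex.conj_ofReal]
  ring

/-- The operator is the sum of a real multiplication and a unitary conjugate of it. -/
theorem inner_conductorL2 (φ ψ : h.space) :
    inner ℂ (h.conductorL2 hd φ) (h.toL2 ψ) = inner ℂ (h.toL2 φ) (h.conductorL2 hd ψ) := by
  rw [h.conductorL2_apply, h.conductorL2_apply, inner_add_left, inner_add_right, h.inner_logL2]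
  congr 1
  rw [← LinearIsometryEquiv.inner_map_map (h.fourierL2 hd).symm,
    ← LinearIsometryEquiv.inner_map_map (h.fourierL2 hd).symm (h.toL2 φ)]
  simp only [LinearIsometryEquiv.symm_apply_apply, h.fourierL2_symm_toL2, h.inner_logL2]

/-- The conductor operator with domain `𝒮`. -/
def conductorOp : Lp ℂ 2 μ →ₗ.[ℂ] Lp ℂ 2 μ where
  domain := LinearMap.range h.toL2
  toFun := h.conductorL2 hd ∘ₗ (LinearEquiv.ofInjective h.toL2 h.toL2_injective).symm.toLinearMap

theorem mem_domain_conductorOp {f : Lp ℂ 2 μ} :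
    f ∈ (h.conductorOp hd).domain ↔ ∃ φ, h.toL2 φ = f := Iff.rfl

theorem conductorOp_toL2 (φ : h.space) (hφ : h.toL2 φ ∈ (h.conductorOp hd).domain) :
    h.conductorOp hd ⟨h.toL2 φ, hφ⟩ = h.conductorL2 hd φ := by
  have h1 : (LinearEquiv.ofInjective h.toL2 h.toL2_injective).symm ⟨h.toL2 φ, hφ⟩ = φ := by
    rw [LinearEquiv.symm_apply_eq]
    rfl
  exact congrArg (h.conductorL2 hd) h1

/-- The conductor operator with domain `𝒮₀`. -/
def conductorOpZero : Lp ℂ 2 μ →ₗ.[ℂ] Lp ℂ 2 μ := (h.conductorOp hd).domRestrict h.domainZero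

theorem conductorOpZero_le : h.conductorOpZero hd ≤ h.conductorOp hd :=
  LinearPMap.domRestrict_le

theorem domain_conductorOpZero : (h.conductorOpZero hd).domain = h.domainZero := by
  refine inf_eq_left.2 fun f hf ↦ ?_
  obtain ⟨φ, hφ, rfl⟩ := h.mem_domainZero.1 hf
  exact ⟨_, rfl⟩

theorem conductorOpZero_toL2 (φ : h.space) (hφ : h.toL2 φ ∈ (h.conductorOpZero hd).domain) :
    h.conductorOpZero hd ⟨h.toL2 φ, hφ⟩ = h.conductorL2 hd φ := by
  rw [← h.conductorOp_toL2 hd φ ⟨φ, rfl⟩]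
  exact (h.conductorOpZero_le hd).2 rfl

theorem isFormalAdjoint_conductorOp :
    (h.conductorOp hd).IsFormalAdjoint (h.conductorOp hd) := by
  rintro ⟨f, hf⟩ ⟨g, hg⟩
  obtain ⟨φ, rfl⟩ := (h.mem_domain_conductorOp hd).1 hf
  obtain ⟨ψ, rfl⟩ := (h.mem_domain_conductorOp hd).1 hg
  rw [h.conductorOp_toL2, h.conductorOp_toL2]
  exact h.inner_conductorL2 hd φ ψ

theorem isFormalAdjoint_conductorOpZero :
    (h.conductorOpZero hd).IsFormalAdjoint (h.conductorOpZero hd) := by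
  intro x y
  have h1 := h.isFormalAdjoint_conductorOp hd ⟨x, (h.conductorOpZero_le hd).1 x.2⟩
    ⟨y, (h.conductorOpZero_le hd).1 y.2⟩
  rwa [← (h.conductorOpZero_le hd).2 (x := x) rfl, ← (h.conductorOpZero_le hd).2 (x := y) rfl] at h1

theorem isOperatorOf_conductorOp :
    IsOperatorOf (h.conductorOp hd) D.schwartz (D.conductor μ) where
  memLp _ hφ := h.memLp_of_mem hφ
  mem_domain_iff f := by
    constructor
    · rintro ⟨φ, rfl⟩
      exact ⟨φ.1, φ.2, h.coeFn_toL2 φ⟩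
    · rintro ⟨φ, hφ, hf⟩
      exact ⟨⟨φ, hφ⟩, (h.eq_toL2 hφ hf).symm⟩
  apply_eq := by
    rintro ⟨f, hf⟩ φ hφ hfφ
    obtain rfl := h.eq_toL2 hφ hfφ
    rw [h.conductorOp_toL2]
    exact h.coeFn_conductorL2 hd _

theorem isOperatorOf_conductorOpZero :
    IsOperatorOf (h.conductorOpZero hd) D.schwartzZero (D.conductor μ) where
  memLp _ hφ := h.memLp_of_mem hφ.1
  mem_domain_iff f := by
    rw [h.domain_conductorOpZero, h.mem_domainZero]
    constructor
    · rintro ⟨φ, hφ, rfl⟩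
      exact ⟨φ, hφ, h.coeFn_toL2 _⟩
    · rintro ⟨φ, hφ, hf⟩
      exact ⟨φ, hφ, (h.eq_toL2 hφ.1 hf).symm⟩
  apply_eq := by
    rintro ⟨f, hf⟩ φ hφ hfφ
    obtain rfl := h.eq_toL2 hφ.1 hfφ
    rw [h.conductorOpZero_toL2]
    exact h.coeFn_conductorL2 hd _

/-- The Fourier transform commutes with the conductor operator on `𝒮`. -/
theorem commutesWith_fourierL2 : CommutesWith (h.conductorOp hd) (h.fourierL2 hd) := by
  have hmem : ∀ φ : h.space, h.toL2 φ ∈ (h.conductorOp hd).domain := fun φ ↦ ⟨φ, rfl⟩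
  constructor
  · intro f
    constructor
    · rintro ⟨φ, hφ⟩
      exact ⟨(h.fourierEquiv hd).symm φ, by
        rw [← h.fourierL2_symm_toL2, hφ, LinearIsometryEquiv.symm_apply_apply]⟩
    · rintro ⟨φ, rfl⟩
      exact ⟨h.fourierEquiv hd φ, (h.fourierL2_toL2 hd φ).symm⟩
  · intro f hf hU
    obtain ⟨φ, rfl⟩ := (h.mem_domain_conductorOp hd).1 hf
    rw [h.conductorOp_toL2]
    have h1 : h.conductorOp hd ⟨h.fourierL2 hd (h.toL2 φ), hU⟩
        = h.conductorL2 hd (h.fourierEquiv hd φ) := by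
      rw [← h.conductorOp_toL2 hd _ (hmem _)]
      congr 1
      exact Subtype.ext (h.fourierL2_toL2 hd φ)
    rw [h1, h.conductorL2_apply, h.conductorL2_apply, map_add, LinearEquiv.symm_apply_apply,
      add_comm]
    congr 1
    -- What remains is `A ℱ = ℱ² A ℱ⁻¹`: here `ℱ²` is the reflection and `log |x|` is even.
    refine Lp.ext ((h.coeFn_logL2 _).trans (Filter.EventuallyEq.symm ?_))
    refine (h.fourierL2_fourierL2 hd _).trans ?_
    have := h.isAddHaarMeasure
    have h2 := (Measure.measurePreserving_neg μ).quasiMeasurePreserving.ae_eq_comp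
      (h.coeFn_logL2 ((h.fourierEquiv hd).symm φ))
    refine Filter.EventuallyEq.trans h2 (Filter.Eventually.of_forall fun x ↦ ?_)
    change D.logMul (D.fourierInv μ φ.1) (-x) = D.logMul (D.fourier μ φ.1) x
    rw [h.logMul_apply, h.logMul_apply, h.fourierInv_eq, neg_neg, norm_neg]

end LocalData.Admissible

end LTwo

/-! ### Weighted composition operators -/

section WeightedComp

variable {F : Type*} [MeasurableSpace F]

/-- The composition with `σ`, followed by the multiplication with `w`, is isometric on `L²(μ)`. -/
structure IsWeightedComp (μ : Measure F) (w : F → ℂ) (σ : F → F) : Prop where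
  measurable_weight : Measurable w
  measurable_map : Measurable σ
  lintegral_eq : ∀ g : F → ENNReal, Measurable g →
    ∫⁻ x, ‖w x‖ₑ ^ 2 * g (σ x) ∂μ = ∫⁻ x, g x ∂μ
  ae_ne_zero : ∀ᵐ x ∂μ, w x ≠ 0

namespace IsWeightedComp

variable {μ : Measure F} {w w' : F → ℂ} {σ σ' : F → F} (h : IsWeightedComp μ w σ)
include h

/-- For a null set `s`, the integral of `|w|²` over `σ⁻¹(s)` is zero, and `w` vanishes almost
nowhere. This makes the composition with `σ` meaningful on classes. -/
theorem quasiMeasurePreserving : Measure.QuasiMeasurePreserving σ μ μ := by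
  refine ⟨h.measurable_map, Measure.AbsolutelyContinuous.mk fun s hs h0 ↦ ?_⟩
  rw [Measure.map_apply h.measurable_map hs]
  have h1 := h.lintegral_eq _ (measurable_one.indicator hs)
  have hm : Measurable fun x ↦ ‖w x‖ₑ ^ 2 * s.indicator (1 : F → ENNReal) (σ x) :=
    (h.measurable_weight.enorm.pow_const 2).mul ((measurable_one.indicator hs).comp
      h.measurable_map)
  rw [lintegral_indicator_one hs, h0, lintegral_eq_zero_iff hm] at h1
  refine measure_mono_null (fun x hx ↦ ?_) (ae_iff.1 (h1.and h.ae_ne_zero))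
  intro hx'
  have h2 : ‖w x‖ₑ ^ 2 * s.indicator 1 (σ x) = 0 := hx'.1
  rw [Set.indicator_of_mem (show σ x ∈ s from hx)] at h2
  simp [hx'.2] at h2

theorem aestronglyMeasurable {f : F → ℂ} (hf : AEStronglyMeasurable f μ) :
    AEStronglyMeasurable (fun x ↦ w x * f (σ x)) μ :=
  h.measurable_weight.aestronglyMeasurable.mul
    (hf.comp_quasiMeasurePreserving h.quasiMeasurePreserving)

theorem congr_ae {f g : F → ℂ} (hfg : f =ᵐ[μ] g) :
    (fun x ↦ w x * f (σ x)) =ᵐ[μ] fun x ↦ w x * g (σ x) := by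
  filter_upwards [h.quasiMeasurePreserving.ae_eq_comp hfg] with x hx
  exact congrArg (w x * ·) hx

theorem eLpNorm_eq {f : F → ℂ} (hf : AEStronglyMeasurable f μ) :
    eLpNorm (fun x ↦ w x * f (σ x)) 2 μ = eLpNorm f 2 μ := by
  rw [eLpNorm_congr_ae (h.congr_ae hf.ae_eq_mk), eLpNorm_congr_ae hf.ae_eq_mk,
    eLpNorm_eq_lintegral_rpow_enorm_toReal (by norm_num) (by norm_num),
    eLpNorm_eq_lintegral_rpow_enorm_toReal (by norm_num) (by norm_num)]
  congr 1
  have hm := hf.stronglyMeasurable_mk.measurable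
  rw [← h.lintegral_eq (fun x ↦ ‖hf.mk f x‖ₑ ^ ENNReal.toReal 2) (by fun_prop)]
  refine lintegral_congr fun x ↦ ?_
  simp [enorm_mul, mul_pow]

theorem memLp {f : F → ℂ} (hf : MemLp f 2 μ) : MemLp (fun x ↦ w x * f (σ x)) 2 μ :=
  ⟨h.aestronglyMeasurable hf.1, by rw [h.eLpNorm_eq hf.1]; exact hf.2⟩

/-- The isometry `f ↦ w · (f ∘ σ)` of `L²`. -/
def toLinearIsometry : Lp ℂ 2 μ →ₗᵢ[ℂ] Lp ℂ 2 μ where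
  toFun f := (h.memLp (Lp.memLp f)).toLp _
  map_add' f g := by
    rw [← MemLp.toLp_add, MemLp.toLp_eq_toLp_iff]
    refine (h.congr_ae (Lp.coeFn_add f g)).trans (Filter.Eventually.of_forall fun x ↦ ?_)
    simp [mul_add]
  map_smul' c f := by
    rw [RingHom.id_apply, ← MemLp.toLp_const_smul, MemLp.toLp_eq_toLp_iff]
    refine (h.congr_ae (Lp.coeFn_smul c f)).trans (Filter.Eventually.of_forall fun x ↦ ?_)
    simp [mul_left_comm]
  norm_map' f := by
    simp only [LinearMap.coe_mk, AddHom.coe_mk]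
    rw [Lp.norm_toLp, h.eLpNorm_eq (Lp.memLp f).1, Lp.norm_def]

theorem coeFn_toLinearIsometry (f : Lp ℂ 2 μ) :
    h.toLinearIsometry f =ᵐ[μ] fun x ↦ w x * f (σ x) := MemLp.coeFn_toLp (h.memLp (Lp.memLp f))

theorem toLinearIsometry_comp (h' : IsWeightedComp μ w' σ')
    (hww : ∀ᵐ x ∂μ, w x * w' (σ x) = 1 ∧ σ' (σ x) = x) (f : Lp ℂ 2 μ) :
    h.toLinearIsometry (h'.toLinearIsometry f) = f := by
  refine Lp.ext ((h.coeFn_toLinearIsometry _).trans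
    ((h.congr_ae (h'.coeFn_toLinearIsometry f)).trans ?_))
  filter_upwards [hww] with x hx
  rw [← mul_assoc, hx.1, hx.2, one_mul]

/-- The unitary operator `f ↦ w · (f ∘ σ)` of `L²`, for mutually inverse data. -/
def toLinearIsometryEquiv (h' : IsWeightedComp μ w' σ')
    (hww : ∀ᵐ x ∂μ, w x * w' (σ x) = 1 ∧ σ' (σ x) = x) : Lp ℂ 2 μ ≃ₗᵢ[ℂ] Lp ℂ 2 μ :=
  LinearIsometryEquiv.ofSurjective h.toLinearIsometry
    fun f ↦ ⟨_, h.toLinearIsometry_comp h' hww f⟩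

theorem coeFn_toLinearIsometryEquiv (h' : IsWeightedComp μ w' σ')
    (hww : ∀ᵐ x ∂μ, w x * w' (σ x) = 1 ∧ σ' (σ x) = x) (f : Lp ℂ 2 μ) :
    h.toLinearIsometryEquiv h' hww f =ᵐ[μ] fun x ↦ w x * f (σ x) :=
  h.coeFn_toLinearIsometry f

end IsWeightedComp

end WeightedComp

/-! ### Dilations and the Inversion as unitary operators of `L²`. -/

section Dilations

variable {F : Type*} [NormedField F] [ProperSpace F] [MeasurableSpace F] [BorelSpace F]

namespace LocalData.Admissible

variable {D : LocalData F} {μ : Measure F} {n : ℕ} (h : D.Admissible μ n)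
include h

theorem module_pos {t : F} (ht : t ≠ 0) : 0 < D.module t := by
  rw [h.module_eq]
  exact pow_pos (norm_pos_iff.2 ht) n

theorem module_mul (s t : F) : D.module (s * t) = D.module s * D.module t := by
  simp only [h.module_eq, norm_mul, mul_pow]

theorem module_inv (t : F) : D.module t⁻¹ = (D.module t)⁻¹ := by
  simp only [h.module_eq, norm_inv, inv_pow]

theorem isWeightedComp_dilation {t : F} (ht : t ≠ 0) :
    IsWeightedComp μ (fun _ ↦ ((Real.sqrt (D.module t))⁻¹ : ℂ)) (fun x ↦ x / t) where
  measurable_weight := measurable_const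
  measurable_map := by fun_prop
  lintegral_eq g hg := by
    have h0 := h.module_pos ht
    rw [lintegral_const_mul _ (by fun_prop)]
    simp_rw [div_eq_inv_mul]
    have h1 : ‖((Real.sqrt (D.module t) : ℂ))⁻¹‖ₑ ^ 2 = ENNReal.ofReal (D.module t)⁻¹ := by
      rw [← ofReal_norm, ← ENNReal.ofReal_pow (norm_nonneg _), norm_inv, Complex.norm_real,
        Real.norm_of_nonneg (Real.sqrt_nonneg _), inv_pow, Real.sq_sqrt h0.le]
    rw [h.lintegral_mul_left (inv_ne_zero ht) hg, h1, ← mul_assoc,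
      ← ENNReal.ofReal_mul (by positivity), ← h.module_eq, h.module_inv, inv_inv,
      inv_mul_cancel₀ h0.ne', ENNReal.ofReal_one, one_mul]
  ae_ne_zero := Filter.Eventually.of_forall fun x ↦ by
    have := Real.sqrt_pos.2 (h.module_pos ht)
    simp only [ne_eq, inv_eq_zero, Complex.ofReal_eq_zero]
    exact this.ne'

theorem dilation_weight_mul {t : F} (ht : t ≠ 0) :
    ((Real.sqrt (D.module t))⁻¹ : ℂ) * ((Real.sqrt (D.module t⁻¹))⁻¹ : ℂ) = 1 := by
  have := Real.sqrt_pos.2 (h.module_pos ht)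
  rw [h.module_inv, Real.sqrt_inv]
  push_cast
  rw [inv_inv, inv_mul_cancel₀]
  exact_mod_cast this.ne'

open Classical in
/-- The unitary dilations. -/
def dilationL2 (t : F) : Lp ℂ 2 μ ≃ₗᵢ[ℂ] Lp ℂ 2 μ :=
  -- The value at `t = 0` is a convention: `{0}` is a null set for `d*t`. With the identity there,
  -- `U(t)⁻¹ = U(t⁻¹)` holds for all `t`, as `0⁻¹ = 0`.
  if ht : t = 0 then LinearIsometryEquiv.refl ℂ _ else
    (h.isWeightedComp_dilation ht).toLinearIsometryEquiv
      (h.isWeightedComp_dilation (inv_ne_zero ht)) (Filter.Eventually.of_forall fun x ↦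
        ⟨h.dilation_weight_mul ht, by field_simp⟩)

theorem coeFn_dilationL2 {t : F} (ht : t ≠ 0) (f : Lp ℂ 2 μ) :
    h.dilationL2 t f =ᵐ[μ] D.dilation t f := by
  rw [dilationL2, dif_neg ht]
  exact (h.isWeightedComp_dilation ht).coeFn_toLinearIsometryEquiv _ _ f

theorem dilation_congr_ae {t : F} (ht : t ≠ 0) {f g : F → ℂ} (hfg : f =ᵐ[μ] g) :
    D.dilation t f =ᵐ[μ] D.dilation t g := (h.isWeightedComp_dilation ht).congr_ae hfg

theorem dilation_dilation (s t : F) (f : F → ℂ) :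
    D.dilation s (D.dilation t f) = D.dilation (s * t) f := by
  ext x
  have hs : 0 ≤ D.module s := by rw [h.module_eq]; positivity
  simp only [LocalData.dilation]
  rw [h.module_mul, Real.sqrt_mul hs, ← mul_assoc, ← div_div]
  push_cast
  rw [mul_inv]

theorem dilation_one (f : F → ℂ) : D.dilation 1 f = f := by
  ext x
  simp [LocalData.dilation, h.module_eq]

theorem dilationL2_dilationL2 {s t : F} (hs : s ≠ 0) (ht : t ≠ 0) (f : Lp ℂ 2 μ) :
    h.dilationL2 s (h.dilationL2 t f) = h.dilationL2 (s * t) f := by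
  refine Lp.ext ((h.coeFn_dilationL2 hs _).trans
    ((h.dilation_congr_ae hs (h.coeFn_dilationL2 ht f)).trans ?_))
  rw [h.dilation_dilation]
  exact (h.coeFn_dilationL2 (mul_ne_zero hs ht) f).symm

theorem dilationL2_one (f : Lp ℂ 2 μ) : h.dilationL2 1 f = f := by
  refine Lp.ext ((h.coeFn_dilationL2 one_ne_zero _).trans ?_)
  rw [h.dilation_one]

theorem dilationL2_symm {t : F} (f : Lp ℂ 2 μ) :
    (h.dilationL2 t).symm f = h.dilationL2 t⁻¹ f := by
  rw [LinearIsometryEquiv.symm_apply_eq]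
  rcases eq_or_ne t 0 with rfl | ht
  · simp [dilationL2]
  · rw [h.dilationL2_dilationL2 ht (inv_ne_zero ht), mul_inv_cancel₀ ht, h.dilationL2_one]

theorem inner_dilationL2_left (t : F) (f g : Lp ℂ 2 μ) :
    inner ℂ (h.dilationL2 t f) g = inner ℂ f (h.dilationL2 t⁻¹ g) := by
  rw [← h.dilationL2_symm, ← LinearIsometryEquiv.inner_map_map (h.dilationL2 t).symm,
    LinearIsometryEquiv.symm_apply_apply]

theorem dilation_mem {t : F} (ht : t ≠ 0) {φ : F → ℂ} (hφ : φ ∈ D.schwartz) :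
    D.dilation t φ ∈ D.schwartz := by
  have h1 := h.smul_mem ((Real.sqrt (D.module t))⁻¹ : ℂ) _
    (h.dilate_mem φ hφ t⁻¹ (inv_ne_zero ht))
  have h2 : D.dilation t φ = fun x ↦ ((Real.sqrt (D.module t))⁻¹ : ℂ) * φ (t⁻¹ * x) := by
    ext x
    simp only [LocalData.dilation, div_eq_inv_mul]
  rwa [h2]

theorem dilation_mem_zero {t : F} (ht : t ≠ 0) {φ : F → ℂ} (hφ : φ ∈ D.schwartzZero) :
    D.dilation t φ ∈ D.schwartzZero := by
  refine ⟨h.dilation_mem ht hφ.1, ?_, ?_⟩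
  · have h1 : HasCompactSupport fun x ↦ φ (x / t) := by
      simp_rw [div_eq_mul_inv]
      exact hφ.2.1.comp_homeomorph (Homeomorph.mulRight₀ t⁻¹ (inv_ne_zero ht))
    exact h1.mul_left
  · have h1 : Filter.Tendsto (fun x : F ↦ x / t) (𝓝 0) (𝓝 0) := by
      have : Continuous fun x : F ↦ x / t := by fun_prop
      simpa using this.tendsto 0
    filter_upwards [h1.eventually hφ.2.2] with x hx
    simp [LocalData.dilation, hx]

theorem dilationL2_toL2 {t : F} (ht : t ≠ 0) (φ : h.space) :
    h.dilationL2 t (h.toL2 φ) = h.toL2 ⟨D.dilation t φ.1, h.dilation_mem ht φ.2⟩ :=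
  h.eq_toL2 _ ((h.coeFn_dilationL2 ht _).trans (h.dilation_congr_ae ht (h.coeFn_toL2 φ)))

/-! #### The Inversion -/

/-- One has `|x|⁻² g(1/x) dx = |x|⁻¹ g(1/x) d*x`, and the invariance of `d*x` under inversion turns
this into `|x| g(x) d*x = g(x) dx`. -/
theorem isWeightedComp_inversion :
    IsWeightedComp μ (fun x ↦ ((D.module x)⁻¹ : ℂ)) (fun x ↦ 1 / x) where
  measurable_weight := by
    simp_rw [h.module_eq]
    fun_prop
  measurable_map := by fun_prop
  lintegral_eq g hg := by
    have key : ∀ k : F → ENNReal, Measurable k → ∫⁻ x, k x ∂μ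
        = ∫⁻ x, ENNReal.ofReal (‖x‖ ^ n) * k x ∂(mulHaar μ n) := by
      intro k hk
      rw [lintegral_mulHaar _ _ (by fun_prop)]
      refine lintegral_congr_ae ?_
      filter_upwards [h.ae_ne_zero] with x hx
      have : 0 < ‖x‖ := norm_pos_iff.2 hx
      rw [← mul_assoc, ← ENNReal.ofReal_mul (by positivity), inv_mul_cancel₀ (by positivity),
        ENNReal.ofReal_one, one_mul]
    have h1 : ∀ x, ‖((D.module x : ℂ))⁻¹‖ₑ ^ 2 = ENNReal.ofReal ((‖x‖ ^ n)⁻¹ ^ 2) := by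
      intro x
      rw [← ofReal_norm, ← ENNReal.ofReal_pow (norm_nonneg _), norm_inv, Complex.norm_real,
        h.module_eq, Real.norm_of_nonneg (by positivity)]
    simp_rw [h1]
    rw [key _ (by fun_prop), key g hg, ← h.lintegral_mulHaar_inv (by fun_prop)]
    refine lintegral_congr_ae ?_
    filter_upwards [h.ae_mulHaar_ne_zero] with x hx
    have : 0 < ‖x‖ := norm_pos_iff.2 hx
    rw [← mul_assoc, ← ENNReal.ofReal_mul (by positivity), one_div, inv_inv, norm_inv]
    congr 2
    rw [inv_pow]
    field_simp
  ae_ne_zero := by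
    filter_upwards [h.ae_ne_zero] with x hx
    simp only [ne_eq, inv_eq_zero, Complex.ofReal_eq_zero]
    exact (h.module_pos hx).ne'

theorem inversion_inversion (f : F → ℂ) {x : F} (hx : x ≠ 0) :
    D.inversion (D.inversion f) x = f x := by
  have h1 : (D.module x : ℂ) ≠ 0 := by exact_mod_cast (h.module_pos hx).ne'
  simp only [LocalData.inversion]
  rw [one_div, one_div, inv_inv, h.module_inv]
  push_cast
  field_simp

/-- The unitary Inversion. -/
def inversionL2 : Lp ℂ 2 μ ≃ₗᵢ[ℂ] Lp ℂ 2 μ :=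
  h.isWeightedComp_inversion.toLinearIsometryEquiv h.isWeightedComp_inversion (by
    filter_upwards [h.ae_ne_zero] with x hx
    have h1 : (D.module x : ℂ) ≠ 0 := by exact_mod_cast (h.module_pos hx).ne'
    refine ⟨?_, by simp⟩
    rw [one_div, h.module_inv]
    push_cast
    field_simp)

theorem coeFn_inversionL2 (f : Lp ℂ 2 μ) : h.inversionL2 f =ᵐ[μ] D.inversion f :=
  h.isWeightedComp_inversion.coeFn_toLinearIsometryEquiv _ _ f

theorem inversion_congr_ae {f g : F → ℂ} (hfg : f =ᵐ[μ] g) :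
    D.inversion f =ᵐ[μ] D.inversion g := h.isWeightedComp_inversion.congr_ae hfg

theorem inversionL2_inversionL2 (f : Lp ℂ 2 μ) : h.inversionL2 (h.inversionL2 f) = f := by
  refine Lp.ext ((h.coeFn_inversionL2 _).trans
    ((h.inversion_congr_ae (h.coeFn_inversionL2 f)).trans ?_))
  filter_upwards [h.ae_ne_zero] with x hx
  exact h.inversion_inversion _ hx

theorem inner_inversionL2_left (f g : Lp ℂ 2 μ) :
    inner ℂ (h.inversionL2 f) g = inner ℂ f (h.inversionL2 g) := by
  rw [← LinearIsometryEquiv.inner_map_map h.inversionL2, h.inversionL2_inversionL2]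

theorem inversionL2_dilationL2 {t : F} (ht : t ≠ 0) (f : Lp ℂ 2 μ) :
    h.inversionL2 (h.dilationL2 t f) = h.dilationL2 t⁻¹ (h.inversionL2 f) := by
  refine Lp.ext ((h.coeFn_inversionL2 _).trans
    ((h.inversion_congr_ae (h.coeFn_dilationL2 ht f)).trans
      (Filter.EventuallyEq.symm ((h.coeFn_dilationL2 (inv_ne_zero ht) _).trans
        ((h.dilation_congr_ae (inv_ne_zero ht) (h.coeFn_inversionL2 f)).trans ?_)))))
  refine Filter.Eventually.of_forall fun x ↦ ?_
  have h0 := h.module_pos ht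
  have h1 : (Real.sqrt (D.module t) : ℂ) ≠ 0 := by
    exact_mod_cast (Real.sqrt_pos.2 h0).ne'
  have h2 : (D.module t : ℂ) = (Real.sqrt (D.module t) : ℂ) ^ 2 := by
    exact_mod_cast (Real.sq_sqrt h0.le).symm
  simp only [LocalData.inversion, LocalData.dilation]
  rw [h.module_inv, Real.sqrt_inv, div_inv_eq_mul, h.module_mul, one_div, one_div, mul_inv,
    div_eq_mul_inv]
  push_cast
  rw [h2, inv_inv, mul_inv]
  field_simp

/-- Vanishing near the origin and vanishing near infinity are exchanged. -/
theorem inversion_mem_zero {φ : F → ℂ} (hφ : φ ∈ D.schwartzZero) :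
    D.inversion φ ∈ D.schwartzZero := by
  refine ⟨h.inversion_mem φ hφ, ?_, ?_⟩
  · obtain ⟨ε, hε, hball⟩ := Metric.eventually_nhds_iff_ball.1 hφ.2.2
    refine HasCompactSupport.intro (isCompact_closedBall (0 : F) ε⁻¹) fun x hx ↦ ?_
    rw [mem_closedBall_zero_iff, not_le] at hx
    simp only [LocalData.inversion]
    rw [hball, mul_zero]
    rw [mem_ball_zero_iff, one_div, norm_inv]
    exact inv_lt_of_inv_lt₀ hε hx
  · obtain ⟨R, hR⟩ := hφ.2.1.isCompact.isBounded.exists_norm_le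
    have hR1 : 0 < |R| + 1 := by positivity
    filter_upwards [Metric.ball_mem_nhds (0 : F) (inv_pos.2 hR1)] with x hx
    rcases eq_or_ne x 0 with rfl | hx0
    -- At the origin the weight is `0⁻¹ = 0`.
    · simp [LocalData.inversion, h.module_eq, h.n_pos.ne']
    · have h1 : 1 / x ∉ tsupport φ := by
        intro hmem
        have h2 := hR _ hmem
        rw [one_div, norm_inv] at h2
        rw [mem_ball_zero_iff] at hx
        have h3 := (lt_inv_comm₀ (norm_pos_iff.2 hx0) hR1).1 hx
        linarith [le_abs_self R]
      simp only [LocalData.inversion]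
      rw [image_eq_zero_of_notMem_tsupport h1, mul_zero]

theorem inversionL2_toL2 {φ : F → ℂ} (hφ : φ ∈ D.schwartzZero) :
    h.inversionL2 (h.toL2 ⟨φ, hφ.1⟩) = h.toL2 ⟨D.inversion φ, h.inversion_mem φ hφ⟩ :=
  h.eq_toL2 _ ((h.coeFn_inversionL2 _).trans (h.inversion_congr_ae (h.coeFn_toL2 _)))

/-! #### Dilations commute with the conductor operator -/

variable (hd : D.IsSelfDual μ)
include hd

/-- Dilation changes `log |x|` by `log |t|` in the first term and contributes `-log |t|` in the
second, where Fourier inversion returns the multiple of `φ(x/t)` that cancels the first. At `x = 0`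
the convention `log 0 = 0` breaks the additivity of the logarithm. -/
theorem conductor_dilation {t : F} (ht : t ≠ 0) {φ : F → ℂ} (hφ : φ ∈ D.schwartz) {x : F}
    (hx : x ≠ 0) :
    D.conductor μ (D.dilation t φ) x = D.dilation t (D.conductor μ φ) x := by
  have ht' : ‖t‖ ≠ 0 := norm_ne_zero_iff.2 ht
  have hx' : ‖x‖ ≠ 0 := norm_ne_zero_iff.2 hx
  set c : ℂ := ((Real.sqrt (D.module t))⁻¹ : ℂ) with hc
  set ψ := D.fourierInv μ φ with hψ
  have hψm : ψ ∈ D.schwartz := h.fourierInv_mem hφ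
  have h1 : D.fourierInv μ (D.dilation t φ) = fun y ↦ (c * (‖t‖ ^ n : ℝ)) * ψ (t * y) := by
    ext y
    rw [h.fourierInv_eq]
    have h2 : D.dilation t φ = fun x ↦ c * φ (t⁻¹ * x) := by
      ext z
      simp only [LocalData.dilation, div_eq_inv_mul]
      rfl
    rw [h2, h.fourier_const_mul, h.fourier_dilate _ (inv_ne_zero ht), hψ, h.fourierInv_eq, norm_inv,
      inv_pow, inv_inv, div_inv_eq_mul, neg_mul, mul_comm t y]
    ring
  have h2 : D.fourier μ (D.logMul (D.fourierInv μ (D.dilation t φ))) x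
      = c * (D.fourier μ (D.logMul ψ) (x / t) - (n * Real.log ‖t‖ : ℝ) * φ (x / t)) := by
    have h3 : D.logMul (D.fourierInv μ (D.dilation t φ)) =ᵐ[μ] fun y ↦ (c * (‖t‖ ^ n : ℝ)) *
        ((fun z ↦ D.logMul ψ z + (-(n * Real.log ‖t‖ : ℝ) : ℂ) * ψ z) (t * y)) := by
      filter_upwards [h.ae_ne_zero] with y hy
      rw [h1, h.logMul_apply, h.logMul_apply, norm_mul, Real.log_mul ht' (norm_ne_zero_iff.2 hy)]
      push_cast
      ring
    have h4 : D.fourier μ (D.logMul (D.fourierInv μ (D.dilation t φ))) x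
        = D.fourier μ (fun y ↦ (c * (‖t‖ ^ n : ℝ)) *
        ((fun z ↦ D.logMul ψ z + (-(n * Real.log ‖t‖ : ℝ) : ℂ) * ψ z) (t * y))) x := by
      refine integral_congr_ae ?_
      filter_upwards [h3] with y hy
      rw [hy]
    rw [h4, h.fourier_const_mul, h.fourier_dilate (fun z ↦ D.logMul ψ z +
      (-(n * Real.log ‖t‖ : ℝ) : ℂ) * ψ z) ht,
      h.fourier_add (h.integrable_logMul hψm) ((h.integrable_of_mem hψm).const_mul _),
      h.fourier_const_mul, hψ, h.fourier_fourierInv hd hφ]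
    have h5 : ((‖t‖ ^ n : ℝ) : ℂ) ≠ 0 := by exact_mod_cast pow_ne_zero n ht'
    push_cast at h5 ⊢
    field_simp
    ring
  change D.logMul (D.dilation t φ) x + D.fourier μ (D.logMul (D.fourierInv μ (D.dilation t φ))) x
    = c * (D.logMul φ (x / t) + D.fourier μ (D.logMul ψ) (x / t))
  rw [h2, h.logMul_apply, h.logMul_apply, show D.dilation t φ x = c * φ (x / t) from rfl, norm_div, Real.log_div hx' ht']
  push_cast
  ring

theorem conductorL2_dilation {t : F} (ht : t ≠ 0) (φ : h.space) :
    h.conductorL2 hd ⟨D.dilation t φ.1, h.dilation_mem ht φ.2⟩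
      = h.dilationL2 t (h.conductorL2 hd φ) := by
  refine Lp.ext ((h.coeFn_conductorL2 hd _).trans (Filter.EventuallyEq.symm
    ((h.coeFn_dilationL2 ht _).trans ((h.dilation_congr_ae ht (h.coeFn_conductorL2 hd φ)).trans
      ?_))))
  filter_upwards [h.ae_ne_zero] with x hx
  exact (h.conductor_dilation hd ht φ.2 hx).symm

theorem commutesWith_dilationL2 {t : F} (ht : t ≠ 0) :
    CommutesWith (h.conductorOpZero hd) (h.dilationL2 t) := by
  have hmem : ∀ {s : F}, s ≠ 0 → ∀ f ∈ h.domainZero, h.dilationL2 s f ∈ h.domainZero := by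
    intro s hs f hf
    obtain ⟨φ, hφ, rfl⟩ := h.mem_domainZero.1 hf
    rw [h.dilationL2_toL2 hs]
    exact h.mem_domainZero.2 ⟨_, h.dilation_mem_zero hs hφ, rfl⟩
  constructor
  · intro f
    rw [h.domain_conductorOpZero]
    refine ⟨fun hf ↦ ?_, hmem ht f⟩
    have h1 := hmem (inv_ne_zero ht) _ hf
    rwa [← h.dilationL2_symm, LinearIsometryEquiv.symm_apply_apply] at h1
  · intro f hf hU
    have hf' := hf
    rw [h.domain_conductorOpZero] at hf'
    obtain ⟨φ, hφ, rfl⟩ := h.mem_domainZero.1 hf'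
    have h1 := h.dilationL2_toL2 ht ⟨φ, hφ.1⟩
    rw [h.conductorOpZero_toL2, ← h.conductorL2_dilation hd ht]
    have h2 : h.toL2 ⟨D.dilation t φ, h.dilation_mem ht hφ.1⟩ ∈ (h.conductorOpZero hd).domain := by
      rw [← h1]
      exact hU
    rw [← h.conductorOpZero_toL2 hd _ h2]
    congr 1
    exact Subtype.ext h1

end LocalData.Admissible

end Dilations

/-! ### The Fourier transform of `log |x|` -/

section Frullani

variable {F : Type*} [NormedField F]

/-- A homomorphism `F^× → ℝ` which is nonnegative for `1 ≤ ‖y‖` is a multiple of `log ‖y‖`. -/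
theorem exists_eq_mul_log (l : F → ℝ) (hF : ∃ a : F, 1 < ‖a‖)
    (hmul : ∀ y z, y ≠ 0 → z ≠ 0 → l (y * z) = l y + l z) (hpos : ∀ y, 1 ≤ ‖y‖ → 0 ≤ l y) :
    ∃ c : ℝ, 0 ≤ c ∧ ∀ y, y ≠ 0 → l y = c * Real.log ‖y‖ := by
  obtain ⟨a, ha⟩ := hF
  have ha0 : a ≠ 0 := norm_pos_iff.1 (by linarith)
  have hla : 0 < Real.log ‖a‖ := Real.log_pos ha
  set c := l a / Real.log ‖a‖
  have hc0 : 0 ≤ c := div_nonneg (hpos a ha.le) hla.le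
  have hca : c * Real.log ‖a‖ = l a := div_mul_cancel₀ _ hla.ne'
  refine ⟨c, hc0, fun y hy ↦ ?_⟩
  -- On nonzero elements `Λ` is a homomorphism killing `a`. Every `y` is a power of `a` times some
  -- `z` with `1 ≤ ‖z‖ ≤ ‖a‖`, and there both terms of `Λ` lie between `0` and `l a`.
  let Λ : F → ℝ := fun y ↦ l y - c * Real.log ‖y‖
  have hΛ : ∀ y z, y ≠ 0 → z ≠ 0 → Λ (y * z) = Λ y + Λ z := by
    intro y z hy hz
    simp only [Λ]
    rw [hmul y z hy hz, norm_mul, Real.log_mul (norm_ne_zero_iff.2 hy) (norm_ne_zero_iff.2 hz)]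
    ring
  have h1 : Λ 1 = 0 := by
    have := hΛ 1 1 one_ne_zero one_ne_zero
    rw [mul_one] at this
    linarith
  have hpow : ∀ y, y ≠ 0 → ∀ m : ℕ, Λ (y ^ m) = m * Λ y := by
    intro y hy m
    induction m with
    | zero => simp [h1]
    | succ m ih =>
      rw [pow_succ, hΛ _ _ (pow_ne_zero m hy) hy, ih]
      push_cast
      ring
  have hinv : ∀ y, y ≠ 0 → Λ y⁻¹ = -Λ y := by
    intro y hy
    have := hΛ y y⁻¹ hy (inv_ne_zero hy)
    rw [mul_inv_cancel₀ hy, h1] at this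
    linarith
  have hΛa : Λ a = 0 := by simp only [Λ]; linarith
  have hzpow : ∀ k : ℤ, Λ (a ^ k) = 0 := by
    intro k
    cases k with
    | ofNat m => rw [Int.ofNat_eq_natCast, zpow_natCast, hpow a ha0, hΛa, mul_zero]
    | negSucc m =>
      rw [zpow_negSucc, hinv _ (pow_ne_zero _ ha0), hpow a ha0, hΛa, mul_zero, neg_zero]
  have hbd : ∀ y, y ≠ 0 → |Λ y| ≤ l a := by
    intro y hy
    obtain ⟨k, hk1, hk2⟩ := exists_mem_Ico_zpow (norm_pos_iff.2 hy) ha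
    have hk0 : 0 < ‖a‖ ^ k := by positivity
    set z := y * (a ^ k)⁻¹ with hz
    have hz0 : z ≠ 0 := mul_ne_zero hy (inv_ne_zero (zpow_ne_zero k ha0))
    have hzn : ‖z‖ = ‖y‖ / ‖a‖ ^ k := by rw [hz, norm_mul, norm_inv, norm_zpow, div_eq_mul_inv]
    have hz1 : 1 ≤ ‖z‖ := by rwa [hzn, one_le_div hk0]
    have hz2 : ‖z‖ ≤ ‖a‖ := by
      rw [hzn, div_le_iff₀ hk0, ← zpow_one_add₀ (by positivity), add_comm]
      exact hk2.le
    have hyz : Λ y = Λ z := by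
      rw [hz, hΛ y _ hy (inv_ne_zero (zpow_ne_zero k ha0)), hinv _ (zpow_ne_zero k ha0), hzpow]
      simp
    have h2 : 0 ≤ l (a * z⁻¹) := hpos _ (by
      rw [norm_mul, norm_inv, ← div_eq_mul_inv, one_le_div (by positivity)]
      exact hz2)
    have h3 : l a = l (a * z⁻¹) + l z := by
      rw [← hmul _ _ (mul_ne_zero ha0 (inv_ne_zero hz0)) hz0, inv_mul_cancel_right₀ hz0]
    have h4 : 0 ≤ l z := hpos z hz1
    have h5 : 0 ≤ c * Real.log ‖z‖ := mul_nonneg hc0 (Real.log_nonneg hz1)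
    have h6 : c * Real.log ‖z‖ ≤ l a := by
      rw [← hca]
      gcongr
    rw [hyz, abs_le]
    constructor <;> simp only [Λ] <;> linarith
  -- A bounded homomorphism to `ℝ` vanishes, since `Λ (y ^ m) = m Λ y`.
  have hzero : Λ y = 0 := by
    by_contra hne
    obtain ⟨m, hm⟩ := exists_nat_gt (l a / |Λ y|)
    have h2 := hbd (y ^ m) (pow_ne_zero m hy)
    rw [hpow y hy, abs_mul, Nat.abs_cast] at h2
    rw [div_lt_iff₀ (abs_pos.2 hne)] at hm
    linarith
  simp only [Λ] at hzero
  linarith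

variable [ProperSpace F] [MeasurableSpace F] [BorelSpace F]

namespace LocalData.Admissible

variable {D : LocalData F} {μ : Measure F} {n : ℕ} (h : D.Admissible μ n)
include h

/-- The Lipschitz bound gives `O(‖t‖)` near the origin and the decay gives `O(‖t‖⁻¹)` at infinity;
both are `O(weight²)`, hence `O(weight)`. -/
theorem integrable_mulHaar_of_zero {φ : F → ℂ} (hφ : φ ∈ D.schwartz) (h0 : φ 0 = 0) :
    Integrable φ (mulHaar μ n) := by
  obtain ⟨C, hC⟩ := h.lipschitz φ hφ
  obtain ⟨C₁, hC₁⟩ := h.decay φ hφ 1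
  have hC₁' : 0 ≤ C₁ := le_trans (by positivity) (hC₁ 0)
  refine h.integrable_mulHaar_of_le_weight (C := |C| + C₁)
    (h.continuous_of_mem hφ).aestronglyMeasurable fun t ht ↦ ?_
  have htp : 0 < ‖t‖ := norm_pos_iff.2 ht
  have hw0 := weight_nonneg t
  have hw1 := weight_le_one t
  rcases le_total ‖t‖ 1 with h1 | h1
  · have h2 := hC t 0
    rw [h0, sub_zero, sub_zero] at h2
    calc ‖φ t‖ ≤ C * ‖t‖ := h2
      _ ≤ |C| * weight t ^ 2 := by
        rw [weight_sq_of_le_one ht h1]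
        gcongr
        exact le_abs_self C
      _ ≤ |C| * weight t := by
        gcongr
        nlinarith
      _ ≤ (|C| + C₁) * weight t := by
        gcongr
        linarith
  · have h2 := hC₁ t
    rw [pow_one, mul_comm, ← le_div_iff₀ htp, div_eq_mul_inv, ← weight_sq_of_one_le h1] at h2
    calc ‖φ t‖ ≤ C₁ * weight t ^ 2 := h2
      _ ≤ C₁ * weight t := by
        gcongr
        nlinarith
      _ ≤ (|C| + C₁) * weight t := by
        gcongr
        linarith [abs_nonneg C]

theorem integral_comp_mul_right_mulHaar {E : Type*} [NormedAddCommGroup E] [NormedSpace ℝ E]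
    (f : F → E) {a : F} (ha : a ≠ 0) :
    ∫ t, f (t * a) ∂(mulHaar μ n) = ∫ t, f t ∂(mulHaar μ n) := by
  simp_rw [mul_comm _ a]
  exact (h.measurePreserving_mul_left ha).integral_comp
    (Homeomorph.mulLeft₀ a ha).measurableEmbedding f

theorem integral_comp_inv_mulHaar {E : Type*} [NormedAddCommGroup E] [NormedSpace ℝ E]
    (f : F → E) : ∫ t, f t⁻¹ ∂(mulHaar μ n) = ∫ t, f t ∂(mulHaar μ n) :=
  h.measurePreserving_inv.integral_comp (MeasurableEquiv.inv F).measurableEmbedding f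

theorem integrable_comp_mul_right_mulHaar {E : Type*} [NormedAddCommGroup E]
    {f : F → E} {a : F} (ha : a ≠ 0) (hf : Integrable f (mulHaar μ n)) :
    Integrable (fun t ↦ f (t * a)) (mulHaar μ n) := by
  simp_rw [mul_comm _ a]
  exact (h.measurePreserving_mul_left ha).integrable_comp_of_integrable hf

/-- Frullani's integral. -/
theorem exists_frullani {G : F → ℝ} (hG : (fun x ↦ (G x : ℂ)) ∈ D.schwartz) (hG0 : G 0 = 1)
    (hanti : ∀ x y, ‖x‖ ≤ ‖y‖ → G y ≤ G x) :
    ∃ c : ℝ, 0 < c ∧ ∀ y, y ≠ 0 → Integrable (fun t ↦ G t - G (t * y)) (mulHaar μ n) ∧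
      ∫ t, (G t - G (t * y)) ∂(mulHaar μ n) = c * Real.log ‖y‖ ∧
      ∫ t, |G t - G (t * y)| ∂(mulHaar μ n) = c * |Real.log ‖y‖| := by
  have hGc : Continuous G := by
    have := Complex.continuous_re.comp (h.continuous_of_mem hG)
    exact this
  have hint : ∀ y, y ≠ 0 → Integrable (fun t ↦ G t - G (t * y)) (mulHaar μ n) := by
    intro y hy
    have h1 := h.add_mem _ hG _ (h.smul_mem (-1) _ (h.dilate_mem _ hG y hy))
    have h2 := (h.integrable_mulHaar_of_zero h1 (by simp)).re
    refine h2.congr (Filter.Eventually.of_forall fun t ↦ ?_)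
    simp [mul_comm t y, sub_eq_add_neg]
  set l : F → ℝ := fun y ↦ ∫ t, (G t - G (t * y)) ∂(mulHaar μ n)
  -- Split `G(t) - G(tyz)` at `G(ty)` and translate the second part by `y`. Thus `l` is a
  -- homomorphism, and it is nonnegative for `1 ≤ ‖y‖` by monotonicity of `G`.
  have hmul : ∀ y z, y ≠ 0 → z ≠ 0 → l (y * z) = l y + l z := by
    intro y z hy hz
    have h1 : l z = ∫ t, (G (t * y) - G (t * y * z)) ∂(mulHaar μ n) :=
      (h.integral_comp_mul_right_mulHaar (fun t ↦ G t - G (t * z)) hy).symm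
    rw [h1, ← integral_add (hint y hy)
      (h.integrable_comp_mul_right_mulHaar (f := fun t ↦ G t - G (t * z)) hy (hint z hz))]
    refine integral_congr_ae (Filter.Eventually.of_forall fun t ↦ ?_)
    simp only
    rw [← mul_assoc]
    ring
  have hge : ∀ y, 1 ≤ ‖y‖ → ∀ t, 0 ≤ G t - G (t * y) := by
    intro y hy t
    refine sub_nonneg.2 (hanti _ _ ?_)
    rw [norm_mul]
    exact le_mul_of_one_le_right (norm_nonneg t) hy
  have hle : ∀ y, ‖y‖ ≤ 1 → ∀ t, G t - G (t * y) ≤ 0 := by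
    intro y hy t
    refine sub_nonpos.2 (hanti _ _ ?_)
    rw [norm_mul]
    exact mul_le_of_le_one_right (norm_nonneg t) hy
  obtain ⟨c, hc0, hc⟩ := exists_eq_mul_log l h.exists_one_lt_norm hmul
    fun y hy ↦ integral_nonneg (hge y hy)
  -- If `c = 0`, then `G(ta) = G(t)` for all `t`, so `G` is constant on the powers of `a`. Negative
  -- powers give the value `G 0 = 1`, which contradicts the decay along positive powers.
  have hcpos : 0 < c := by
    refine lt_of_le_of_ne hc0 fun hc' ↦ ?_
    obtain ⟨a, ha⟩ := h.exists_one_lt_norm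
    have ha0 : a ≠ 0 := norm_pos_iff.1 (by linarith)
    have h1 : l a = 0 := by rw [hc a ha0, ← hc', zero_mul]
    have h2 : (fun t ↦ G t - G (t * a)) =ᵐ[mulHaar μ n] 0 :=
      (integral_eq_zero_iff_of_nonneg (hge a ha.le) (hint a ha0)).1 h1
    have := h.isAddHaarMeasure
    have h3 : (fun t ↦ G t - G (t * a)) = 0 :=
      (Continuous.ae_eq_iff_eq μ (by fun_prop) continuous_const).1
        (h.absolutelyContinuous_mulHaar.ae_le h2)
    have h4 : ∀ t, G (t * a) = G t := fun t ↦ by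
      have := congrFun h3 t
      simp only [Pi.zero_apply] at this
      linarith
    have h5 : ∀ k : ℕ, G (a ^ k) = G 1 := by
      intro k
      induction k with
      | zero => simp
      | succ k ih => rw [pow_succ, h4, ih]
    have h6 : ∀ k : ℕ, G ((a⁻¹) ^ k) = G 1 := by
      intro k
      induction k with
      | zero => simp
      | succ k ih => rw [← h4, pow_succ, mul_assoc, inv_mul_cancel₀ ha0, mul_one, ih]
    have h7 : Filter.Tendsto (fun k : ℕ ↦ G ((a⁻¹) ^ k)) Filter.atTop (𝓝 (G 0)) := by
      refine (hGc.tendsto 0).comp (tendsto_pow_atTop_nhds_zero_of_norm_lt_one ?_)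
      rw [norm_inv]
      exact inv_lt_one_of_one_lt₀ ha
    simp_rw [h6] at h7
    have h8 : G 1 = 1 := by rw [tendsto_nhds_unique tendsto_const_nhds h7, hG0]
    obtain ⟨C, hC⟩ := h.decay _ hG 1
    obtain ⟨k, hk⟩ := pow_unbounded_of_one_lt C ha
    have h9 := hC (a ^ k)
    rw [h5, h8] at h9
    simp at h9
    linarith
  refine ⟨c, hcpos, fun y hy ↦ ⟨hint y hy, hc y hy, ?_⟩⟩
  have hyp := norm_pos_iff.2 hy
  rcases le_total 1 ‖y‖ with h1 | h1
  · rw [abs_of_nonneg (Real.log_nonneg h1), ← hc y hy]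
    exact integral_congr_ae (Filter.Eventually.of_forall fun t ↦ abs_of_nonneg (hge y h1 t))
  · rw [abs_of_nonpos (Real.log_nonpos hyp.le h1), mul_neg, ← hc y hy, ← integral_neg]
    exact integral_congr_ae (Filter.Eventually.of_forall fun t ↦ abs_of_nonpos (hle y h1 t))

variable (hd : D.IsSelfDual μ)
include hd

/-- The Fourier transform of `log |y|` is `-κ / |u|` away from the origin. -/
theorem exists_integral_logMul : ∃ κ : ℝ, 0 ≤ κ ∧ ∀ φ ∈ D.schwartz, φ 0 = 0 →
    ∫ y, D.logMul (D.fourierInv μ φ) y ∂μ = -(κ * ∫ u, φ u ∂(mulHaar μ n)) := by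
  have := h.sigmaFinite
  have := h.isAddHaarMeasure
  obtain ⟨G, hG, hG0, hanti⟩ := h.exists_radial
  obtain ⟨c, hc0, hc⟩ := h.exists_frullani hG hG0 hanti
  have hGc : Continuous G := Complex.continuous_re.comp (h.continuous_of_mem hG)
  -- The logarithm of the module is `n log ‖y‖`, while Frullani's integral yields `c log ‖y‖`.
  refine ⟨n / c, by positivity, fun φ hφ hφ0 ↦ ?_⟩
  set ν := mulHaar μ n with hν
  set ψ := D.fourierInv μ φ with hψ
  have hψm : ψ ∈ D.schwartz := h.fourierInv_mem hφ
  have hψc := h.continuous_of_mem hψm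
  have hψi := h.integrable_of_mem hψm
  set Ghat := D.fourier μ (fun x ↦ (G x : ℂ)) with hGhat
  have hGhatm : Ghat ∈ D.schwartz := h.fourier_mem _ hG
  have hGhatc := h.continuous_of_mem hGhatm
  have hGhat1 : ∫ u, Ghat u ∂μ = 1 := by
    have h1 := hd.fourier_fourier _ hG 0
    rw [LocalData.fourier] at h1
    simp only [zero_mul, neg_zero, h.character_zero, mul_one, hG0] at h1
    simpa using h1
  -- The hypothesis `φ 0 = 0` enters here; it removes the term `G(t)` from the inner integral in
  -- `step2`.
  have hψ0 : ∫ y, ψ y ∂μ = 0 := by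
    have h1 := congrFun (h.fourier_fourierInv hd hφ) 0
    simp only [LocalData.fourier, zero_mul, neg_zero, h.character_zero, mul_one, hφ0] at h1
    exact h1
  -- the first application of Fubini's theorem
  have hint1 : Integrable (fun p : F × F ↦ ((G p.2 - G (p.2 * p.1) : ℝ) : ℂ) * ψ p.1)
      (μ.prod ν) := by
    have hm : AEStronglyMeasurable (fun p : F × F ↦ ((G p.2 - G (p.2 * p.1) : ℝ) : ℂ) * ψ p.1)
        (μ.prod ν) := by
      refine Continuous.aestronglyMeasurable ?_
      fun_prop
    rw [integrable_prod_iff hm]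
    constructor
    · filter_upwards [h.ae_ne_zero] with y hy
      exact (hc y hy).1.ofReal.mul_const _
    · refine ((h.integrable_logMul hψm).norm.const_mul (c / n)).congr ?_
      filter_upwards [h.ae_ne_zero] with y hy
      simp only [norm_mul, Complex.norm_real, Real.norm_eq_abs]
      rw [integral_mul_const, (hc y hy).2.2, h.logMul_apply, norm_mul, Complex.norm_real,
        norm_mul, Real.norm_natCast, Real.norm_eq_abs]
      have : (n : ℝ) ≠ 0 := by exact_mod_cast h.n_pos.ne'
      field_simp
  have step1 : ∫ y, D.logMul ψ y ∂μ
      = (n / c : ℝ) * ∫ y, ∫ t, ((G t - G (t * y) : ℝ) : ℂ) * ψ y ∂ν ∂μ := by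
    rw [← integral_const_mul]
    refine integral_congr_ae ?_
    filter_upwards [h.ae_ne_zero] with y hy
    rw [integral_mul_const, integral_complex_ofReal, (hc y hy).2.1, h.logMul_apply, ← mul_assoc]
    congr 1
    norm_cast
    field_simp
  -- the second application of Fubini's theorem
  have hinner : ∀ u : F, u ≠ 0 → ∀ k : F → ℂ,
      ∫ t, ((‖t‖ ^ n)⁻¹ : ℝ) * k (u / t) ∂ν = ((‖u‖ ^ n)⁻¹ : ℝ) * ∫ s, k s ∂μ := by
    intro u hu k
    rw [h.integral_eq_mulHaar k, ← integral_const_mul, ← hν,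
      ← h.integral_comp_inv_mulHaar, ← h.integral_comp_mul_right_mulHaar _ (inv_ne_zero hu)]
    refine integral_congr_ae ?_
    filter_upwards [h.ae_mulHaar_ne_zero] with t ht
    have h1 : ‖u‖ ≠ 0 := norm_ne_zero_iff.2 hu
    have h2 : ‖t‖ ≠ 0 := norm_ne_zero_iff.2 ht
    have h3 : u / (t * u⁻¹)⁻¹ = t := by field_simp
    rw [h3, Complex.real_smul, ← mul_assoc]
    congr 1
    norm_cast
    simp only [norm_inv, norm_mul, mul_inv, inv_inv, mul_pow, inv_pow]
    field_simp
  have hφν := h.integrable_mulHaar_of_zero hφ hφ0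
  have hint2 : Integrable (fun p : F × F ↦ φ p.1 * (((‖p.2‖ ^ n)⁻¹ : ℝ) * Ghat (p.1 / p.2)))
      (μ.prod ν) := by
    have hm : AEStronglyMeasurable (fun p : F × F ↦ φ p.1 * (((‖p.2‖ ^ n)⁻¹ : ℝ) *
        Ghat (p.1 / p.2))) (μ.prod ν) := by
      have h1 := (h.continuous_of_mem hφ).measurable
      have h2 := hGhatc.measurable
      refine Measurable.aestronglyMeasurable ?_
      fun_prop
    have hn : ∀ u t : F, ‖φ u * (((‖t‖ ^ n)⁻¹ : ℝ) * Ghat (u / t))‖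
        = ‖φ u‖ * ((‖t‖ ^ n)⁻¹ * ‖Ghat (u / t)‖) := by
      intro u t
      rw [norm_mul, norm_mul, Complex.norm_real, Real.norm_of_nonneg (by positivity)]
    have hinner' : ∀ u : F, u ≠ 0 →
        ∫ t, (‖t‖ ^ n)⁻¹ * ‖Ghat (u / t)‖ ∂ν = (‖u‖ ^ n)⁻¹ * ∫ s, ‖Ghat s‖ ∂μ := by
      intro u hu
      have h1 := hinner u hu fun s ↦ (‖Ghat s‖ : ℂ)
      rw [integral_complex_ofReal] at h1
      have h2 : ∫ t, (((‖t‖ ^ n)⁻¹ : ℝ) : ℂ) * (‖Ghat (u / t)‖ : ℂ) ∂ν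
          = ((∫ t, (‖t‖ ^ n)⁻¹ * ‖Ghat (u / t)‖ ∂ν : ℝ) : ℂ) := by
        rw [← integral_complex_ofReal]
        push_cast
        rfl
      rw [h2] at h1
      exact_mod_cast h1
    rw [integrable_prod_iff hm]
    constructor
    · filter_upwards [h.ae_ne_zero] with u hu
      refine Integrable.const_mul ?_ _
      have h1 : Integrable (fun s ↦ ((‖s‖ ^ n : ℝ) : ℂ) * Ghat s) ν := by
        have := h.integrable_iff_mulHaar.1 (h.integrable_of_mem hGhatm)
        simpa only [Complex.real_smul] using this
      have h2 := (h.measurePreserving_inv.integrable_comp_of_integrable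
        (h.integrable_comp_mul_right_mulHaar hu h1)).const_mul (((‖u‖ ^ n)⁻¹ : ℝ) : ℂ)
      refine h2.congr ?_
      filter_upwards [h.ae_mulHaar_ne_zero] with t ht
      have h3 : ‖u‖ ≠ 0 := norm_ne_zero_iff.2 hu
      have h4 : ‖t‖ ≠ 0 := norm_ne_zero_iff.2 ht
      simp only [Function.comp]
      rw [← mul_assoc, mul_comm t⁻¹ u, ← div_eq_mul_inv]
      congr 1
      norm_cast
      rw [norm_div, div_pow]
      field_simp
    · simp_rw [hn]
      refine ((integrable_mulHaar_iff.1 hφν).norm.mul_const (∫ s, ‖Ghat s‖ ∂μ)).congr ?_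
      filter_upwards [h.ae_ne_zero] with u hu
      rw [integral_const_mul, hinner' u hu, norm_smul, Real.norm_of_nonneg (by positivity)]
      ring
  have heven : ∀ x, G (-x) = G x := fun x ↦
    le_antisymm (hanti _ _ (by simp)) (hanti _ _ (by simp))
  -- The multiplication formula moves the transform from `φ` to `y ↦ G(ty)`, where it becomes `|t|⁻¹
  -- Ghat(u/t)`.
  have step2 : ∀ t : F, t ≠ 0 → ∫ y, ((G t - G (t * y) : ℝ) : ℂ) * ψ y ∂μ
      = -∫ u, φ u * (((‖t‖ ^ n)⁻¹ : ℝ) * Ghat (u / t)) ∂μ := by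
    intro t ht
    have hGt := h.dilate_mem _ hG t ht
    obtain ⟨C, -, hC⟩ := h.exists_bound hGt
    have h1 : Integrable (fun y ↦ (G (t * y) : ℂ) * ψ y) μ :=
      hψi.bdd_mul (h.continuous_of_mem hGt).aestronglyMeasurable
        (Filter.Eventually.of_forall hC)
    have h2 : ∫ y, ((G t - G (t * y) : ℝ) : ℂ) * ψ y ∂μ = -∫ y, (G (t * y) : ℂ) * ψ y ∂μ := by
      push_cast
      simp_rw [sub_mul]
      rw [integral_sub (hψi.const_mul _) h1, integral_const_mul, hψ0]
      simp
    rw [h2]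
    congr 1
    have h3 : ∫ y, (G (t * y) : ℂ) * ψ y ∂μ = ∫ y, D.fourier μ φ y * (G (t * y) : ℂ) ∂μ := by
      rw [← integral_neg_eq_self]
      refine integral_congr_ae (Filter.Eventually.of_forall fun y ↦ ?_)
      simp only [hψ]
      rw [h.fourierInv_eq, neg_neg, mul_neg, heven, mul_comm]
    rw [h3, h.integral_fourier_mul (h.integrable_of_mem hφ) (h.integrable_of_mem hGt)]
    refine integral_congr_ae (Filter.Eventually.of_forall fun u ↦ ?_)
    simp only
    rw [h.fourier_dilate (fun x ↦ (G x : ℂ)) ht]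
  calc ∫ y, D.logMul ψ y ∂μ
      = (n / c : ℝ) * ∫ y, ∫ t, ((G t - G (t * y) : ℝ) : ℂ) * ψ y ∂ν ∂μ := step1
    _ = (n / c : ℝ) * ∫ t, ∫ y, ((G t - G (t * y) : ℝ) : ℂ) * ψ y ∂μ ∂ν := by
        rw [integral_integral_swap hint1]
    _ = (n / c : ℝ) * ∫ t, -∫ u, φ u * (((‖t‖ ^ n)⁻¹ : ℝ) * Ghat (u / t)) ∂μ ∂ν := by
        congr 1
        refine integral_congr_ae ?_
        filter_upwards [h.ae_mulHaar_ne_zero] with t ht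
        exact step2 t ht
    _ = -((n / c : ℝ) * ∫ u, ∫ t, φ u * (((‖t‖ ^ n)⁻¹ : ℝ) * Ghat (u / t)) ∂ν ∂μ) := by
        rw [integral_neg, ← integral_integral_swap hint2, mul_neg]
    _ = -((n / c : ℝ) * ∫ u, φ u ∂ν) := by
        congr 2
        rw [hν, integral_mulHaar]
        refine integral_congr_ae ?_
        filter_upwards [h.ae_ne_zero] with u hu
        rw [integral_const_mul, hinner u hu, hGhat1, mul_one, Complex.real_smul, mul_comm]

end LocalData.Admissible

end Frullani

/-! ### The kernel of the conductor operator -/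

section Kernel

variable {F : Type*} [NormedField F]

/-- The kernel `|t|^(1/2) / |1 - t|`. -/
def mulKernel (n : ℕ) (t : F) : ℝ := √(‖t‖ ^ n) / ‖1 - t‖ ^ n

theorem mulKernel_nonneg (n : ℕ) (t : F) : 0 ≤ mulKernel n t := by
  unfold mulKernel; positivity

theorem mulKernel_inv (n : ℕ) {t : F} (ht : t ≠ 0) : mulKernel n t⁻¹ = mulKernel n t := by
  have h0 : 0 < ‖t‖ ^ n := pow_pos (norm_pos_iff.2 ht) n
  have h1 : ‖1 - t⁻¹‖ = ‖1 - t‖ / ‖t‖ := by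
    rw [← norm_div, ← norm_neg]
    congr 1
    field_simp
    ring
  have h2 : √(‖t‖ ^ n) * √(‖t‖ ^ n) = ‖t‖ ^ n := Real.mul_self_sqrt h0.le
  have h3 : √(‖t‖ ^ n) ≠ 0 := (Real.sqrt_pos.2 h0).ne'
  unfold mulKernel
  rw [h1, norm_inv, inv_pow, Real.sqrt_inv, div_pow]
  -- If this power vanishes, both sides are `0` by the convention on division.
  rcases eq_or_ne (‖1 - t‖ ^ n) 0 with h4 | h4
  · simp [h4]
  · field_simp
    linarith

theorem measurable_mulKernel [ProperSpace F] [MeasurableSpace F] [BorelSpace F] (n : ℕ) :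
    Measurable (mulKernel n : F → ℝ) := by
  unfold mulKernel; fun_prop

theorem norm_mem_of_norm_one_sub_le {t : F} (ht : ‖1 - t‖ ≤ 1 / 2) :
    1 / 2 ≤ ‖t‖ ∧ ‖t‖ ≤ 3 / 2 := by
  have h1 := norm_sub_norm_le (1 : F) t
  have h2 := norm_sub_norm_le t (1 : F)
  rw [norm_sub_rev] at h2
  rw [norm_one] at h1 h2
  constructor <;> linarith

variable [ProperSpace F] [MeasurableSpace F] [BorelSpace F]

/-- Near `t = 1`, put `u = t - 1`: the integrand is bounded by a multiple of `‖u‖ ‖u‖⁻ⁿ`, that is,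
of `‖u‖` for `d*u`. Elsewhere the kernel is bounded by a multiple of the integrable weight, with the
square root as decay at the origin and at infinity. -/
theorem HasModule.integrable_mulKernel {μ : Measure F} {n : ℕ} (h : HasModule μ n) :
    Integrable (fun t ↦ mulKernel n t * min 1 ‖1 - t‖) (mulHaar μ n) := by
  have := h.isAddHaarMeasure
  set A : Set F := {t | ‖1 - t‖ ≤ 1 / 2}
  have hA : MeasurableSet A := by measurability
  have hmeas : Measurable fun t : F ↦ mulKernel n t * min 1 ‖1 - t‖ :=
    (measurable_mulKernel n).mul (by fun_prop)
  rw [← integrableOn_univ, ← Set.union_compl_self A]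
  refine IntegrableOn.union ?_ ?_
  · have h1 : Integrable (fun u : F ↦ ({u : F | ‖u‖ ≤ 1 / 2}).indicator (fun u ↦ ‖u‖) u)
        (mulHaar μ n) := by
      refine h.integrable_mulHaar_of_le_weight (C := 1) ?_ fun u hu ↦ ?_
      · exact (measurable_norm.indicator (by measurability)).aestronglyMeasurable
      · by_cases h2 : ‖u‖ ≤ 1 / 2
        · rw [Set.indicator_of_mem (by exact h2), norm_norm, one_mul,
            weight_of_le_one hu (by linarith)]
          exact Real.le_sqrt_of_sq_le (by nlinarith [norm_nonneg u])
        · rw [Set.indicator_of_notMem (by exact h2), norm_zero, one_mul]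
          exact weight_nonneg u
    have h2 := (integrable_mulHaar_iff.1 h1).comp_sub_right (1 : F)
    rw [← integrable_indicator_iff hA, integrable_mulHaar_iff]
    refine (h2.const_mul (2 ^ n * √((3 / 2) ^ n))).mono' (Measurable.aestronglyMeasurable ?_)
      (Filter.Eventually.of_forall fun t ↦ ?_)
    · exact (measurable_norm.pow_const n).inv.smul (hmeas.indicator hA)
    · by_cases ht : t ∈ A
      · have ht' : ‖1 - t‖ ≤ 1 / 2 := ht
        obtain ⟨h3, h4⟩ := norm_mem_of_norm_one_sub_le ht'
        have h5 : t - 1 ∈ {u : F | ‖u‖ ≤ 1 / 2} := by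
          change ‖t - 1‖ ≤ 1 / 2
          rwa [norm_sub_rev]
        rw [Set.indicator_of_mem ht, Set.indicator_of_mem h5, norm_smul, norm_mul,
          Real.norm_of_nonneg (mulKernel_nonneg n t), Real.norm_of_nonneg (by positivity),
          Real.norm_of_nonneg (by positivity), norm_sub_rev t 1, mulKernel, smul_eq_mul]
        have h6 : (‖t‖ ^ n)⁻¹ ≤ 2 ^ n := by
          rw [← inv_pow]
          gcongr
          exact inv_le_of_inv_le₀ (by norm_num) (by linarith)
        calc (‖t‖ ^ n)⁻¹ * (√(‖t‖ ^ n) / ‖1 - t‖ ^ n * min 1 ‖1 - t‖)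
            ≤ 2 ^ n * (√((3 / 2) ^ n) / ‖1 - t‖ ^ n * ‖1 - t‖) := by
              gcongr
              exact min_le_right _ _
          _ = 2 ^ n * √((3 / 2) ^ n) * ((‖1 - t‖ ^ n)⁻¹ * ‖1 - t‖) := by ring
      · rw [Set.indicator_of_notMem ht, smul_zero, norm_zero]
        refine mul_nonneg (by positivity) (smul_nonneg (by positivity) ?_)
        exact Set.indicator_nonneg (fun _ _ ↦ norm_nonneg _) _
  · rw [← integrable_indicator_iff hA.compl]
    -- Off `A` one has `1/2 < ‖1 - t‖`, so both `1` and `‖t‖ ≤ 1 + ‖1 - t‖` are at most `3 ‖1 - t‖`.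
    refine h.integrable_mulHaar_of_le_weight (C := 3 ^ n)
      (hmeas.indicator hA.compl).aestronglyMeasurable fun t ht0 ↦ ?_
    by_cases ht : t ∈ A
    · rw [Set.indicator_of_notMem (by simpa using ht), norm_zero]
      exact mul_nonneg (by positivity) (weight_nonneg t)
    · have ht' : 1 / 2 < ‖1 - t‖ := not_le.1 ht
      have htp : 0 < ‖t‖ := norm_pos_iff.2 ht0
      rw [Set.indicator_of_mem (by exact ht), norm_mul,
          Real.norm_of_nonneg (mulKernel_nonneg n t), Real.norm_of_nonneg (by positivity), mulKernel]
      have h1 : √(‖t‖ ^ n) / ‖1 - t‖ ^ n * min 1 ‖1 - t‖ ≤ √(‖t‖ ^ n) / ‖1 - t‖ ^ n :=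
        mul_le_of_le_one_right (by positivity) (min_le_left _ _)
      refine h1.trans ?_
      rw [div_le_iff₀ (by positivity)]
      rcases le_total ‖t‖ 1 with h2 | h2
      · rw [weight_of_le_one ht0 h2]
        have h3 : √(‖t‖ ^ n) ≤ √‖t‖ :=
          Real.sqrt_le_sqrt (pow_le_of_le_one htp.le h2 h.n_pos.ne')
        have h4 : (1 : ℝ) ≤ 3 ^ n * ‖1 - t‖ ^ n := by
          rw [← mul_pow]
          exact one_le_pow₀ (by linarith)
        calc √(‖t‖ ^ n) ≤ 1 * √‖t‖ := by rw [one_mul]; exact h3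
          _ ≤ (3 ^ n * ‖1 - t‖ ^ n) * √‖t‖ := by gcongr
          _ = 3 ^ n * √‖t‖ * ‖1 - t‖ ^ n := by ring
      · rw [weight_of_one_le h2]
        have h3 : ‖t‖ ≤ 3 * ‖1 - t‖ := by
          have := norm_sub_norm_le t (1 : F)
          rw [norm_sub_rev, norm_one] at this
          linarith
        have h4 : ‖t‖ ^ n ≤ 3 ^ n * ‖1 - t‖ ^ n := by
          rw [← mul_pow]
          gcongr
        have h5 : √‖t‖ ≤ √(‖t‖ ^ n) :=
          Real.sqrt_le_sqrt (le_self_pow₀ h2 h.n_pos.ne')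
        have h6 : 0 < √‖t‖ := Real.sqrt_pos.2 htp
        have h7 : √(‖t‖ ^ n) * √(‖t‖ ^ n) = ‖t‖ ^ n := Real.mul_self_sqrt (by positivity)
        rw [mul_assoc, mul_comm (√‖t‖)⁻¹, ← mul_assoc, le_mul_inv_iff₀ h6]
        calc √(‖t‖ ^ n) * √‖t‖ ≤ √(‖t‖ ^ n) * √(‖t‖ ^ n) := by gcongr
          _ ≤ 3 ^ n * ‖1 - t‖ ^ n := by rw [h7]; exact h4

/-- The square root is removed by `|1 - s| ≤ |1 - s²|` for `s > 0`; then a difference of powers of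
`‖t‖` and `1` has to be estimated. -/
theorem abs_one_sub_inv_sqrt_pow_le (n : ℕ) {t : F} (ht : ‖1 - t‖ ≤ 1 / 2) :
    |1 - (√(‖t‖ ^ n))⁻¹| ≤ 2 ^ n * (n * (3 / 2) ^ n) * ‖1 - t‖ := by
  obtain ⟨h3, h4⟩ := norm_mem_of_norm_one_sub_le ht
  have htp : 0 < ‖t‖ := by linarith
  set s := (√(‖t‖ ^ n))⁻¹
  have hs : 0 < s := inv_pos.2 (Real.sqrt_pos.2 (by positivity))
  have hs2 : s ^ 2 = (‖t‖ ^ n)⁻¹ := by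
    simp only [s]
    rw [inv_pow, Real.sq_sqrt (by positivity)]
  have h5 : |1 - s| ≤ |1 - s ^ 2| := by
    have : 1 - s ^ 2 = (1 - s) * (1 + s) := by ring
    rw [this, abs_mul, abs_of_pos (by linarith : 0 < 1 + s)]
    exact le_mul_of_one_le_right (abs_nonneg _) (by linarith)
  have h6 : |1 - s ^ 2| = (‖t‖ ^ n)⁻¹ * |‖t‖ ^ n - 1 ^ n| := by
    have h7 : 1 - s ^ 2 = (‖t‖ ^ n)⁻¹ * (‖t‖ ^ n - 1 ^ n) := by
      rw [hs2, one_pow, mul_sub, inv_mul_cancel₀ (by positivity), mul_one]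
    rw [h7, abs_mul, abs_of_pos (show 0 < (‖t‖ ^ n)⁻¹ by positivity)]
  have h7 := abs_pow_sub_pow_le ‖t‖ 1 n
  have h8 : |‖t‖ - 1| ≤ ‖1 - t‖ := by
    have := abs_norm_sub_norm_le t (1 : F)
    rwa [norm_one, norm_sub_rev] at this
  have h9 : (‖t‖ ^ n)⁻¹ ≤ 2 ^ n := by
    rw [← inv_pow]
    gcongr
    exact inv_le_of_inv_le₀ (by norm_num) (by linarith)
  have h10 : max |‖t‖| |(1 : ℝ)| ^ (n - 1) ≤ (3 / 2) ^ n := by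
    calc max |‖t‖| |(1 : ℝ)| ^ (n - 1) ≤ (3 / 2) ^ (n - 1) := by
          gcongr
          rw [abs_of_pos htp, abs_one]
          exact max_le h4 (by norm_num)
      _ ≤ (3 / 2) ^ n := by
          gcongr
          · norm_num
          · omega
  calc |1 - s| ≤ (‖t‖ ^ n)⁻¹ * |‖t‖ ^ n - 1 ^ n| := h6 ▸ h5
    _ ≤ 2 ^ n * (‖1 - t‖ * n * (3 / 2) ^ n) := by
        gcongr
        exact h7.trans (by gcongr)
    _ = 2 ^ n * (n * (3 / 2) ^ n) * ‖1 - t‖ := by ring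

namespace LocalData.Admissible

variable {D : LocalData F} {μ : Measure F} {n : ℕ} (h : D.Admissible μ n)
include h

theorem norm_dilation_weight (t : F) :
    ‖((Real.sqrt (D.module t))⁻¹ : ℂ)‖ = (√(‖t‖ ^ n))⁻¹ := by
  rw [h.module_eq, norm_inv, Complex.norm_real, Real.norm_of_nonneg (Real.sqrt_nonneg _)]

/-- Test functions vary slowly under dilations. -/
theorem exists_sub_dilation_bound {φ : F → ℂ} (hφ : φ ∈ D.schwartzZero) :
    ∃ C R : ℝ, 0 ≤ C ∧ ∀ t : F, ‖1 - t‖ ≤ 1 / 2 → ∀ x, ‖φ x - D.dilation t φ x‖ ≤ C * ‖1 - t‖ ∧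
      (R < ‖x‖ → φ x - D.dilation t φ x = 0) := by
  obtain ⟨R₀, hR₀⟩ := hφ.2.1.isCompact.isBounded.exists_norm_le
  set R := |R₀|
  have hR : ∀ x, R < ‖x‖ → φ x = 0 := fun x hx ↦
    image_eq_zero_of_notMem_tsupport fun hmem ↦ by linarith [hR₀ x hmem, le_abs_self R₀]
  have hR0 : 0 ≤ R := abs_nonneg _
  obtain ⟨C₀, hC₀⟩ := h.lipschitz φ hφ.1
  obtain ⟨M, hM0, hM⟩ := h.exists_bound hφ.1
  -- The first constant bounds `φ(x) - φ(x/t)` by the Lipschitz property, the second the effect of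
  -- the factor `|t|^(-1/2)`. Since `‖t‖ ≤ 3/2`, the radius `2R` contains the supports of `φ` and of
  -- its dilate.
  refine ⟨|C₀| * (4 * R) + 2 ^ n * (n * (3 / 2) ^ n) * M, 2 * R, by positivity, fun t ht x ↦ ?_⟩
  obtain ⟨h3, h4⟩ := norm_mem_of_norm_one_sub_le ht
  have htp : 0 < ‖t‖ := by linarith
  have ht0 : t ≠ 0 := norm_pos_iff.1 htp
  have hzero : 2 * R < ‖x‖ → φ x - D.dilation t φ x = 0 := by
    intro hx
    have h5 : φ (x / t) = 0 := by
      refine hR _ ?_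
      rw [norm_div, lt_div_iff₀ htp]
      nlinarith
    simp only [LocalData.dilation]
    rw [h5, hR x (by linarith), mul_zero, sub_zero]
  refine ⟨?_, hzero⟩
  by_cases hx : 2 * R < ‖x‖
  · rw [hzero hx, norm_zero]
    positivity
  · have h5 : ‖φ x - φ (x / t)‖ ≤ |C₀| * (4 * R) * ‖1 - t‖ := by
      have h6 : ‖x - x / t‖ ≤ 4 * R * ‖1 - t‖ := by
        have h7 : x - x / t = -(x * (1 - t) / t) := by
          field_simp
          ring
        rw [h7, norm_neg, norm_div, norm_mul, div_le_iff₀ htp]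
        have h8 : ‖x‖ ≤ 2 * R := not_lt.1 hx
        calc ‖x‖ * ‖1 - t‖ ≤ 2 * R * ‖1 - t‖ := by gcongr
          _ = 4 * R * ‖1 - t‖ * (1 / 2) := by ring
          _ ≤ 4 * R * ‖1 - t‖ * ‖t‖ := by gcongr
      calc ‖φ x - φ (x / t)‖ ≤ C₀ * ‖x - x / t‖ := hC₀ _ _
        _ ≤ |C₀| * (4 * R * ‖1 - t‖) := by
            gcongr
            exact le_abs_self _
        _ = _ := by ring
    have h6 : φ x - D.dilation t φ x
        = (φ x - φ (x / t)) + ((1 - (√(‖t‖ ^ n))⁻¹ : ℝ) : ℂ) * φ (x / t) := by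
      simp only [LocalData.dilation]
      rw [h.module_eq]
      push_cast
      ring
    rw [h6]
    refine (norm_add_le _ _).trans ?_
    rw [norm_mul, Complex.norm_real, Real.norm_eq_abs]
    calc ‖φ x - φ (x / t)‖ + |1 - (√(‖t‖ ^ n))⁻¹| * ‖φ (x / t)‖
        ≤ |C₀| * (4 * R) * ‖1 - t‖ + (2 ^ n * (n * (3 / 2) ^ n) * ‖1 - t‖) * M := by
          gcongr
          · exact abs_one_sub_inv_sqrt_pow_le n ht
          · exact hM _
      _ = _ := by ring

theorem measurable_dilation_apply {φ : F → ℂ} (hφ : Measurable φ) :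
    Measurable fun p : F × F ↦ D.dilation p.2 φ p.1 := by
  simp only [LocalData.dilation, h.module_eq]
  fun_prop

/-- The difference is `O(min(1, ‖1 - t‖))`. For `t` far from `1`, the factor `|t|^(-1/2)` stays
bounded wherever `φ(1/t) ≠ 0`, because `φ` has bounded support. -/
theorem integrable_kernel_one {φ : F → ℂ} (hφ : φ ∈ D.schwartzZero) :
    Integrable (fun t ↦ (mulKernel n t : ℂ) * (φ 1 - D.dilation t φ 1)) (mulHaar μ n) := by
  obtain ⟨C, R, hC0, hC⟩ := h.exists_sub_dilation_bound hφ
  obtain ⟨R₀, hR₀⟩ := hφ.2.1.isCompact.isBounded.exists_norm_le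
  obtain ⟨M, hM0, hM⟩ := h.exists_bound hφ.1
  have hφm := (h.continuous_of_mem hφ.1).measurable
  have hm : Measurable fun t ↦ (mulKernel n t : ℂ) * (φ 1 - D.dilation t φ 1) := by
    have h1 : Measurable fun t : F ↦ D.dilation t φ 1 := by
      simp only [LocalData.dilation, h.module_eq]
      fun_prop
    exact (Complex.measurable_ofReal.comp (measurable_mulKernel n)).mul (measurable_const.sub h1)
  refine (h.integrable_mulKernel.const_mul (C + 2 * (M + √(|R₀| ^ n) * M))).mono'
    hm.aestronglyMeasurable ?_
  filter_upwards [h.ae_mulHaar_ne_zero] with t ht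
  rw [norm_mul, Complex.norm_real, Real.norm_of_nonneg (mulKernel_nonneg n t), mul_left_comm]
  refine mul_le_mul_of_nonneg_left ?_ (mulKernel_nonneg n t)
  have hK : 0 ≤ √(|R₀| ^ n) * M := by positivity
  rcases le_total ‖1 - t‖ (1 / 2) with h1 | h1
  · rw [min_eq_right (by linarith)]
    refine ((hC t h1 1).1).trans ?_
    gcongr
    linarith
  · have h2 : 1 / 2 ≤ min 1 ‖1 - t‖ := le_min (by norm_num) h1
    have h3 : ‖D.dilation t φ 1‖ ≤ √(|R₀| ^ n) * M := by
      simp only [LocalData.dilation]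
      rw [norm_mul, h.norm_dilation_weight]
      by_cases h4 : φ (1 / t) = 0
      · rw [h4, norm_zero, mul_zero]
        exact hK
      · have h5 := hR₀ _ (subset_tsupport _ h4)
        rw [norm_div, norm_one, one_div] at h5
        refine mul_le_mul ?_ (hM _) (norm_nonneg _) (by positivity)
        rw [← Real.sqrt_inv, ← inv_pow]
        refine Real.sqrt_le_sqrt ?_
        gcongr
        exact h5.trans (le_abs_self _)
    calc ‖φ 1 - D.dilation t φ 1‖ ≤ M + √(|R₀| ^ n) * M :=
          (norm_sub_le _ _).trans (add_le_add (hM 1) h3)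
      _ = 2 * (M + √(|R₀| ^ n) * M) * (1 / 2) := by ring
      _ ≤ (C + 2 * (M + √(|R₀| ^ n) * M)) * min 1 ‖1 - t‖ := by
          gcongr
          linarith

/-- At `x = 1` the term `log |x| φ(x)` vanishes, and the character in the outer transform is
absorbed in a translation of `φ`. -/
theorem conductor_one (φ : F → ℂ) :
    D.conductor μ φ 1 = ∫ y, D.logMul (D.fourierInv μ fun x ↦ φ (x + 1)) y ∂μ := by
  have h1 : D.logMul φ 1 = 0 := by
    rw [h.logMul_apply]
    simp
  rw [LocalData.conductor, h1, zero_add, LocalData.fourier]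
  refine integral_congr_ae (Filter.Eventually.of_forall fun y ↦ ?_)
  simp only [LocalData.logMul]
  rw [h.fourierInv_eq, h.fourierInv_eq, h.fourier_translate]
  simp only [mul_one]
  ring

/-- Otherwise dilations force `𝒮₀ = 0`, and then `𝒮₀` could not separate the constant `1` from `0`.
-/
theorem exists_mem_schwartzZero_ne_zero : ∃ φ ∈ D.schwartzZero, φ 1 ≠ 0 := by
  have := h.isAddHaarMeasure
  by_contra! hcon
  have h1 : ∀ φ ∈ D.schwartzZero, ∀ x, φ x = 0 := by
    intro φ hφ x
    rcases eq_or_ne x 0 with rfl | hx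
    · exact hφ.2.2.self_of_nhds
    · have h2 := hcon _ (h.dilation_mem_zero (inv_ne_zero hx) hφ)
      simp only [LocalData.dilation, one_div, inv_inv] at h2
      refine (mul_eq_zero.1 h2).resolve_left fun h3 ↦ ?_
      have h4 := h.norm_dilation_weight x⁻¹
      rw [h3, norm_zero] at h4
      have h5 : 0 < √(‖x⁻¹‖ ^ n) :=
        Real.sqrt_pos.2 (pow_pos (norm_pos_iff.2 (inv_ne_zero hx)) n)
      exact (inv_pos.2 h5).ne h4
  have h2 := h.separates (fun _ ↦ 1) (locallyIntegrable_const 1) fun ψ hψ ↦ by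
    simp [h1 ψ hψ]
  have h3 : (fun _ : F ↦ (1 : ℂ)) = 0 :=
    (Continuous.ae_eq_iff_eq μ continuous_const continuous_const).1 h2
  exact one_ne_zero (congrFun h3 0)

variable (hd : D.IsSelfDual μ)
include hd

/-- The conductor operator is given by the kernel `mulKernel`. -/
theorem exists_conductor_eq : ∃ (c : ℂ) (κ : ℝ), 0 ≤ κ ∧ ∀ φ ∈ D.schwartzZero, ∀ x, x ≠ 0 →
    D.conductor μ φ x = c * φ x +
      κ * ∫ t, (mulKernel n t : ℂ) * (φ x - D.dilation t φ x) ∂(mulHaar μ n) := by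
  obtain ⟨κ, hκ0, hκ⟩ := h.exists_integral_logMul hd
  -- The translate `φ(u + 1)` vanishes at `u = 0`, so the transform of `log |y|` is the density
  -- `-κ/|u|`. The substitution `u + 1 = 1/t` turns it into `mulKernel`.
  have key : ∀ φ ∈ D.schwartzZero, φ 1 = 0 → D.conductor μ φ 1
      = κ * ∫ t, (mulKernel n t : ℂ) * (φ 1 - D.dilation t φ 1) ∂(mulHaar μ n) := by
    have := h.isAddHaarMeasure
    intro φ hφ h1
    rw [h.conductor_one, hκ _ (h.translate_mem φ hφ.1 1) (by simpa using h1), ← mul_neg,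
      integral_mulHaar, ← integral_sub_right_eq_self _ (1 : F), h.integral_eq_mulHaar,
      ← h.integral_comp_inv_mulHaar, ← integral_neg]
    congr 1
    refine integral_congr_ae ?_
    filter_upwards [h.ae_mulHaar_ne_zero] with t ht
    have h2 : 0 < ‖t‖ ^ n := pow_pos (norm_pos_iff.2 ht) n
    have h3 : (√(‖t‖ ^ n) : ℂ) ≠ 0 := by
      exact_mod_cast (Real.sqrt_pos.2 h2).ne'
    have h4 : ‖t⁻¹ - 1‖ = ‖1 - t‖ / ‖t‖ := by
      rw [← norm_div]
      congr 1
      field_simp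
    simp only [LocalData.dilation, sub_add_cancel]
    rw [h1, h.module_eq, h4, zero_sub, mul_neg, mulKernel, one_div, norm_inv, Complex.real_smul,
      Complex.real_smul, ← mul_assoc, ← mul_assoc]
    congr 2
    rw [div_pow, inv_pow, inv_div]
    push_cast
    have h5 : ((‖t‖ : ℂ)) ^ n ≠ 0 := by exact_mod_cast h2.ne'
    field_simp
  obtain ⟨φ₀, hφ₀, hne⟩ := h.exists_mem_schwartzZero_ne_zero
  -- This linear functional vanishes on all `φ ∈ 𝒮₀` with `φ 1 = 0`, hence is a multiple of the
  -- evaluation at `1`; the multiple is the constant `c`.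
  set T : (F → ℂ) → ℂ := fun φ ↦ D.conductor μ φ 1 -
    κ * ∫ t, (mulKernel n t : ℂ) * (φ 1 - D.dilation t φ 1) ∂(mulHaar μ n) with hT
  have hlin : ∀ φ ∈ D.schwartzZero, ∀ a : ℂ, T (fun x ↦ φ x + a * φ₀ x) = T φ + a * T φ₀ := by
    intro φ hφ a
    have hadd : (fun x ↦ φ x + a * φ₀ x) ∈ D.schwartz :=
      h.add_mem _ hφ.1 _ (h.smul_mem a _ hφ₀.1)
    have hφ' := h.translate_mem φ hφ.1 1
    have hφ₀' := h.translate_mem φ₀ hφ₀.1 1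
    simp only [hT]
    rw [h.conductor_one, h.conductor_one, h.conductor_one]
    have h1 : ∫ y, D.logMul (D.fourierInv μ fun x ↦ φ (x + 1) + a * φ₀ (x + 1)) y ∂μ
        = ∫ y, D.logMul (D.fourierInv μ fun x ↦ φ (x + 1)) y ∂μ
          + a * ∫ y, D.logMul (D.fourierInv μ fun x ↦ φ₀ (x + 1)) y ∂μ := by
      rw [← integral_const_mul, ← integral_add (h.integrable_logMul (h.fourierInv_mem hφ'))
        ((h.integrable_logMul (h.fourierInv_mem hφ₀')).const_mul a)]
      refine integral_congr_ae (Filter.Eventually.of_forall fun y ↦ ?_)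
      simp only [LocalData.logMul]
      rw [h.fourierInv_eq, h.fourierInv_eq, h.fourierInv_eq, h.fourier_add (h.integrable_of_mem hφ')
        ((h.integrable_of_mem hφ₀').const_mul a), h.fourier_const_mul]
      ring
    have h2 : ∫ t, (mulKernel n t : ℂ) * (φ 1 + a * φ₀ 1 -
          D.dilation t (fun x ↦ φ x + a * φ₀ x) 1) ∂(mulHaar μ n)
        = ∫ t, (mulKernel n t : ℂ) * (φ 1 - D.dilation t φ 1) ∂(mulHaar μ n)
          + a * ∫ t, (mulKernel n t : ℂ) * (φ₀ 1 - D.dilation t φ₀ 1) ∂(mulHaar μ n) := by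
      rw [← integral_const_mul, ← integral_add (h.integrable_kernel_one hφ)
        ((h.integrable_kernel_one hφ₀).const_mul a)]
      refine integral_congr_ae (Filter.Eventually.of_forall fun t ↦ ?_)
      simp only [LocalData.dilation]
      ring
    rw [h1, h2]
    ring
  set c := T φ₀ / φ₀ 1 with hc
  have hone : ∀ φ ∈ D.schwartzZero, D.conductor μ φ 1 = c * φ 1 +
      κ * ∫ t, (mulKernel n t : ℂ) * (φ 1 - D.dilation t φ 1) ∂(mulHaar μ n) := by
    intro φ hφ
    have h1 : (fun x ↦ φ x + -(φ 1 / φ₀ 1) * φ₀ x) ∈ D.schwartzZero :=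
      h.spaceZero.add_mem (x := φ) hφ (h.spaceZero.smul_mem (-(φ 1 / φ₀ 1)) (x := φ₀) hφ₀)
    have h2 : T (fun x ↦ φ x + -(φ 1 / φ₀ 1) * φ₀ x) = 0 := by
      have h3 := key _ h1 (by rw [neg_mul, div_mul_cancel₀ _ hne, add_neg_cancel])
      simp only [hT]
      rw [h3, sub_self]
    rw [hlin φ hφ] at h2
    have h3 : T φ = c * φ 1 := by
      rw [hc]
      field_simp at h2 ⊢
      linear_combination h2
    rw [← h3]
    simp only [hT]
    ring
  refine ⟨c, κ, hκ0, fun φ hφ x hx ↦ ?_⟩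
  -- The dilation by `x⁻¹` moves `x` to `1`, and both sides are covariant under it.
  have h1 := hone _ (h.dilation_mem_zero (inv_ne_zero hx) hφ)
  rw [h.conductor_dilation hd (inv_ne_zero hx) hφ.1 one_ne_zero] at h1
  have hs : ((Real.sqrt (D.module x⁻¹))⁻¹ : ℂ) ≠ 0 := by
    rw [← norm_ne_zero_iff, h.norm_dilation_weight]
    exact (inv_pos.2 (Real.sqrt_pos.2 (pow_pos (norm_pos_iff.2 (inv_ne_zero hx)) n))).ne'
  have h2 : ∀ g : F → ℂ, D.dilation x⁻¹ g 1 = ((Real.sqrt (D.module x⁻¹))⁻¹ : ℂ) * g x := by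
    intro g
    simp only [LocalData.dilation, one_div, inv_inv]
  have h3 : ∫ t, (mulKernel n t : ℂ) * (D.dilation x⁻¹ φ 1 -
        D.dilation t (D.dilation x⁻¹ φ) 1) ∂(mulHaar μ n)
      = ((Real.sqrt (D.module x⁻¹))⁻¹ : ℂ) *
        ∫ t, (mulKernel n t : ℂ) * (φ x - D.dilation t φ x) ∂(mulHaar μ n) := by
    rw [← integral_const_mul]
    refine integral_congr_ae (Filter.Eventually.of_forall fun t ↦ ?_)
    simp only
    rw [h.dilation_dilation, mul_comm t, ← h.dilation_dilation, h2, h2]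
    ring
  rw [h3, h2, h2] at h1
  refine mul_left_cancel₀ hs ?_
  rw [h1]
  ring

end LocalData.Admissible

end Kernel

/-! ### The quadratic form of the conductor operator -/

section WeakForm

variable {F : Type*} [NormedField F] [ProperSpace F] [MeasurableSpace F] [BorelSpace F]

theorem integral_norm_mul_norm_le {μ : Measure F} (f g : Lp ℂ 2 μ) :
    Integrable (fun x ↦ ‖f x‖ * ‖g x‖) μ ∧ ∫ x, ‖f x‖ * ‖g x‖ ∂μ ≤ ‖f‖ * ‖g‖ := by
  have hf := (Lp.memLp f).norm
  have hg := (Lp.memLp g).norm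
  have hnorm : ∀ f : Lp ℂ 2 μ, ‖(Lp.memLp f).norm.toLp _‖ = ‖f‖ := fun f ↦ by
    rw [Lp.norm_toLp, eLpNorm_norm, Lp.norm_def]
  have h1 : (fun x ↦ inner ℝ (hf.toLp _ x) (hg.toLp _ x)) =ᵐ[μ] fun x ↦ ‖f x‖ * ‖g x‖ := by
    filter_upwards [hf.coeFn_toLp, hg.coeFn_toLp] with x h2 h3
    rw [h2, h3]
    simp [mul_comm]
  refine ⟨(L2.integrable_inner (𝕜 := ℝ) (hf.toLp _) (hg.toLp _)).congr h1, ?_⟩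
  rw [← integral_congr_ae h1, ← L2.inner_def, ← hnorm f, ← hnorm g]
  exact real_inner_le_norm _ _

namespace LocalData.Admissible

variable {D : LocalData F} {μ : Measure F} {n : ℕ} (h : D.Admissible μ n)
include h

theorem exists_norm_sub_dilationL2_le {φ : F → ℂ} (hφ : φ ∈ D.schwartzZero) :
    ∃ C : ℝ, 0 ≤ C ∧ ∀ t : F,
      ‖h.toL2 ⟨φ, hφ.1⟩ - h.dilationL2 t (h.toL2 ⟨φ, hφ.1⟩)‖ ≤ C * min 1 ‖1 - t‖ := by
  have := h.isAddHaarMeasure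
  obtain ⟨C, R, hC0, hC⟩ := h.exists_sub_dilation_bound hφ
  set f := h.toL2 ⟨φ, hφ.1⟩
  -- Near `t = 1` the difference is dominated by a multiple of the indicator of a fixed ball.
  -- Elsewhere its norm is at most `2‖f‖`, and the minimum is at least `1/2`; hence `4‖f‖` in the
  -- constant.
  set g : Lp ℂ 2 μ := indicatorConstLp 2 (measurableSet_closedBall (x := (0 : F)) (ε := R))
    measure_closedBall_lt_top.ne 1
  refine ⟨C * ‖g‖ + 4 * ‖f‖, by positivity, fun t ↦ ?_⟩
  rcases le_total ‖1 - t‖ (1 / 2) with ht | ht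
  · have htp : 0 < ‖t‖ := by linarith [(norm_mem_of_norm_one_sub_le ht).1]
    have ht0 : t ≠ 0 := norm_pos_iff.1 htp
    have h1 : ‖f - h.dilationL2 t f‖ ≤ C * ‖1 - t‖ * ‖g‖ := by
      refine Lp.norm_le_mul_norm_of_ae_le_mul ?_
      filter_upwards [Lp.coeFn_sub f (h.dilationL2 t f), h.coeFn_toL2 ⟨φ, hφ.1⟩,
        h.coeFn_dilationL2 ht0 f, h.dilation_congr_ae ht0 (h.coeFn_toL2 ⟨φ, hφ.1⟩),
        (indicatorConstLp_coeFn : g =ᵐ[μ] _)] with x h2 h3 h4 h5 h6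
      rw [h2, Pi.sub_apply, h4, h5, h3, h6]
      obtain ⟨h7, h8⟩ := hC t ht x
      by_cases hx : R < ‖x‖
      · rw [h8 hx, norm_zero]
        positivity
      · rw [Set.indicator_of_mem (by simpa using hx), norm_one, mul_one]
        exact h7
    rw [min_eq_right (by linarith)]
    nlinarith [mul_nonneg (norm_nonneg f) (norm_nonneg (1 - t))]
  · have h2 : 1 / 2 ≤ min 1 ‖1 - t‖ := le_min (by norm_num) ht
    calc ‖f - h.dilationL2 t f‖ ≤ ‖f‖ + ‖f‖ := by
          simpa using norm_sub_le f (h.dilationL2 t f)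
      _ = 4 * ‖f‖ * (1 / 2) := by ring
      _ ≤ (C * ‖g‖ + 4 * ‖f‖) * min 1 ‖1 - t‖ := by
        gcongr
        exact le_add_of_nonneg_left (by positivity)

theorem aestronglyMeasurable_kernel (g : Lp ℂ 2 μ) {φ : F → ℂ} (hφ : φ ∈ D.schwartz) :
    AEStronglyMeasurable (fun p : F × F ↦ (mulKernel n p.2 : ℂ) *
      ((φ p.1 - D.dilation p.2 φ p.1) * (starRingEnd ℂ) (g p.1))) (μ.prod (mulHaar μ n)) := by
  have hφm := (h.continuous_of_mem hφ).measurable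
  have := h.isAddHaarMeasure
  have h1 : AEStronglyMeasurable (fun p : F × F ↦ (starRingEnd ℂ) (g p.1))
      (μ.prod (mulHaar μ n)) :=
    Complex.continuous_conj.comp_aestronglyMeasurable (Lp.aestronglyMeasurable g).comp_fst
  refine AEStronglyMeasurable.mul ?_ (AEStronglyMeasurable.mul ?_ h1)
  · exact (Complex.measurable_ofReal.comp
      ((measurable_mulKernel n).comp measurable_snd)).aestronglyMeasurable
  · exact ((hφm.comp measurable_fst).sub (h.measurable_dilation_apply hφm)).aestronglyMeasurable

theorem inner_sub_dilationL2 (g : Lp ℂ 2 μ) {φ : F → ℂ} (hφ : φ ∈ D.schwartzZero) {t : F}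
    (ht : t ≠ 0) : inner ℂ g (h.toL2 ⟨φ, hφ.1⟩ - h.dilationL2 t (h.toL2 ⟨φ, hφ.1⟩))
      = ∫ x, (φ x - D.dilation t φ x) * (starRingEnd ℂ) (g x) ∂μ := by
  refine inner_eq_integral (Filter.EventuallyEq.refl _ _) ?_
  filter_upwards [Lp.coeFn_sub (h.toL2 ⟨φ, hφ.1⟩) (h.dilationL2 t (h.toL2 ⟨φ, hφ.1⟩)),
    h.coeFn_toL2 ⟨φ, hφ.1⟩, h.coeFn_toL2 ⟨_, h.dilation_mem ht hφ.1⟩] with x h1 h2 h3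
  rw [h1, Pi.sub_apply, h2, h.dilationL2_toL2 ht, h3]

theorem integral_norm_sub_dilation_mul_le (g : Lp ℂ 2 μ) {φ : F → ℂ} (hφ : φ ∈ D.schwartzZero)
    {t : F} (ht : t ≠ 0) :
    Integrable (fun x ↦ ‖(φ x - D.dilation t φ x) * (starRingEnd ℂ) (g x)‖) μ ∧
    ∫ x, ‖(φ x - D.dilation t φ x) * (starRingEnd ℂ) (g x)‖ ∂μ
      ≤ ‖h.toL2 ⟨φ, hφ.1⟩ - h.dilationL2 t (h.toL2 ⟨φ, hφ.1⟩)‖ * ‖g‖ := by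
  have h1 := integral_norm_mul_norm_le
    (h.toL2 ⟨φ, hφ.1⟩ - h.dilationL2 t (h.toL2 ⟨φ, hφ.1⟩)) g
  have h2 : (fun x ↦ ‖(h.toL2 ⟨φ, hφ.1⟩ - h.dilationL2 t (h.toL2 ⟨φ, hφ.1⟩)) x‖ * ‖g x‖)
      =ᵐ[μ] fun x ↦ ‖(φ x - D.dilation t φ x) * (starRingEnd ℂ) (g x)‖ := by
    filter_upwards [Lp.coeFn_sub (h.toL2 ⟨φ, hφ.1⟩) (h.dilationL2 t (h.toL2 ⟨φ, hφ.1⟩)),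
      h.coeFn_toL2 ⟨φ, hφ.1⟩, h.coeFn_toL2 ⟨_, h.dilation_mem ht hφ.1⟩] with x h1 h2 h3
    rw [h1, Pi.sub_apply, h2, h.dilationL2_toL2 ht, h3, norm_mul, RCLike.norm_conj]
  exact ⟨h1.1.congr h2, (integral_congr_ae h2).symm.le.trans h1.2⟩

/-- For each `t ≠ 0` the Cauchy-Schwarz inequality bounds the integral over `x` by a multiple of
`k(t) min(1, ‖1 - t‖)`. This justifies Fubini's theorem in the weak form of the kernel formula. -/
theorem integrable_kernel_prod (g : Lp ℂ 2 μ) {φ : F → ℂ} (hφ : φ ∈ D.schwartzZero) :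
    Integrable (fun p : F × F ↦ (mulKernel n p.2 : ℂ) *
      ((φ p.1 - D.dilation p.2 φ p.1) * (starRingEnd ℂ) (g p.1))) (μ.prod (mulHaar μ n)) := by
  have := h.isAddHaarMeasure
  obtain ⟨C, hC0, hC⟩ := h.exists_norm_sub_dilationL2_le hφ
  have hm := h.aestronglyMeasurable_kernel g hφ.1
  rw [integrable_prod_iff' hm]
  constructor
  · filter_upwards [h.ae_mulHaar_ne_zero, hm.prodMk_right] with t ht hmt
    rw [← integrable_norm_iff hmt]
    simp_rw [norm_mul (mulKernel n t : ℂ)]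
    exact (h.integral_norm_sub_dilation_mul_le g hφ ht).1.const_mul _
  · refine (h.integrable_mulKernel.const_mul (C * ‖g‖)).mono' hm.norm.prod_swap.integral_prod_right' ?_
    filter_upwards [h.ae_mulHaar_ne_zero] with t ht
    rw [Real.norm_of_nonneg (integral_nonneg fun _ ↦ norm_nonneg _)]
    simp_rw [norm_mul (mulKernel n t : ℂ)]
    rw [integral_const_mul, Complex.norm_real, Real.norm_of_nonneg (mulKernel_nonneg n t)]
    calc mulKernel n t * ∫ x, ‖(φ x - D.dilation t φ x) * (starRingEnd ℂ) (g x)‖ ∂μ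
        ≤ mulKernel n t * ((C * min 1 ‖1 - t‖) * ‖g‖) := by
          gcongr
          · exact mulKernel_nonneg n t
          · refine (h.integral_norm_sub_dilation_mul_le g hφ ht).2.trans ?_
            gcongr
            exact hC t
      _ = C * ‖g‖ * (mulKernel n t * min 1 ‖1 - t‖) := by ring

theorem integrable_kernel_inner (g : Lp ℂ 2 μ) {φ : F → ℂ} (hφ : φ ∈ D.schwartzZero) :
    Integrable (fun t ↦ (mulKernel n t : ℂ) *
      inner ℂ g (h.toL2 ⟨φ, hφ.1⟩ - h.dilationL2 t (h.toL2 ⟨φ, hφ.1⟩))) (mulHaar μ n) := by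
  have := h.isAddHaarMeasure
  refine (h.integrable_kernel_prod g hφ).integral_prod_right.congr ?_
  filter_upwards [h.ae_mulHaar_ne_zero] with t ht
  rw [integral_const_mul, h.inner_sub_dilationL2 g hφ ht]

variable (hd : D.IsSelfDual μ)
include hd

/-- The weak form `H = c + κ ∫ k(t) (1 - U(t)) d*t` on `𝒮₀`. Semiboundedness, the Inversion and
essential self-adjointness all rest on it. -/
theorem exists_inner_conductorL2_eq : ∃ (c : ℂ) (κ : ℝ), 0 ≤ κ ∧
    ∀ (g : Lp ℂ 2 μ) (φ : F → ℂ) (hφ : φ ∈ D.schwartzZero),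
      inner ℂ g (h.conductorL2 hd ⟨φ, hφ.1⟩) = c * inner ℂ g (h.toL2 ⟨φ, hφ.1⟩) +
        κ * ∫ t, (mulKernel n t : ℂ) *
          inner ℂ g (h.toL2 ⟨φ, hφ.1⟩ - h.dilationL2 t (h.toL2 ⟨φ, hφ.1⟩)) ∂(mulHaar μ n) := by
  have := h.isAddHaarMeasure
  obtain ⟨c, κ, hκ, hc⟩ := h.exists_conductor_eq hd
  refine ⟨c, κ, hκ, fun g φ hφ ↦ ?_⟩
  have hprod := h.integrable_kernel_prod g hφ
  have h1 : ∫ t, (mulKernel n t : ℂ) *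
        inner ℂ g (h.toL2 ⟨φ, hφ.1⟩ - h.dilationL2 t (h.toL2 ⟨φ, hφ.1⟩)) ∂(mulHaar μ n)
      = ∫ t, ∫ x, (mulKernel n t : ℂ) *
        ((φ x - D.dilation t φ x) * (starRingEnd ℂ) (g x)) ∂μ ∂(mulHaar μ n) := by
    refine integral_congr_ae ?_
    filter_upwards [h.ae_mulHaar_ne_zero] with t ht
    rw [integral_const_mul, h.inner_sub_dilationL2 g hφ ht]
  have h2 : Integrable (fun x ↦ φ x * (starRingEnd ℂ) (g x)) μ := by
    refine (L2.integrable_inner (𝕜 := ℂ) g (h.toL2 ⟨φ, hφ.1⟩)).congr ?_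
    filter_upwards [h.coeFn_toL2 ⟨φ, hφ.1⟩] with x hx
    rw [hx, RCLike.inner_apply]
  rw [h1, ← integral_integral_swap (f := fun x t ↦ (mulKernel n t : ℂ) *
      ((φ x - D.dilation t φ x) * (starRingEnd ℂ) (g x))) hprod,
    inner_eq_integral (Filter.EventuallyEq.refl _ _) (h.coeFn_conductorL2 hd ⟨φ, hφ.1⟩),
    h.inner_toL2, ← integral_const_mul, ← integral_const_mul,
    ← integral_add (h2.const_mul c) (hprod.integral_prod_left.const_mul _)]
  refine integral_congr_ae ?_
  filter_upwards [h.ae_ne_zero] with x hx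
  rw [hc φ hφ x hx]
  simp_rw [← mul_assoc]
  rw [integral_mul_const]
  ring

/-- Since `U(t)` is isometric, `Re ⟨f, f - U(t) f⟩ ≥ 0`; with `k ≥ 0` and `κ ≥ 0` the integral only
increases the form, and `Re c` is a lower bound. -/
theorem isBoundedBelow_conductorOpZero : IsBoundedBelow (h.conductorOpZero hd) := by
  obtain ⟨c, κ, hκ, hc⟩ := h.exists_inner_conductorL2_eq hd
  refine ⟨c.re, fun ⟨f, hf⟩ ↦ ?_⟩
  obtain ⟨φ, hφ, rfl⟩ := h.mem_domainZero.1 (h.domain_conductorOpZero hd ▸ hf)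
  rw [h.conductorOpZero_toL2, ← inner_conj_symm, Complex.conj_re, hc _ φ hφ]
  set f := h.toL2 ⟨φ, hφ.1⟩
  rw [Complex.add_re, inner_self_eq_norm_sq_to_K, Complex.re_ofReal_mul]
  have h1 : (c * (Complex.ofReal ‖f‖) ^ 2).re = c.re * ‖f‖ ^ 2 := by
    rw [← Complex.ofReal_pow, Complex.re_mul_ofReal]
  have h2 : 0 ≤ (∫ t, (mulKernel n t : ℂ) * inner ℂ f (f - h.dilationL2 t f) ∂(mulHaar μ n)).re := by
    have h3 := integral_re (h.integrable_kernel_inner f hφ)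
    simp only [RCLike.re_to_complex] at h3
    rw [← h3]
    refine integral_nonneg fun t ↦ ?_
    rw [Complex.re_ofReal_mul]
    refine mul_nonneg (mulKernel_nonneg n t) ?_
    rw [inner_sub_right, Complex.sub_re, inner_self_eq_norm_sq_to_K]
    have h4 : ((Complex.ofReal ‖f‖) ^ 2).re = ‖f‖ ^ 2 := by
      rw [← Complex.ofReal_pow, Complex.ofReal_re]
    have h5 := (Complex.re_le_norm _).trans (norm_inner_le_norm (𝕜 := ℂ) f (h.dilationL2 t f))
    rw [LinearIsometryEquiv.norm_map] at h5
    have h6 : ((Complex.ofReal ‖f‖) ^ 2).re - (inner ℂ f (h.dilationL2 t f)).re ≥ 0 := by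
      rw [h4]; nlinarith
    exact h6
  exact h1.symm.le.trans (le_add_of_nonneg_right (mul_nonneg hκ h2))

/-- In the weak form, `I U(t) = U(1/t) I`, while `k` and `d*t` are invariant under `t ↦ 1/t`. -/
theorem conductorL2_inversion {φ : F → ℂ} (hφ : φ ∈ D.schwartzZero) :
    h.conductorL2 hd ⟨D.inversion φ, h.inversion_mem φ hφ⟩
      = h.inversionL2 (h.conductorL2 hd ⟨φ, hφ.1⟩) := by
  obtain ⟨c, κ, hκ, hc⟩ := h.exists_inner_conductorL2_eq hd
  refine ext_inner_left ℂ fun g ↦ ?_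
  rw [hc g _ (h.inversion_mem_zero hφ), ← h.inner_inversionL2_left, hc _ φ hφ,
    ← h.inversionL2_toL2 hφ, h.inner_inversionL2_left, ← h.integral_comp_inv_mulHaar]
  congr 2
  refine integral_congr_ae ?_
  filter_upwards [h.ae_mulHaar_ne_zero] with t ht
  rw [mulKernel_inv n ht, h.inner_inversionL2_left, map_sub, ← h.inversionL2_dilationL2 ht]

theorem commutesWith_inversionL2 : CommutesWith (h.conductorOpZero hd) h.inversionL2 := by
  have key : ∀ f ∈ h.domainZero, h.inversionL2 f ∈ h.domainZero := by
    intro f hf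
    obtain ⟨φ, hφ, rfl⟩ := h.mem_domainZero.1 hf
    rw [h.inversionL2_toL2 hφ]
    exact h.mem_domainZero.2 ⟨_, h.inversion_mem_zero hφ, rfl⟩
  refine ⟨fun f ↦ ?_, fun f hf hUf ↦ ?_⟩
  · rw [h.domain_conductorOpZero hd]
    refine ⟨fun hf ↦ ?_, key f⟩
    rw [← h.inversionL2_inversionL2 f]
    exact key _ hf
  · obtain ⟨φ, hφ, rfl⟩ := h.mem_domainZero.1 (h.domain_conductorOpZero hd ▸ hf)
    rw [h.conductorOpZero_toL2 hd ⟨φ, hφ.1⟩ hf, ← h.conductorL2_inversion hd hφ]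
    have h1 := h.inversionL2_toL2 hφ
    have h2 : h.toL2 ⟨D.inversion φ, h.inversion_mem φ hφ⟩ ∈ (h.conductorOpZero hd).domain :=
      h1 ▸ hUf
    rw [← h.conductorOpZero_toL2 hd _ h2]
    congr 1
    exact Subtype.ext h1

end LocalData.Admissible

end WeakForm

/-! ### Essential self-adjointness -/

section Averages

/-- In the quotient by the closed subspace the integrand is zero almost everywhere. -/
theorem integral_mem_of_isClosed {X G : Type*} [MeasurableSpace X] {ν : Measure X}
    [NormedAddCommGroup G] [NormedSpace ℂ G] [CompleteSpace G] {S : Submodule ℂ G}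
    (hS : _root_.IsClosed (S : Set G)) {f : X → G} (hf : Integrable f ν)
    (hmem : ∀ᵐ x ∂ν, f x ∈ S) : ∫ x, f x ∂ν ∈ S := by
  have : _root_.IsClosed (S : Set G) := hS
  rw [← Submodule.Quotient.mk_eq_zero]
  have h1 := S.mkQL.integral_comp_comm hf
  have h2 : ∫ x, S.mkQL (f x) ∂ν = 0 := by
    refine integral_eq_zero_of_ae ?_
    filter_upwards [hmem] with x hx
    exact (Submodule.Quotient.mk_eq_zero S).2 hx
  exact h1.symm.trans h2

variable {F : Type*} [NormedField F] [ProperSpace F] [MeasurableSpace F] [BorelSpace F]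

/-- A normalized tent function around `1`. The last estimate, Lipschitz continuity of multiplicative
translation in `L¹(d*t)`, is what cancels the singularity of the kernel; its constant may depend on
`ε`. -/
theorem HasModule.exists_bump {μ : Measure F} {n : ℕ} (h : HasModule μ n) {ε : ℝ} (hε : 0 < ε)
    (hε2 : ε ≤ 1 / 2) : ∃ k : F → ℝ, (∀ t, 0 ≤ k t) ∧ (∀ t, k t ≠ 0 → ‖1 - t‖ ≤ ε) ∧
      Integrable k (mulHaar μ n) ∧ ∫ t, k t ∂(mulHaar μ n) = 1 ∧
      ∃ C : ℝ, 0 ≤ C ∧ ∀ s : F, s ≠ 0 →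
        ∫ t, |k t - k (t * s⁻¹)| ∂(mulHaar μ n) ≤ C * min 1 ‖1 - s‖ := by
  have := h.isAddHaarMeasure
  set g : F → ℝ := fun t ↦ max 0 (1 - ‖1 - t‖ / ε) with hg
  have hg0 : ∀ t, 0 ≤ g t := fun t ↦ le_max_left _ _
  have hg1 : ∀ t, g t ≤ 1 := fun t ↦ max_le zero_le_one (by
    have : 0 ≤ ‖1 - t‖ / ε := by positivity
    linarith)
  have hgε : ∀ t, g t ≠ 0 → ‖1 - t‖ ≤ ε := by
    intro t ht
    by_contra! hlt
    refine ht (max_eq_left ?_)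
    have : 1 ≤ ‖1 - t‖ / ε := (one_le_div hε).2 hlt.le
    linarith
  have hgm : Measurable g := by fun_prop
  have hlip : ∀ s t, |g s - g t| ≤ ‖s - t‖ / ε := by
    intro s t
    refine (abs_max_sub_max_le_max _ _ _ _).trans (max_le (by simpa using by positivity) ?_)
    have h1 : 1 - ‖1 - s‖ / ε - (1 - ‖1 - t‖ / ε) = (‖1 - t‖ - ‖1 - s‖) / ε := by ring
    rw [h1, abs_div, abs_of_pos hε]
    gcongr
    refine (abs_norm_sub_norm_le _ _).trans (le_of_eq ?_)
    congr 1
    ring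
  -- The shell contains the support of `g`, and that of `t ↦ g(t s⁻¹)` for `‖1 - s‖ ≤ 1/2`, since
  -- there `1/4 ≤ ‖t‖ ≤ 9/4`.
  have hfin := h.mulHaar_closedBall_diff_lt_top (r := 1 / 8) (by norm_num) 3
  set S : Set F := {x | 1 / 8 ≤ ‖x‖ ∧ ‖x‖ ≤ 3}
  have hSm : MeasurableSet S := by measurability
  have hind : ∀ c : ℝ, Integrable (S.indicator fun _ ↦ c) (mulHaar μ n) := fun c ↦
    (integrable_indicator_iff hSm).2 (integrableOn_const hfin.ne)
  have hgS : ∀ t, ‖1 - t‖ ≤ 1 / 2 → t ∈ S := fun t ht ↦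
    ⟨by linarith [(norm_mem_of_norm_one_sub_le ht).1],
      by linarith [(norm_mem_of_norm_one_sub_le ht).2]⟩
  have hgint : Integrable g (mulHaar μ n) := by
    refine (hind 1).mono' hgm.aestronglyMeasurable (Filter.Eventually.of_forall fun t ↦ ?_)
    rw [Real.norm_of_nonneg (hg0 t)]
    by_cases ht : g t = 0
    · rw [ht]
      exact Set.indicator_nonneg (fun _ _ ↦ zero_le_one) _
    · rw [Set.indicator_of_mem (hgS t ((hgε t ht).trans hε2))]
      exact hg1 t
  set Z := ∫ t, g t ∂(mulHaar μ n) with hZ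
  have hZpos : 0 < Z := by
    rw [hZ, integral_pos_iff_support_of_nonneg hg0 hgint, pos_iff_ne_zero]
    intro h0
    have h1 : μ (Metric.ball 1 ε) = 0 := by
      refine measure_mono_null (fun t ht ↦ ?_) (h.absolutelyContinuous_mulHaar h0)
      rw [Metric.mem_ball, dist_comm, dist_eq_norm] at ht
      refine (lt_max_of_lt_right ?_).ne'
      have : ‖1 - t‖ / ε < 1 := (div_lt_one hε).2 ht
      linarith
    exact (Metric.measure_ball_pos μ 1 hε).ne' h1
  have hshift : ∀ s : F, s ≠ 0 → Integrable (fun t ↦ g (t * s⁻¹)) (mulHaar μ n) := by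
    intro s hs
    have := (h.measurePreserving_mul_left (inv_ne_zero hs)).integrable_comp_of_integrable hgint
    simpa only [Function.comp_def, mul_comm] using this
  have hshift1 : ∀ s : F, s ≠ 0 → ∫ t, g (t * s⁻¹) ∂(mulHaar μ n) = Z := fun s hs ↦
    (integral_congr_ae (Filter.Eventually.of_forall fun t ↦ by rw [mul_comm])).trans
      ((h.measurePreserving_mul_left (inv_ne_zero hs)).integral_comp
        (Homeomorph.mulLeft₀ _ (inv_ne_zero hs)).measurableEmbedding g)
  set A : ℝ := (mulHaar μ n).real S
  have hgbound : ∃ C : ℝ, 0 ≤ C ∧ ∀ s : F, s ≠ 0 →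
      ∫ t, |g t - g (t * s⁻¹)| ∂(mulHaar μ n) ≤ C * min 1 ‖1 - s‖ := by
    -- For `s` near `1`, the Lipschitz constant `1/ε` meets `‖t‖/‖s‖ ≤ 3/(1/2) = 6` on a shell of
    -- measure `A`. Otherwise the integral is at most `2Z`, and the minimum is at least `1/2`.
    refine ⟨6 / ε * A + 4 * Z, by positivity, fun s hs ↦ ?_⟩
    have hint := (hgint.sub (hshift s hs)).abs
    rcases le_total ‖1 - s‖ (1 / 2) with h1 | h1
    · obtain ⟨h2, h3⟩ := norm_mem_of_norm_one_sub_le h1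
      have hsp : 0 < ‖s‖ := by linarith
      calc ∫ t, |g t - g (t * s⁻¹)| ∂(mulHaar μ n)
          ≤ ∫ t, S.indicator (fun _ ↦ 6 / ε * ‖1 - s‖) t ∂(mulHaar μ n) := by
            refine integral_mono hint (hind _) fun t ↦ ?_
            by_cases ht : t ∈ S
            · simp only [Set.indicator_of_mem ht]
              refine (hlip _ _).trans ?_
              have h4 : t - t * s⁻¹ = -(t * (1 - s) / s) := by
                field_simp
                ring
              rw [h4, norm_neg, norm_div, norm_mul, div_mul_eq_mul_div]
              gcongr
              rw [div_le_iff₀ hsp]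
              calc ‖t‖ * ‖1 - s‖ ≤ 3 * ‖1 - s‖ := by
                    gcongr
                    exact ht.2
                _ = 6 * ‖1 - s‖ * (1 / 2) := by ring
                _ ≤ 6 * ‖1 - s‖ * ‖s‖ := by gcongr
            · simp only [Set.indicator_of_notMem ht]
              have h4 : g t = 0 := by
                by_contra h5
                exact ht (hgS t ((hgε t h5).trans hε2))
              have h5 : g (t * s⁻¹) = 0 := by
                by_contra h6
                obtain ⟨h7, h8⟩ := norm_mem_of_norm_one_sub_le ((hgε _ h6).trans hε2)
                rw [norm_mul, norm_inv, ← div_eq_mul_inv] at h7 h8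
                rw [le_div_iff₀ hsp] at h7
                rw [div_le_iff₀ hsp] at h8
                exact ht ⟨by linarith, by linarith⟩
              rw [h4, h5, sub_zero, abs_zero]
        _ = 6 / ε * A * ‖1 - s‖ := by
            rw [integral_indicator hSm, setIntegral_const, smul_eq_mul]
            ring
        _ ≤ (6 / ε * A + 4 * Z) * min 1 ‖1 - s‖ := by
            rw [min_eq_right (by linarith)]
            gcongr
            linarith
    · have h2 : 1 / 2 ≤ min 1 ‖1 - s‖ := le_min (by norm_num) h1
      calc ∫ t, |g t - g (t * s⁻¹)| ∂(mulHaar μ n)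
          ≤ ∫ t, (g t + g (t * s⁻¹)) ∂(mulHaar μ n) := by
            refine integral_mono hint (hgint.add (hshift s hs)) fun t ↦ ?_
            exact (abs_sub _ _).trans_eq (by rw [abs_of_nonneg (hg0 _), abs_of_nonneg (hg0 _)])
        _ = 4 * Z * (1 / 2) := by
            rw [integral_add hgint (hshift s hs), hshift1 s hs]
            ring
        _ ≤ (6 / ε * A + 4 * Z) * min 1 ‖1 - s‖ := by
            gcongr
            exact le_add_of_nonneg_left (by positivity)
  obtain ⟨C, hC0, hC⟩ := hgbound
  refine ⟨fun t ↦ Z⁻¹ * g t, fun t ↦ mul_nonneg (inv_nonneg.2 hZpos.le) (hg0 t),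
    fun t ht ↦ hgε t (right_ne_zero_of_mul ht), hgint.const_mul _, ?_, Z⁻¹ * C, by positivity,
    fun s hs ↦ ?_⟩
  · rw [integral_const_mul, inv_mul_cancel₀ hZpos.ne']
  · simp_rw [← mul_sub, abs_mul, abs_of_pos (inv_pos.2 hZpos)]
    rw [integral_const_mul, mul_assoc]
    gcongr
    exact hC s hs

namespace LocalData.Admissible

variable {D : LocalData F} {μ : Measure F} {n : ℕ} (h : D.Admissible μ n)
include h

theorem norm_sub_dilationL2_eq {s t : F} (hs : s ≠ 0) (ht : t ≠ 0) (f : Lp ℂ 2 μ) :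
    ‖h.dilationL2 t f - h.dilationL2 s f‖ = ‖f - h.dilationL2 (t / s) f‖ := by
  have h1 : h.dilationL2 t f = h.dilationL2 s (h.dilationL2 (t / s) f) := by
    rw [h.dilationL2_dilationL2 hs (div_ne_zero ht hs), mul_div_cancel₀ _ hs]
  rw [h1, ← map_sub, LinearIsometryEquiv.norm_map, norm_sub_rev]

/-- Strong continuity at `t = 1`, carried over from `𝒮₀` by density and the isometry of `U(t)`. -/
theorem exists_norm_sub_dilationL2_lt (f : Lp ℂ 2 μ) {ε : ℝ} (hε : 0 < ε) :
    ∃ δ > 0, ∀ t : F, ‖1 - t‖ < δ → ‖f - h.dilationL2 t f‖ < ε := by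
  obtain ⟨g, hg, hfg⟩ := Metric.dense_iff.1 h.dense_domainZero f (ε / 3) (by positivity)
  obtain ⟨φ, hφ, rfl⟩ := h.mem_domainZero.1 hfg
  rw [Metric.mem_ball, dist_comm, dist_eq_norm] at hg
  obtain ⟨C, hC0, hC⟩ := h.exists_norm_sub_dilationL2_le hφ
  set g := h.toL2 ⟨φ, hφ.1⟩
  refine ⟨ε / (3 * (C + 1)), by positivity, fun t ht ↦ ?_⟩
  have h1 : f - h.dilationL2 t f = (f - g) + (g - h.dilationL2 t g) - h.dilationL2 t (f - g) := by
    rw [map_sub]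
    abel
  have h2 : ‖g - h.dilationL2 t g‖ ≤ ε / 3 := by
    calc ‖g - h.dilationL2 t g‖ ≤ C * min 1 ‖1 - t‖ := hC t
      _ ≤ (C + 1) * (ε / (3 * (C + 1))) := by
          gcongr
          · linarith
          · exact (min_le_right _ _).trans ht.le
      _ = ε / 3 := by field_simp
  rw [h1]
  have h3 := norm_sub_le ((f - g) + (g - h.dilationL2 t g)) (h.dilationL2 t (f - g))
  have h4 := norm_add_le (f - g) (g - h.dilationL2 t g)
  rw [LinearIsometryEquiv.norm_map] at h3
  linarith

theorem continuousOn_dilationL2 (f : Lp ℂ 2 μ) :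
    ContinuousOn (fun t ↦ h.dilationL2 t f) {0}ᶜ := by
  intro s hs
  have hs0 : s ≠ 0 := hs
  refine ContinuousAt.continuousWithinAt (Metric.continuousAt_iff.2 fun ε hε ↦ ?_)
  obtain ⟨δ, hδ, hδf⟩ := h.exists_norm_sub_dilationL2_lt f hε
  have hsp : 0 < ‖s‖ := norm_pos_iff.2 hs0
  refine ⟨min ‖s‖ (δ * ‖s‖), by positivity, fun t ht ↦ ?_⟩
  rw [dist_eq_norm] at ht ⊢
  have ht0 : t ≠ 0 := by
    rintro rfl
    rw [zero_sub, norm_neg] at ht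
    exact (lt_irrefl _) (ht.trans_le (min_le_left _ _))
  rw [h.norm_sub_dilationL2_eq hs0 ht0]
  refine hδf _ ?_
  have h1 : 1 - t / s = -((t - s) / s) := by
    field_simp
    ring
  rw [h1, norm_neg, norm_div, div_lt_iff₀ hsp]
  exact ht.trans_le (min_le_right _ _)

theorem aestronglyMeasurable_dilationL2 (f : Lp ℂ 2 μ) :
    AEStronglyMeasurable (fun t ↦ h.dilationL2 t f) (mulHaar μ n) := by
  have h1 := (h.continuousOn_dilationL2 f).aestronglyMeasurable (μ := mulHaar μ n)
    (measurableSet_singleton (0 : F)).compl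
  rwa [Measure.restrict_eq_self_of_ae_mem (s := {0}ᶜ) h.ae_mulHaar_ne_zero] at h1

theorem integrable_smul_dilationL2 {k : F → ℝ} (hk : Integrable k (mulHaar μ n)) (f : Lp ℂ 2 μ) :
    Integrable (fun t ↦ k t • h.dilationL2 t f) (mulHaar μ n) := by
  refine (hk.norm.mul_const ‖f‖).mono'
    (hk.aestronglyMeasurable.smul (h.aestronglyMeasurable_dilationL2 f))
    (Filter.Eventually.of_forall fun t ↦ ?_)
  rw [norm_smul, LinearIsometryEquiv.norm_map]

/-- The average `∫ k(t) U(t) d*t` of the dilations. -/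
def average {k : F → ℝ} (hk : Integrable k (mulHaar μ n)) : Lp ℂ 2 μ →L[ℂ] Lp ℂ 2 μ :=
  LinearMap.mkContinuous
    { toFun := fun f ↦ ∫ t, k t • h.dilationL2 t f ∂(mulHaar μ n)
      map_add' := fun f g ↦ by
        rw [← integral_add (h.integrable_smul_dilationL2 hk f) (h.integrable_smul_dilationL2 hk g)]
        simp_rw [map_add, smul_add]
      map_smul' := fun c f ↦ by
        rw [RingHom.id_apply, ← integral_smul]
        simp_rw [map_smul, smul_comm c] }
    (∫ t, ‖k t‖ ∂(mulHaar μ n)) fun f ↦ by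
      refine (norm_integral_le_integral_norm _).trans (le_of_eq ?_)
      simp_rw [norm_smul, LinearIsometryEquiv.norm_map]
      rw [integral_mul_const]

theorem average_apply {k : F → ℝ} (hk : Integrable k (mulHaar μ n)) (f : Lp ℂ 2 μ) :
    h.average hk f = ∫ t, k t • h.dilationL2 t f ∂(mulHaar μ n) := rfl

/-- The pair is an integral of points `k(t) (U(t) f, U(t) T f)` of the graph. -/
theorem average_mem_graph_closure {T : Lp ℂ 2 μ →ₗ.[ℂ] Lp ℂ 2 μ}
    (hT : ∀ t : F, t ≠ 0 → CommutesWith T (h.dilationL2 t)) {k : F → ℝ}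
    (hk : Integrable k (mulHaar μ n)) (f : T.domain) :
    (h.average hk f, h.average hk (T f)) ∈ T.graph.topologicalClosure := by
  have hi := h.integrable_smul_dilationL2 hk (f : Lp ℂ 2 μ)
  have hi' := h.integrable_smul_dilationL2 hk (T f)
  have h1 : (h.average hk f, h.average hk (T f))
      = ∫ t, (k t • h.dilationL2 t f, k t • h.dilationL2 t (T f)) ∂(mulHaar μ n) := by
    rw [integral_pair hi hi', average_apply, average_apply]
  rw [h1]
  refine integral_mem_of_isClosed T.graph.isClosed_topologicalClosure (hi.prodMk hi') ?_
  filter_upwards [h.ae_mulHaar_ne_zero] with t ht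
  refine T.graph.le_topologicalClosure ?_
  have h2 : (h.dilationL2 t f, h.dilationL2 t (T f)) ∈ T.graph :=
    (commutesWith_iff_graph.1 (hT t ht) _ _).2 (T.mem_graph f)
  have h3 := T.graph.smul_mem (k t : ℂ) h2
  rw [Prod.smul_mk] at h3
  rwa [RCLike.real_smul_eq_coe_smul (K := ℂ), RCLike.real_smul_eq_coe_smul (K := ℂ)]

theorem inner_average_left {k : F → ℝ} (hk : Integrable k (mulHaar μ n)) (f g : Lp ℂ 2 μ) :
    inner ℂ (h.average hk f) g = ∫ t, (k t : ℂ) * inner ℂ (h.dilationL2 t f) g ∂(mulHaar μ n) := by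
  rw [← inner_conj_symm, average_apply, ← integral_inner (h.integrable_smul_dilationL2 hk f),
    ← integral_conj]
  refine integral_congr_ae (Filter.Eventually.of_forall fun t ↦ ?_)
  simp only
  rw [inner_conj_symm, RCLike.real_smul_eq_coe_smul (K := ℂ), inner_smul_left,
    RCLike.conj_ofReal]
  rfl

/-- For each `t`, move `U(t)` to the right as `U(t⁻¹)`, which preserves the domain of `T` and
commutes with `T`. -/
theorem inner_average_adjoint {T : Lp ℂ 2 μ →ₗ.[ℂ] Lp ℂ 2 μ} (hd : Dense (T.domain : Set (Lp ℂ 2 μ)))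
    (hT : ∀ t : F, t ≠ 0 → CommutesWith T (h.dilationL2 t)) {k : F → ℝ}
    (hk : Integrable k (mulHaar μ n)) (x : T.adjoint.domain) (f : T.domain) :
    inner ℂ (h.average hk (T.adjoint x)) (f : Lp ℂ 2 μ) = inner ℂ (h.average hk x) (T f) := by
  rw [inner_average_left, inner_average_left]
  refine integral_congr_ae ?_
  filter_upwards [h.ae_mulHaar_ne_zero] with t ht
  congr 1
  have h1 := hT t⁻¹ (inv_ne_zero ht)
  have h2 := (h1.1 f).2 f.2
  rw [h.inner_dilationL2_left, h.inner_dilationL2_left, ← h1.2 f f.2 h2]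
  exact LinearPMap.adjoint_isFormalAdjoint hd x ⟨_, h2⟩

/-- Averaging after `U(s)` amounts to averaging with the translated weight `t ↦ k(t s⁻¹)`. -/
theorem average_sub_dilationL2 {k : F → ℝ} (hk : Integrable k (mulHaar μ n)) {s : F} (hs : s ≠ 0)
    (f : Lp ℂ 2 μ) : ‖h.average hk (f - h.dilationL2 s f)‖
      ≤ (∫ t, |k t - k (t * s⁻¹)| ∂(mulHaar μ n)) * ‖f‖ := by
  have hk' : Integrable (fun t ↦ k (t * s⁻¹)) (mulHaar μ n) := by
    have := (h.measurePreserving_mul_left (inv_ne_zero hs)).integrable_comp_of_integrable hk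
    simpa only [Function.comp_def, mul_comm] using this
  have h1 : h.average hk (h.dilationL2 s f)
      = ∫ t, k (t * s⁻¹) • h.dilationL2 t f ∂(mulHaar μ n) := by
    rw [average_apply, ← h.integral_comp_mul_right_mulHaar (fun t ↦ k (t * s⁻¹) • _) hs]
    refine integral_congr_ae ?_
    filter_upwards [h.ae_mulHaar_ne_zero] with t ht
    rw [h.dilationL2_dilationL2 ht hs, mul_inv_cancel_right₀ hs]
  rw [map_sub, h1, average_apply, ← integral_sub (h.integrable_smul_dilationL2 hk f)
    (h.integrable_smul_dilationL2 hk' f), ← integral_mul_const]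
  refine (norm_integral_le_integral_norm _).trans (le_of_eq ?_)
  refine integral_congr_ae (Filter.Eventually.of_forall fun t ↦ ?_)
  simp only
  rw [← sub_smul, norm_smul, LinearIsometryEquiv.norm_map, Real.norm_eq_abs]

variable (hd : D.IsSelfDual μ)
include hd

theorem isEssentiallySelfAdjoint_conductorOpZero :
    IsEssentiallySelfAdjoint (h.conductorOpZero hd) := by
  have hdense : Dense ((h.conductorOpZero hd).domain : Set (Lp ℂ 2 μ)) := by
    rw [h.domain_conductorOpZero hd]
    exact h.dense_domainZero
  have hcomm : ∀ t : F, t ≠ 0 → CommutesWith (h.conductorOpZero hd) (h.dilationL2 t) :=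
    fun t ht ↦ h.commutesWith_dilationL2 hd ht
  -- The shift by `2` keeps the radius at most `1/2` for every `m`, as `exists_bump` requires.
  have hε : ∀ m : ℕ, 0 < 1 / ((m : ℝ) + 2) := fun m ↦ by positivity
  have hε2 : ∀ m : ℕ, 1 / ((m : ℝ) + 2) ≤ 1 / 2 := fun m ↦ by
    gcongr
    have : (0 : ℝ) ≤ m := m.cast_nonneg
    linarith
  choose k hk0 hksupp hk hk1 C hC0 hC using fun m : ℕ ↦ h.exists_bump (hε m) (hε2 m)
  refine isEssentiallySelfAdjoint_of_regularizing hdense (h.isFormalAdjoint_conductorOpZero hd)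
    (fun m ↦ h.average (hk m)) (fun f ↦ ?_)
    (fun m f ↦ h.average_mem_graph_closure hcomm (hk m) f) (fun m ↦ ?_)
    (fun m x f ↦ h.inner_average_adjoint hdense hcomm (hk m) x f)
  · rw [Metric.tendsto_atTop]
    intro ε hε'
    obtain ⟨δ, hδ, hδf⟩ := h.exists_norm_sub_dilationL2_lt f (half_pos hε')
    obtain ⟨N, hN⟩ := exists_nat_gt (1 / δ)
    refine ⟨N, fun m hm ↦ ?_⟩
    have hlt : 1 / ((m : ℝ) + 2) < δ := by
      rw [div_lt_comm₀ (by positivity) hδ]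
      have : (N : ℝ) ≤ m := by exact_mod_cast hm
      linarith
    have h1 : f = ∫ t, k m t • f ∂(mulHaar μ n) := by
      rw [integral_smul_const, hk1, one_smul]
    rw [dist_comm, dist_eq_norm, average_apply]
    nth_rewrite 1 [h1]
    rw [← integral_sub ((hk m).smul_const f) (h.integrable_smul_dilationL2 (hk m) f)]
    calc ‖∫ t, (k m t • f - k m t • h.dilationL2 t f) ∂(mulHaar μ n)‖
        ≤ ∫ t, k m t * (ε / 2) ∂(mulHaar μ n) := by
          refine norm_integral_le_of_norm_le ((hk m).mul_const _)
            (Filter.Eventually.of_forall fun t ↦ ?_)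
          rw [← smul_sub, norm_smul, Real.norm_of_nonneg (hk0 m t)]
          by_cases ht : k m t = 0
          · simp [ht]
          · exact mul_le_mul_of_nonneg_left
              (hδf t ((hksupp m t ht).trans_lt hlt)).le (hk0 m t)
      _ = ε / 2 := by rw [integral_mul_const, hk1, one_mul]
      _ < ε := half_lt_self hε'
  · obtain ⟨c, κ, hκ, hc⟩ := h.exists_inner_conductorL2_eq hd
    set R := h.average (hk m) with hR
    set B := ∫ t, mulKernel n t * min 1 ‖1 - t‖ ∂(mulHaar μ n)
    refine ⟨‖c‖ * ‖R‖ + κ * (C m * B), fun ⟨f, hf⟩ ↦ ?_⟩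
    obtain ⟨φ, hφ, rfl⟩ := h.mem_domainZero.1 (h.domain_conductorOpZero hd ▸ hf)
    rw [h.conductorOpZero_toL2]
    set f := h.toL2 ⟨φ, hφ.1⟩
    -- The vector `R† y` in the weak form expresses `‖y‖²` by the inner products `⟨y, R (f - U(t)
    -- f)⟩`. Their bound `O(min(1, ‖1 - t‖))` makes the kernel integrable, and division by `‖y‖`
    -- gives the estimate of `R H f`.
    set y := R (h.conductorL2 hd ⟨φ, hφ.1⟩)
    have hadj : ∀ g : Lp ℂ 2 μ, inner ℂ (R.adjoint y) g = inner ℂ y (R g) := fun g ↦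
      ContinuousLinearMap.adjoint_inner_left R g y
    have h1 : inner ℂ y y = c * inner ℂ y (R f) + κ * ∫ t, (mulKernel n t : ℂ) *
        inner ℂ y (R (f - h.dilationL2 t f)) ∂(mulHaar μ n) := by
      have h2 := hc (R.adjoint y) φ hφ
      simp only [hadj] at h2
      exact h2
    have h2 : ‖∫ t, (mulKernel n t : ℂ) * inner ℂ y (R (f - h.dilationL2 t f)) ∂(mulHaar μ n)‖
        ≤ C m * B * (‖y‖ * ‖f‖) := by
      have h3 : C m * B * (‖y‖ * ‖f‖)
          = ∫ t, (mulKernel n t * min 1 ‖1 - t‖) * (C m * (‖y‖ * ‖f‖)) ∂(mulHaar μ n) := by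
        rw [integral_mul_const]
        ring
      rw [h3]
      refine norm_integral_le_of_norm_le (h.integrable_mulKernel.mul_const _) ?_
      filter_upwards [h.ae_mulHaar_ne_zero] with t ht
      rw [norm_mul, Complex.norm_real, Real.norm_of_nonneg (mulKernel_nonneg n t), mul_assoc]
      refine mul_le_mul_of_nonneg_left ?_ (mulKernel_nonneg n t)
      calc ‖inner ℂ y (R (f - h.dilationL2 t f))‖ ≤ ‖y‖ * ‖R (f - h.dilationL2 t f)‖ :=
            norm_inner_le_norm _ _
        _ ≤ ‖y‖ * ((C m * min 1 ‖1 - t‖) * ‖f‖) := by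
            gcongr
            refine (h.average_sub_dilationL2 (hk m) ht f).trans ?_
            gcongr
            exact hC m t ht
        _ = _ := by ring
    have h3 : ‖y‖ * ‖y‖ ≤ ‖y‖ * ((‖c‖ * ‖R‖ + κ * (C m * B)) * ‖f‖) := by
      have h4 : ‖inner ℂ y y‖ = ‖y‖ * ‖y‖ := by
        rw [inner_self_eq_norm_sq_to_K, norm_pow, RCLike.norm_ofReal, abs_norm, sq]
      rw [← h4, h1]
      calc _ ≤ ‖c‖ * (‖y‖ * (‖R‖ * ‖f‖)) + κ * (C m * B * (‖y‖ * ‖f‖)) := by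
            refine (norm_add_le _ _).trans ?_
            rw [norm_mul, norm_mul, Complex.norm_real, Real.norm_of_nonneg hκ]
            gcongr
            refine (norm_inner_le_norm _ _).trans ?_
            gcongr
            exact R.le_opNorm f
        _ = _ := by ring
    rcases (norm_nonneg y).eq_or_lt with h4 | h4
    · have h5 : 0 ≤ B := integral_nonneg fun t ↦
        mul_nonneg (mulKernel_nonneg n t) (by positivity)
      change ‖y‖ ≤ _ * ‖f‖
      rw [← h4]
      have := hC0 m
      positivity
    · exact le_of_mul_le_mul_left h3 h4

end LocalData.Admissible

end Averages

/-! ### Unboundedness, and the properties of the conductor operator -/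

section Unbounded

variable {F : Type*} [NormedField F] [ProperSpace F] [MeasurableSpace F] [BorelSpace F]

namespace LocalData.Admissible

variable {D : LocalData F} {μ : Measure F} {n : ℕ} (h : D.Admissible μ n)
include h

theorem norm_toL2_sq (ψ : h.space) : ‖h.toL2 ψ‖ ^ 2 = ∫ x, ‖ψ.1 x‖ ^ 2 ∂μ := by
  have h1 : inner ℂ (h.toL2 ψ) (h.toL2 ψ) = ((∫ x, ‖ψ.1 x‖ ^ 2 ∂μ : ℝ) : ℂ) := by
    rw [inner_eq_integral (h.coeFn_toL2 ψ) (h.coeFn_toL2 ψ), ← integral_complex_ofReal]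
    refine integral_congr_ae (Filter.Eventually.of_forall fun x ↦ ?_)
    simp only
    rw [Complex.mul_conj, Complex.normSq_eq_norm_sq]
  rw [inner_self_eq_norm_sq_to_K] at h1
  exact Complex.ofReal_injective ((Complex.ofReal_pow _ _).trans h1)

theorem inner_logL2_self (ψ : h.space) : inner ℂ (h.logL2 ψ) (h.toL2 ψ)
    = ((∫ x, n * Real.log ‖x‖ * ‖ψ.1 x‖ ^ 2 ∂μ : ℝ) : ℂ) := by
  rw [inner_eq_integral (h.coeFn_logL2 ψ) (h.coeFn_toL2 ψ), ← integral_complex_ofReal]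
  refine integral_congr_ae (Filter.Eventually.of_forall fun x ↦ ?_)
  simp only
  rw [h.logMul_apply, map_mul, Complex.conj_ofReal, mul_left_comm, Complex.mul_conj,
    Complex.normSq_eq_norm_sq, ← Complex.ofReal_mul]

theorem integrable_log_mul_norm_sq (ψ : h.space) :
    Integrable (fun x ↦ n * Real.log ‖x‖ * ‖ψ.1 x‖ ^ 2) μ := by
  refine ((L2.integrable_inner (𝕜 := ℂ) (h.logL2 ψ) (h.toL2 ψ)).re).congr ?_
  filter_upwards [h.coeFn_logL2 ψ, h.coeFn_toL2 ψ] with x h1 h2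
  have h3 : ψ.1 x * (starRingEnd ℂ) (D.logMul ψ.1 x)
      = ((n * Real.log ‖x‖ * ‖ψ.1 x‖ ^ 2 : ℝ) : ℂ) := by
    rw [h.logMul_apply, map_mul, Complex.conj_ofReal, mul_left_comm, Complex.mul_conj,
      Complex.normSq_eq_norm_sq, ← Complex.ofReal_mul]
  rw [RCLike.inner_apply, h1, h2, h3]
  exact Complex.ofReal_re _

theorem exists_lt_norm (M : ℝ) : ∃ a : F, M < ‖a‖ := by
  obtain ⟨a, ha⟩ := h.exists_one_lt_norm
  obtain ⟨k, hk⟩ := pow_unbounded_of_one_lt M ha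
  exact ⟨a ^ k, by rwa [norm_pow]⟩

variable (hd : D.IsSelfDual μ)
include hd

theorem inner_conductorL2_self (ψ : h.space) : inner ℂ (h.conductorL2 hd ψ) (h.toL2 ψ)
    = ((∫ x, n * Real.log ‖x‖ * ‖ψ.1 x‖ ^ 2 ∂μ +
      ∫ y, n * Real.log ‖y‖ * ‖D.fourierInv μ ψ.1 y‖ ^ 2 ∂μ : ℝ) : ℂ) := by
  rw [h.conductorL2_apply, inner_add_left, h.inner_logL2_self]
  have h1 : h.toL2 ψ = h.fourierL2 hd (h.toL2 ((h.fourierEquiv hd).symm ψ)) := by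
    rw [← h.fourierL2_symm_toL2, LinearIsometryEquiv.apply_symm_apply]
  rw [h1]
  rw [LinearIsometryEquiv.inner_map_map, h.inner_logL2_self, Complex.ofReal_add]
  rfl

/-- Translating a test function multiplies its inverse transform by a character of modulus one, so
the Fourier part `Q` of the quadratic form is unchanged, while the `log |x|` part becomes
arbitrarily large. -/
theorem not_isBoundedOperator_conductorOpZero : ¬ IsBoundedOperator (h.conductorOpZero hd) := by
  rintro ⟨C, hC⟩
  have := h.isAddHaarMeasure
  obtain ⟨φ, hφ, hne⟩ := h.exists_mem_schwartzZero_ne_zero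
  obtain ⟨R₀, hR₀⟩ := hφ.2.1.isCompact.isBounded.exists_norm_le
  set R := |R₀|
  have hR : ∀ x, R < ‖x‖ → φ x = 0 := fun x hx ↦
    image_eq_zero_of_notMem_tsupport fun hmem ↦ by linarith [hR₀ x hmem, le_abs_self R₀]
  have hR0 : 0 ≤ R := abs_nonneg _
  set N := ∫ x, ‖φ x‖ ^ 2 ∂μ with hN
  set Q := ∫ y, n * Real.log ‖y‖ * ‖D.fourierInv μ φ y‖ ^ 2 ∂μ with hQ
  have hNpos : 0 < N := by
    rw [hN, ← h.norm_toL2_sq ⟨φ, hφ.1⟩]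
    have h1 : h.toL2 ⟨φ, hφ.1⟩ ≠ 0 := by
      intro h2
      have h3 := h.toL2_injective (h2.trans (map_zero h.toL2).symm)
      exact hne (congrFun (congrArg Subtype.val h3) 1)
    have := norm_pos_iff.2 h1
    positivity
  -- Chosen so that `L N + Q ≥ C N + N > C N`.
  set L := max 0 ((C * N - Q) / N + 1) with hL
  -- The translated function then lives where `‖x‖ ≥ e^L`, and vanishes on the unit ball.
  obtain ⟨a, ha⟩ := h.exists_lt_norm (R + 1 + Real.exp L)
  have haR : R + 1 < ‖a‖ := by linarith [Real.exp_pos L]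
  set ψ : F → ℂ := fun x ↦ φ (x + a) with hψdef
  have hψ : ψ ∈ D.schwartzZero := by
    refine ⟨h.translate_mem φ hφ.1 a, hφ.2.1.comp_homeomorph (Homeomorph.addRight a), ?_⟩
    filter_upwards [Metric.ball_mem_nhds (0 : F) one_pos] with x hx
    rw [mem_ball_zero_iff] at hx
    refine hR _ ?_
    have h1 := norm_sub_norm_le a (-x)
    rw [sub_neg_eq_add, norm_neg, add_comm a x] at h1
    linarith
  have hψN : ∫ x, ‖ψ x‖ ^ 2 ∂μ = N := integral_add_right_eq_self (fun x ↦ ‖φ x‖ ^ 2) a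
  have hψQ : ∫ y, n * Real.log ‖y‖ * ‖D.fourierInv μ ψ y‖ ^ 2 ∂μ = Q := by
    refine integral_congr_ae (Filter.Eventually.of_forall fun y ↦ ?_)
    simp only
    rw [h.fourierInv_eq, h.fourierInv_eq, h.fourier_translate, norm_mul, h.norm_character, one_mul]
  have hlow : L * N ≤ ∫ x, n * Real.log ‖x‖ * ‖ψ x‖ ^ 2 ∂μ := by
    have hint : Integrable (fun x ↦ ‖ψ x‖ ^ 2) μ := (h.memLp_of_mem hψ.1).integrable_norm_pow two_ne_zero
    rw [← hψN, ← integral_const_mul]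
    refine integral_mono (hint.const_mul L) (h.integrable_log_mul_norm_sq ⟨ψ, hψ.1⟩) fun x ↦ ?_
    simp only
    by_cases hx : φ (x + a) = 0
    · simp [hψdef, hx]
    · gcongr
      have h1 : ‖x + a‖ ≤ R := not_lt.1 fun h2 ↦ hx (hR _ h2)
      have h2 := norm_sub_norm_le a (x + a)
      rw [sub_add_cancel_right, norm_neg] at h2
      have h3 : Real.exp L ≤ ‖x‖ := by linarith
      have h4 : L ≤ Real.log ‖x‖ :=
        (Real.le_log_iff_exp_le ((Real.exp_pos L).trans_le h3)).2 h3
      have h5 : (1 : ℝ) ≤ n := by exact_mod_cast h.n_pos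
      have h6 : 0 ≤ L := le_max_left _ _
      nlinarith
  have hmem : h.toL2 ⟨ψ, hψ.1⟩ ∈ (h.conductorOpZero hd).domain := by
    rw [h.domain_conductorOpZero hd]
    exact h.mem_domainZero.2 ⟨ψ, hψ, rfl⟩
  have hb := hC ⟨_, hmem⟩
  rw [h.conductorOpZero_toL2] at hb
  have h1 := norm_inner_le_norm (𝕜 := ℂ) (h.conductorL2 hd ⟨ψ, hψ.1⟩) (h.toL2 ⟨ψ, hψ.1⟩)
  rw [h.inner_conductorL2_self, Complex.norm_real] at h1
  have h2 := h.norm_toL2_sq ⟨ψ, hψ.1⟩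
  simp only [hψN, hψQ] at h1 h2
  have h3 : ‖h.conductorL2 hd ⟨ψ, hψ.1⟩‖ * ‖h.toL2 ⟨ψ, hψ.1⟩‖ ≤ C * N := by
    rw [← h2, sq, ← mul_assoc]
    exact mul_le_mul_of_nonneg_right hb (norm_nonneg _)
  have h4 : (C * N - Q) / N + 1 ≤ L := le_max_right _ _
  have h5 : C * N - Q + N ≤ L * N := by
    have h6 := mul_le_mul_of_nonneg_right h4 hNpos.le
    rwa [add_mul, div_mul_cancel₀ _ hNpos.ne', one_mul] at h6
  have h6 := (le_abs_self _).trans (h1.trans h3)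
  linarith

theorem conductorProperties : ConductorProperties D μ := by
  have hesa := h.isEssentiallySelfAdjoint_conductorOpZero hd
  have hcl := isClosable_of_symmetric hesa.1 hesa.2.1
  have hdense : Dense ((h.conductorOp hd).domain : Set (Lp ℂ 2 μ)) :=
    hesa.1.mono (h.conductorOpZero_le hd).1
  have hsymm := h.isFormalAdjoint_conductorOp hd
  refine ⟨h.conductorOp hd, h.conductorOpZero hd, h.isOperatorOf_conductorOp hd,
    h.isOperatorOf_conductorOpZero hd, hesa, h.not_isBoundedOperator_conductorOpZero hd,
    h.isBoundedBelow_conductorOpZero hd, fun t ht ↦ ?_, ?_, ?_⟩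
  · have hU := h.commutesWith_dilationL2 hd ht
    exact ⟨h.dilationL2 t, h.coeFn_dilationL2 ht, hU, hU.closure hcl⟩
  · have hI := h.commutesWith_inversionL2 hd
    exact ⟨h.inversionL2, h.coeFn_inversionL2, hI, hI.closure hcl⟩
  · have hF := h.commutesWith_fourierL2 hd
    refine ⟨h.fourierL2 hd, fun φ hφ f hf ↦ h.fourierL2_ae_eq hd (h.integrable_of_mem hφ) hf, hF, ?_⟩
    -- The Fourier transform is controlled on `𝒮` only, so the closure of `H₀` is replaced by that
    -- of `H`.
    rw [← hesa.closure_eq (h.conductorOpZero_le hd) hsymm]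
    exact hF.closure (isClosable_of_symmetric hdense hsymm)

end LocalData.Admissible

end Unbounded

/-! ### Archimedean local fields -/

section Archimedean

theorem exists_eq_smul_of_isAddHaarMeasure {G : Type*} [NormedAddCommGroup G] [ProperSpace G]
    [MeasurableSpace G] [BorelSpace G] (μ ν : Measure G) [μ.IsAddHaarMeasure]
    [ν.IsAddHaarMeasure] : ∃ c : NNReal, 0 < c ∧ μ = c • ν :=
  ⟨_, Measure.addHaarScalarFactor_pos_of_isAddHaarMeasure μ ν,
    Measure.isAddLeftInvariant_eq_smul μ ν⟩

/-- The image measure is again a Haar measure, and the unit ball determines the factor of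
proportionality. -/
theorem map_mul_left_eq_smul {F : Type*} [NormedField F] [ProperSpace F] [MeasurableSpace F]
    [BorelSpace F] (μ : Measure F) [μ.IsAddHaarMeasure] {n : ℕ}
    (hball : ∀ a : F, a ≠ 0 → μ (Metric.closedBall 0 ‖a‖)
      = ENNReal.ofReal (‖a‖ ^ n) * μ (Metric.closedBall 0 1)) {a : F} (ha : a ≠ 0) :
    μ.map (a * ·) = ENNReal.ofReal ((‖a‖ ^ n)⁻¹) • μ := by
  let e : F ≃+ F := { Equiv.mulLeft₀ a ha with map_add' := mul_add a }
  have he : (a * ·) = (e : F → F) := rfl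
  have : (μ.map e).IsAddHaarMeasure :=
    e.isAddHaarMeasure_map μ (continuous_const_mul a) (continuous_const_mul a⁻¹)
  obtain ⟨c, -, hc⟩ := exists_eq_smul_of_isAddHaarMeasure (μ.map e) μ
  have h1 : μ.map e (Metric.closedBall 0 1) = (c • μ) (Metric.closedBall 0 1) :=
    congrFun (congrArg DFunLike.coe hc) _
  rw [← he, Measure.map_apply (measurable_const_mul a) measurableSet_closedBall] at h1
  have h2 : (a * ·) ⁻¹' Metric.closedBall 0 1 = Metric.closedBall (0 : F) ‖a⁻¹‖ := by
    ext x
    simp only [Set.mem_preimage, mem_closedBall_zero_iff, norm_mul, norm_inv]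
    rw [← one_div, le_div_iff₀' (norm_pos_iff.2 ha)]
  rw [h2, hball _ (inv_ne_zero ha), Measure.smul_apply, norm_inv, inv_pow] at h1
  have h3 : μ (Metric.closedBall 0 1) ≠ 0 := (Metric.measure_closedBall_pos μ 0 one_pos).ne'
  have h4 : μ (Metric.closedBall 0 1) ≠ ⊤ := measure_closedBall_lt_top.ne
  have h5 : ENNReal.ofReal ((‖a‖ ^ n)⁻¹) = (c : ENNReal) := (ENNReal.mul_left_inj h3 h4).1 h1
  rw [he, hc, h5]
  rfl

theorem LocalData.exists_bounds_of_mem_schwartzZero {F : Type*} [NormedField F]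
    [MeasurableSpace F] {D : LocalData F} {φ : F → ℂ} (hφ : φ ∈ D.schwartzZero) :
    ∃ r R : ℝ, 0 < r ∧ 0 < R ∧ ∀ x, φ x ≠ 0 → r ≤ ‖x‖ ∧ ‖x‖ ≤ R := by
  obtain ⟨R, hR⟩ := hφ.2.1.isCompact.isBounded.exists_norm_le
  obtain ⟨r, hr, hr0⟩ := Metric.eventually_nhds_iff.1 hφ.2.2
  refine ⟨r, |R| + 1, hr, by positivity, fun x hx ↦ ⟨?_, ?_⟩⟩
  · by_contra! hlt
    exact hx (hr0 (by rwa [dist_zero_right]))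
  · linarith [hR x (subset_tsupport _ hx), le_abs_self R]

open scoped FourierTransform ContDiff

variable {F : Type*} [NormedField F] [ProperSpace F] [MeasurableSpace F] [BorelSpace F]
variable {V : Type*} [RCLike V] [MeasurableSpace V] [BorelSpace V]

/-- The real linear automorphism `v ↦ -m * conj v`. -/
def conjScale (V : Type*) [RCLike V] {m : ℝ} (hm : m ≠ 0) : V ≃L[ℝ] V :=
  RCLike.conjCLE.trans (ContinuousLinearEquiv.smulLeft (Units.mk0 (-m) (neg_ne_zero.2 hm)))

theorem conjScale_apply {m : ℝ} (hm : m ≠ 0) (v : V) :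
    conjScale V hm v = (-m) • (starRingEnd V) v := rfl

/-- This matches the pairing `λ(-yx)` with the Euclidean pairing of the Fourier transform on `V`. -/
theorem inner_conjScale {m : ℝ} (hm : m ≠ 0) (v w : V) :
    inner ℝ v (conjScale V hm w) = -(m * RCLike.re (w * v)) := by
  rw [conjScale_apply, inner_smul_right, real_inner_comm]
  change -m * RCLike.re (v * (starRingEnd V) ((starRingEnd V) w)) = _
  rw [RCLike.conj_conj, mul_comm v]
  ring

theorem exists_integral_comp_conjScale {m : ℝ} (hm : m ≠ 0) :
    ∃ k : ℝ, 0 < k ∧ ∀ f : V → ℂ, ∫ v, f (conjScale V hm v) = k * ∫ v, f v := by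
  have : ((volume : Measure V).map (conjScale V hm)).IsAddHaarMeasure :=
    (conjScale V hm).isAddHaarMeasure_map _
  obtain ⟨c, hc0, hc⟩ := exists_eq_smul_of_isAddHaarMeasure
    ((volume : Measure V).map (conjScale V hm)) volume
  refine ⟨c, hc0, fun f ↦ ?_⟩
  have h1 : ∫ v, f v ∂((volume : Measure V).map (conjScale V hm)) = ∫ v, f (conjScale V hm v) :=
    (conjScale V hm).toHomeomorph.measurableEmbedding.integral_map f
  rw [← h1, hc, integral_smul_nnreal_measure]
  exact Complex.real_smul

/-- The description of Schwartz functions, characters and the module in terms of an isometric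
isomorphism of `F` with `ℝ` or `ℂ`. -/
structure IsArchimedeanModel (D : LocalData F) (e : F ≃+* V) (m : ℝ) : Prop where
  norm_map : ∀ x, ‖e x‖ = ‖x‖
  ne_zero : m ≠ 0
  module_eq : ∀ x, D.module x = ‖x‖ ^ Module.finrank ℝ V
  character_eq : ∀ x, D.character x
    = Complex.exp (2 * Real.pi * Complex.I * (-(m * RCLike.re (e x)) : ℝ))
  mem_schwartz_iff : ∀ φ : F → ℂ, φ ∈ D.schwartz ↔ ∃ f : 𝓢(V, ℂ), ∀ x, φ x = f (e x)

namespace IsArchimedeanModel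

variable {D : LocalData F} {e : F ≃+* V} {m : ℝ} (h : IsArchimedeanModel D e m)
include h

theorem norm_symm_map (v : V) : ‖e.symm v‖ = ‖v‖ := by
  rw [← h.norm_map, e.apply_symm_apply]

theorem continuous : Continuous e :=
  (AddMonoidHomClass.isometry_of_norm e h.norm_map).continuous

theorem continuous_symm : Continuous e.symm :=
  (AddMonoidHomClass.isometry_of_norm e.symm h.norm_symm_map).continuous

/-- The isomorphism as a homeomorphism. -/
def homeomorph : F ≃ₜ V where
  toEquiv := e.toEquiv
  continuous_toFun := h.continuous
  continuous_invFun := h.continuous_symm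

theorem isAddHaarMeasure_map (μ : Measure F) [μ.IsAddHaarMeasure] : (μ.map e).IsAddHaarMeasure :=
  e.toAddEquiv.isAddHaarMeasure_map μ h.continuous h.continuous_symm

theorem integral_map {E : Type*} [NormedAddCommGroup E] [NormedSpace ℝ E] (μ : Measure F)
    (f : V → E) : ∫ v, f v ∂(μ.map e) = ∫ x, f (e x) ∂μ :=
  h.homeomorph.measurableEmbedding.integral_map f

theorem exists_integral_comp_eq (μ : Measure F) [μ.IsAddHaarMeasure] :
    ∃ c : ℝ, 0 < c ∧ ∀ f : V → ℂ, ∫ x, f (e x) ∂μ = c * ∫ v, f v := by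
  have := h.isAddHaarMeasure_map μ
  obtain ⟨c, hc0, hc⟩ := exists_eq_smul_of_isAddHaarMeasure (μ.map e) volume
  refine ⟨c, hc0, fun f ↦ ?_⟩
  rw [← h.integral_map, hc, integral_smul_nnreal_measure]
  exact Complex.real_smul

theorem fourier_eq {μ : Measure F} {c : ℝ} (hc : ∀ f : V → ℂ, ∫ x, f (e x) ∂μ = c * ∫ v, f v)
    {φ : F → ℂ} {f : V → ℂ} (hf : ∀ x, φ x = f (e x)) (y : F) :
    D.fourier μ φ y = c * 𝓕 f (conjScale V h.ne_zero (e y)) := by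
  rw [Real.fourier_eq', ← hc, LocalData.fourier]
  refine integral_congr_ae (Filter.Eventually.of_forall fun x ↦ ?_)
  simp only
  rw [h.character_eq, hf, smul_eq_mul, mul_comm, inner_conjScale, map_neg, map_mul, map_neg]
  congr 2
  push_cast
  ring

/-- The map `conjScale` is symmetric for the real inner product, so it can be moved to `v` and
substituted away. -/
theorem fourier_comp_conjScale {k : ℝ}
    (hk : ∀ f : V → ℂ, ∫ v, f (conjScale V h.ne_zero v) = k * ∫ v, f v)
    (f : V → ℂ) (w : V) :
    𝓕 (fun v ↦ f (conjScale V h.ne_zero v)) (conjScale V h.ne_zero w) = k * 𝓕 f w := by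
  rw [Real.fourier_eq', Real.fourier_eq', ← hk]
  refine integral_congr_ae (Filter.Eventually.of_forall fun v ↦ ?_)
  simp only
  rw [inner_conjScale, real_inner_comm, inner_conjScale, mul_comm w]

theorem fourier_fourier_eq {μ : Measure F} {c k : ℝ}
    (hc : ∀ f : V → ℂ, ∫ x, f (e x) ∂μ = c * ∫ v, f v)
    (hk : ∀ f : V → ℂ, ∫ v, f (conjScale V h.ne_zero v) = k * ∫ v, f v)
    {φ : F → ℂ} (hφ : φ ∈ D.schwartz) (x : F) :
    D.fourier μ (D.fourier μ φ) x = (c ^ 2 * k : ℝ) * φ (-x) := by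
  obtain ⟨f, hf⟩ := (h.mem_schwartz_iff φ).1 hφ
  have h1 : ∀ y, D.fourier μ φ y
      = c * 𝓕 (f : V → ℂ) (conjScale V h.ne_zero (e y)) :=
    h.fourier_eq hc hf
  rw [h.fourier_eq (f := fun v ↦ c * 𝓕 (f : V → ℂ) (conjScale V h.ne_zero v)) hc h1, h.fourier_comp_conjScale hk (fun v ↦ c * 𝓕 (f : V → ℂ) v)]
  have h2 : 𝓕 (fun v ↦ (c : ℂ) * 𝓕 (f : V → ℂ) v) (e x) = c * f (-(e x)) := by
    have h3 : 𝓕 (𝓕 (f : V → ℂ)) (e x) = f (-(e x)) := by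
      have h4 := congrFun (f.continuous.fourierInv_fourier_eq f.integrable
        (𝓕 f : 𝓢(V, ℂ)).integrable) (-(e x))
      rwa [Real.fourierInv_eq_fourier_neg, neg_neg] at h4
    rw [← h3, Real.fourier_eq', Real.fourier_eq', ← integral_const_mul]
    refine integral_congr_ae (Filter.Eventually.of_forall fun v ↦ ?_)
    simp only [smul_eq_mul]
    ring
  rw [h2, hf, map_neg e]
  push_cast
  ring

theorem exists_isSelfDual : ∃ μ : Measure F, D.IsSelfDual μ := by
  obtain ⟨k, hk0, hk⟩ := exists_integral_comp_conjScale (V := V) h.ne_zero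
  have : ((volume : Measure V).map e.symm).IsAddHaarMeasure :=
    e.symm.toAddEquiv.isAddHaarMeasure_map _ h.continuous_symm h.continuous
  -- By `fourier_fourier_eq` the measure is self-dual exactly when `c² k = 1`.
  set c : NNReal := Real.toNNReal (√k)⁻¹
  have hc : (c : ℝ) = (√k)⁻¹ := Real.coe_toNNReal _ (by positivity)
  have hc0 : c ≠ 0 := (Real.toNNReal_pos.2 (inv_pos.2 (Real.sqrt_pos.2 hk0))).ne'
  have h1 : ∀ f : V → ℂ, ∫ x, f (e x) ∂(c • (volume : Measure V).map e.symm)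
      = (c : ℝ) * ∫ v, f v := by
    intro f
    have h2 : ∫ x, f (e x) ∂((volume : Measure V).map e.symm) = ∫ v, f (e (e.symm v)) :=
      h.homeomorph.symm.measurableEmbedding.integral_map _
    rw [integral_smul_nnreal_measure, h2]
    simp_rw [e.apply_symm_apply]
    exact Complex.real_smul
  refine ⟨c • (volume : Measure V).map e.symm,
    Measure.IsAddHaarMeasure.nnreal_smul _ hc0, fun φ hφ x ↦ ?_⟩
  rw [h.fourier_fourier_eq h1 hk hφ, hc, inv_pow, Real.sq_sqrt hk0.le, inv_mul_cancel₀ hk0.ne',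
    Complex.ofReal_one, one_mul]

theorem mem_schwartz_of_contDiff {f : V → ℂ} (hf : HasCompactSupport f) (hf' : ContDiff ℝ ∞ f) :
    (fun x ↦ f (e x)) ∈ D.schwartz :=
  (h.mem_schwartz_iff _).2 ⟨hf.toSchwartzMap hf', fun _ ↦ rfl⟩

theorem exists_lipschitz {φ : F → ℂ} (hφ : φ ∈ D.schwartz) :
    ∃ C : ℝ, ∀ x y, ‖φ x - φ y‖ ≤ C * ‖x - y‖ := by
  obtain ⟨f, hf⟩ := (h.mem_schwartz_iff φ).1 hφ
  obtain ⟨C, -, hC⟩ := f.decay 0 1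
  refine ⟨C, fun x y ↦ ?_⟩
  rw [hf, hf, ← h.norm_map (x - y), map_sub]
  refine Convex.norm_image_sub_le_of_norm_fderiv_le (𝕜 := ℝ)
    (fun v _ ↦ f.differentiableAt) (fun v _ ↦ ?_) convex_univ (Set.mem_univ _) (Set.mem_univ _)
  have h1 := hC v
  rwa [pow_zero, one_mul, norm_iteratedFDeriv_one] at h1

theorem fourier_mem {μ : Measure F} [μ.IsAddHaarMeasure] {φ : F → ℂ} (hφ : φ ∈ D.schwartz) :
    D.fourier μ φ ∈ D.schwartz := by
  obtain ⟨c, -, hc⟩ := h.exists_integral_comp_eq μ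
  obtain ⟨f, hf⟩ := (h.mem_schwartz_iff φ).1 hφ
  exact (h.mem_schwartz_iff _).2
    ⟨(c : ℂ) • SchwartzMap.compCLMOfContinuousLinearEquiv ℂ (conjScale V h.ne_zero) (𝓕 f),
      fun y ↦ h.fourier_eq hc hf y⟩

/-- The support stays in a shell `R⁻¹ ≤ ‖v‖ ≤ r⁻¹`; inversion and the norm are smooth away from the
origin, and near the origin the function is zero. -/
theorem inversion_mem {φ : F → ℂ} (hφ : φ ∈ D.schwartzZero) : D.inversion φ ∈ D.schwartz := by
  obtain ⟨f, hf⟩ := (h.mem_schwartz_iff φ).1 hφ.1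
  obtain ⟨r, R, hr, hR, hrR⟩ := LocalData.exists_bounds_of_mem_schwartzZero hφ
  have hrR' : ∀ v : V, f v ≠ 0 → r ≤ ‖v‖ ∧ ‖v‖ ≤ R := by
    intro v hv
    have h1 := hf (e.symm v)
    rw [e.apply_symm_apply] at h1
    rw [← h.norm_symm_map v]
    exact hrR _ (h1 ▸ hv)
  set g : V → ℂ := fun v ↦ (((‖v‖ ^ Module.finrank ℝ V)⁻¹ : ℝ) : ℂ) * f v⁻¹ with hg
  have hzero : ∀ v : V, ‖v‖ < R⁻¹ → g v = 0 := by
    intro v hv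
    by_contra hne
    have h1 := (hrR' _ (right_ne_zero_of_mul hne)).2
    have h2 := (hrR' _ (right_ne_zero_of_mul hne)).1
    rw [norm_inv] at h1 h2
    have h3 : 0 < ‖v‖ := inv_pos.1 (hr.trans_le h2)
    exact absurd hv (not_lt.2 (inv_le_of_inv_le₀ h3 h1))
  have hsupp : HasCompactSupport g := by
    refine HasCompactSupport.of_support_subset_isCompact (isCompact_closedBall (0 : V) r⁻¹) ?_
    intro v hv
    have h2 := (hrR' _ (right_ne_zero_of_mul hv)).1
    rw [norm_inv] at h2
    rw [mem_closedBall_zero_iff]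
    exact (le_inv_comm₀ hr (inv_pos.1 (hr.trans_le h2))).1 h2
  have hsmooth : ContDiff ℝ ∞ g := by
    rw [contDiff_iff_contDiffAt]
    intro v
    rcases eq_or_ne v 0 with rfl | hv
    · refine contDiffAt_const (c := (0 : ℂ)).congr_of_eventuallyEq ?_
      filter_upwards [Metric.ball_mem_nhds (0 : V) (inv_pos.2 hR)] with v hv
      exact hzero v (by simpa using hv)
    · refine ContDiffAt.mul ?_ ?_
      · have h1 : ContDiffAt ℝ ∞ (fun v : V ↦ (‖v‖ ^ Module.finrank ℝ V)⁻¹) v :=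
          ((contDiffAt_norm ℝ hv).pow _).inv (pow_ne_zero _ (norm_ne_zero_iff.2 hv))
        exact Complex.ofRealCLM.contDiff.contDiffAt.comp v h1
      · exact (f.smooth ⊤).contDiffAt.comp v (contDiffAt_inv ℝ hv)
  have h1 := h.mem_schwartz_of_contDiff hsupp hsmooth
  convert h1 using 2 with x
  simp only [LocalData.inversion, hg]
  rw [h.module_eq, hf, h.norm_map, map_div₀, map_one, one_div]
  push_cast
  rfl

/-- The fundamental lemma of the calculus of variations on the complement of the null set `{0}`. -/
theorem separates {μ : Measure F} [μ.IsAddHaarMeasure] (hzero : μ {0} = 0) {g : F → ℂ}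
    (hg : LocallyIntegrable g μ) (hg0 : ∀ ψ ∈ D.schwartzZero, ∫ x, g x * ψ x ∂μ = 0) :
    g =ᵐ[μ] 0 := by
  have hemb := h.homeomorph.measurableEmbedding
  have hloc : LocallyIntegrable (fun v ↦ g (e.symm v)) (μ.map e) := by
    refine (locallyIntegrable_map_homeomorph h.homeomorph).2 (hg.congr ?_)
    exact Filter.Eventually.of_forall fun x ↦ congrArg g (e.symm_apply_apply x).symm
  have h1 : ∀ᵐ v ∂(μ.map e), v ∈ ({0}ᶜ : Set V) → g (e.symm v) = 0 := by
    refine isOpen_compl_singleton.ae_eq_zero_of_integral_contDiff_smul_eq_zero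
      (hloc.locallyIntegrableOn _) fun k hk hk' hks ↦ ?_
    rw [h.integral_map]
    have h2 : (fun x ↦ (k (e x) : ℂ)) ∈ D.schwartzZero := by
      refine ⟨?_, ?_, ?_⟩
      · exact h.mem_schwartz_of_contDiff (f := fun v ↦ (k v : ℂ))
          (hk'.comp_left (g := fun r : ℝ ↦ (r : ℂ)) Complex.ofReal_zero)
          (Complex.ofRealCLM.contDiff.comp hk)
      · exact (hk'.comp_left (g := fun r : ℝ ↦ (r : ℂ)) Complex.ofReal_zero).comp_homeomorph
          h.homeomorph
      · have h3 : ∀ᶠ v in 𝓝 (0 : V), k v = 0 :=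
          notMem_tsupport_iff_eventuallyEq.1 fun h4 ↦ hks h4 rfl
        have h4 := h.continuous.tendsto 0
        rw [map_zero] at h4
        filter_upwards [h4.eventually h3] with x hx
        rw [hx, Complex.ofReal_zero]
    rw [← hg0 _ h2]
    refine integral_congr_ae (Filter.Eventually.of_forall fun x ↦ ?_)
    simp only
    rw [e.symm_apply_apply, Complex.real_smul, mul_comm]
  have h2 : ∀ᵐ x ∂μ, e x ∈ ({0}ᶜ : Set V) → g (e.symm (e x)) = 0 :=
    (hemb.ae_map_iff).1 h1
  have h3 : ∀ᵐ x ∂μ, x ≠ 0 := by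
    rw [ae_iff]
    simpa using hzero
  filter_upwards [h2, h3] with x h4 h5
  rw [e.symm_apply_apply] at h4
  exact h4 fun h6 ↦ h5 ((map_eq_zero e).1 h6)

theorem exists_radial : ∃ G : F → ℝ, (fun x ↦ (G x : ℂ)) ∈ D.schwartz ∧ G 0 = 1 ∧
    ∀ x y, ‖x‖ ≤ ‖y‖ → G y ≤ G x := by
  -- The square makes the norm smooth at the origin; the cutoff is `1` for `‖x‖ ≤ 1` and `0` for
  -- `‖x‖² ≥ 2`.
  refine ⟨fun x ↦ Real.smoothTransition (2 - ‖e x‖ ^ 2), ?_, ?_, fun x y hxy ↦ ?_⟩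
  · refine h.mem_schwartz_of_contDiff
      (f := fun v ↦ (Real.smoothTransition (2 - ‖v‖ ^ 2) : ℂ)) ?_ ?_
    · refine HasCompactSupport.of_support_subset_isCompact (isCompact_closedBall (0 : V) 2) ?_
      intro v hv
      rw [mem_closedBall_zero_iff]
      by_contra! hlt
      refine hv ?_
      simp only
      rw [Real.smoothTransition.zero_of_nonpos (by nlinarith), Complex.ofReal_zero]
    · exact Complex.ofRealCLM.contDiff.comp
        (Real.smoothTransition.contDiff.comp (contDiff_const.sub (contDiff_norm_sq ℝ)))
  · simp only [map_zero, norm_zero]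
    exact Real.smoothTransition.one_of_one_le (by norm_num)
  · refine Real.smoothTransition.monotone ?_
    rw [h.norm_map, h.norm_map]
    gcongr

theorem hasModule (μ : Measure F) [μ.IsAddHaarMeasure] : HasModule μ (Module.finrank ℝ V) where
  isAddHaarMeasure := inferInstance
  n_pos := Module.finrank_pos
  exists_one_lt_norm := ⟨e.symm 2, by rw [h.norm_symm_map, RCLike.norm_ofNat]; norm_num⟩
  map_mul a ha := by
    refine map_mul_left_eq_smul μ (fun a ha ↦ ?_) ha
    have := h.isAddHaarMeasure_map μ
    have hball : ∀ r : ℝ, μ (Metric.closedBall 0 r) = μ.map e (Metric.closedBall 0 r) := by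
      intro r
      rw [Measure.map_apply h.continuous.measurable measurableSet_closedBall]
      congr 1
      ext x
      simp [h.norm_map]
    rw [hball, hball, Measure.addHaar_closedBall' _ _ (norm_nonneg a)]

theorem admissible (μ : Measure F) [μ.IsAddHaarMeasure] :
    D.Admissible μ (Module.finrank ℝ V) where
  toHasModule := h.hasModule μ
  module_eq := h.module_eq
  character_add x y := by
    rw [h.character_eq, h.character_eq, h.character_eq, ← Complex.exp_add, map_add, map_add]
    congr 1
    push_cast
    ring
  norm_character x := by
    rw [h.character_eq, mul_right_comm, ← Complex.ofReal_ofNat, ← Complex.ofReal_mul,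
      ← Complex.ofReal_mul, Complex.norm_exp_ofReal_mul_I]
  continuous_character := by
    have h1 := h.continuous
    rw [funext h.character_eq]
    have h2 : Continuous fun x ↦ RCLike.re (e x) := RCLike.continuous_re.comp h1
    fun_prop
  add_mem φ hφ ψ hψ := by
    obtain ⟨f, hf⟩ := (h.mem_schwartz_iff φ).1 hφ
    obtain ⟨g, hg⟩ := (h.mem_schwartz_iff ψ).1 hψ
    exact (h.mem_schwartz_iff _).2 ⟨f + g, fun x ↦ by rw [hf, hg]; rfl⟩
  smul_mem c φ hφ := by
    obtain ⟨f, hf⟩ := (h.mem_schwartz_iff φ).1 hφ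
    exact (h.mem_schwartz_iff _).2 ⟨c • f, fun x ↦ by rw [hf]; rfl⟩
  lipschitz φ hφ := h.exists_lipschitz hφ
  decay φ hφ N := by
    obtain ⟨f, hf⟩ := (h.mem_schwartz_iff φ).1 hφ
    obtain ⟨C, -, hC⟩ := f.decay N 0
    refine ⟨C, fun x ↦ ?_⟩
    have h1 := hC (e x)
    rwa [norm_iteratedFDeriv_zero, h.norm_map, ← hf] at h1
  translate_mem φ hφ a := by
    obtain ⟨f, hf⟩ := (h.mem_schwartz_iff φ).1 hφ
    refine (h.mem_schwartz_iff _).2 ⟨SchwartzMap.compSubConstCLM ℂ (-(e a)) f, fun x ↦ ?_⟩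
    rw [SchwartzMap.compSubConstCLM_apply, hf, map_add, sub_neg_eq_add]
  dilate_mem φ hφ a ha := by
    obtain ⟨f, hf⟩ := (h.mem_schwartz_iff φ).1 hφ
    have ha' : e a ≠ 0 := (map_ne_zero e).2 ha
    refine (h.mem_schwartz_iff _).2 ⟨SchwartzMap.compCLMOfContinuousLinearEquiv ℂ
      (ContinuousLinearEquiv.smulLeft (Units.mk0 (e a) ha') : V ≃L[ℝ] V) f, fun x ↦ ?_⟩
    rw [hf, map_mul]
    rfl
  fourier_mem φ hφ := h.fourier_mem hφ
  inversion_mem φ hφ := h.inversion_mem hφ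
  separates g hg hg0 := h.separates (h.hasModule μ).measure_zero hg hg0
  exists_radial := h.exists_radial

end IsArchimedeanModel

end Archimedean

/-! ### Infinite places -/

section InfinitePlaces

variable {K : Type*} [Field K] {v : InfinitePlace K}

instance : ProperSpace v.Completion := by
  rcases v.isReal_or_isComplex with hv | hv
  · have e := (InfinitePlace.Completion.isometryEquivRealOfIsReal hv).symm
    exact e.isometry.antilipschitz.properSpace e.continuous e.surjective
  · have e := (InfinitePlace.Completion.isometryEquivComplexOfIsComplex hv).symm
    exact e.isometry.antilipschitz.properSpace e.continuous e.surjective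

variable [MeasurableSpace v.Completion] [BorelSpace v.Completion]

theorem isArchimedeanModel_of_isReal (hv : v.IsReal) : IsArchimedeanModel (infiniteData v)
    (InfinitePlace.Completion.ringEquivRealOfIsReal hv) 1 where
  norm_map x := (InfinitePlace.Completion.isometry_extensionEmbeddingOfIsReal hv).norm_map_of_map_zero
    (map_zero _) x
  ne_zero := one_ne_zero
  module_eq x := by
    have : v.mult = 1 := InfinitePlace.mult_isReal ⟨v, hv⟩
    simp [infiniteData, this]
  character_eq x := by
    have h1 : v.mult = 1 := InfinitePlace.mult_isReal ⟨v, hv⟩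
    have h2 := InfinitePlace.Completion.extensionEmbeddingOfIsReal_apply hv x
    simp only [infiniteData, infiniteTrace]
    rw [h1, ← h2, Complex.ofReal_re, Nat.cast_one]
    rfl
  mem_schwartz_iff φ := by
    refine ⟨fun hφ ↦ ?_, fun hφ ↦ Or.inl ⟨hv, hφ⟩⟩
    rcases hφ with ⟨_, hf⟩ | ⟨hv', -⟩
    · exact hf
    · exact absurd hv (InfinitePlace.not_isReal_iff_isComplex.2 hv')

theorem isArchimedeanModel_of_isComplex (hv : v.IsComplex) : IsArchimedeanModel (infiniteData v)
    (InfinitePlace.Completion.ringEquivComplexOfIsComplex hv) 2 where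
  norm_map x := (InfinitePlace.Completion.isometry_extensionEmbedding v).norm_map_of_map_zero
    (map_zero _) x
  ne_zero := two_ne_zero
  module_eq x := by
    have : v.mult = 2 := InfinitePlace.mult_isComplex ⟨v, hv⟩
    rw [Complex.finrank_real_complex, ← this]
    rfl
  character_eq x := by
    have h1 : v.mult = 2 := InfinitePlace.mult_isComplex ⟨v, hv⟩
    simp only [infiniteData, infiniteTrace]
    rw [h1]
    simp
  mem_schwartz_iff φ := by
    refine ⟨fun hφ ↦ ?_, fun hφ ↦ Or.inr ⟨hv, hφ⟩⟩
    rcases hφ with ⟨hv', -⟩ | ⟨-, hf⟩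
    · exact absurd hv' (InfinitePlace.not_isReal_iff_isComplex.2 hv)
    · exact hf

variable (v)

theorem exists_isSelfDual_infiniteData :
    ∃ μ : Measure v.Completion, (infiniteData v).IsSelfDual μ := by
  rcases v.isReal_or_isComplex with hv | hv
  · exact (isArchimedeanModel_of_isReal hv).exists_isSelfDual
  · exact (isArchimedeanModel_of_isComplex hv).exists_isSelfDual

theorem conductorProperties_infiniteData {μ : Measure v.Completion}
    (hμ : (infiniteData v).IsSelfDual μ) : ConductorProperties (infiniteData v) μ := by
  have := hμ.isAddHaarMeasure
  rcases v.isReal_or_isComplex with hv | hv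
  · exact ((isArchimedeanModel_of_isReal hv).admissible μ).conductorProperties hμ
  · exact ((isArchimedeanModel_of_isComplex hv).admissible μ).conductorProperties hμ

end InfinitePlaces

/-! ### Nonarchimedean local fields -/

section Nonarchimedean

open Metric

variable {F : Type*} [NormedField F] [ProperSpace F] [MeasurableSpace F] [BorelSpace F]

theorem HasModule.exists_le_norm {μ : Measure F} {n : ℕ} (h : HasModule μ n) (M : ℝ) :
    ∃ a : F, a ≠ 0 ∧ M ≤ ‖a‖ := by
  obtain ⟨b, hb⟩ := h.exists_one_lt_norm
  obtain ⟨k, hk⟩ := pow_unbounded_of_one_lt M hb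
  have hb0 : b ≠ 0 := norm_pos_iff.1 (zero_lt_one.trans hb)
  exact ⟨b ^ k, pow_ne_zero _ hb0, by rw [norm_pow]; exact hk.le⟩

theorem HasModule.measure_closedBall_mul {μ : Measure F} {n : ℕ} (h : HasModule μ n) {a : F}
    (ha : a ≠ 0) (x : F) (ε : ℝ) :
    μ (closedBall x (‖a‖ * ε)) = ENNReal.ofReal (‖a‖ ^ n) * μ (closedBall x ε) := by
  have := h.isAddHaarMeasure
  have ha' : 0 < ‖a‖ := norm_pos_iff.2 ha
  have h0 : ∀ r, μ (closedBall x r) = μ (closedBall 0 r) := fun r ↦ by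
    rw [Measure.addHaar_closedBall_center]
  have h1 := congrArg (fun ν : Measure F ↦ ν (closedBall 0 (‖a‖ * ε))) (h.map_mul a ha)
  have h2 : (a * ·) ⁻¹' closedBall 0 (‖a‖ * ε) = closedBall (0 : F) ε := by
    ext x
    simp only [Set.mem_preimage, mem_closedBall_zero_iff, norm_mul]
    exact mul_le_mul_iff_right₀ ha'
  rw [Measure.map_apply (measurable_const_mul a) measurableSet_closedBall, h2,
    Measure.smul_apply, smul_eq_mul] at h1
  rw [h0, h0, h1, ← mul_assoc, ← ENNReal.ofReal_mul (by positivity),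
    mul_inv_cancel₀ (by positivity), ENNReal.ofReal_one, one_mul]

/-- Doubling gives access to Lebesgue's differentiation theorem, which proves
`IsUltrametricModel.separates`. -/
theorem HasModule.isUnifLocDoublingMeasure {μ : Measure F} {n : ℕ} (h : HasModule μ n) :
    IsUnifLocDoublingMeasure μ := by
  obtain ⟨a, ha, ha2⟩ := h.exists_le_norm 2
  refine ⟨⟨(‖a‖ ^ n).toNNReal, ?_⟩⟩
  filter_upwards [self_mem_nhdsWithin] with ε hε x
  have hε' : 0 < ε := hε
  refine (measure_mono (closedBall_subset_closedBall ?_)).trans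
    (h.measure_closedBall_mul ha x ε).le
  gcongr

variable [IsUltrametricDist F]

/-- The ingredients of the conductor operator over a nonarchimedean local field. -/
structure IsUltrametricModel (D : LocalData F) : Prop where
  module_eq : ∀ x, D.module x = ‖x‖
  character_add : ∀ x y, D.character (x + y) = D.character x * D.character y
  norm_character : ∀ x, ‖D.character x‖ = 1
  exists_trivial : ∃ r : ℝ, 0 < r ∧ ∀ x, ‖x‖ ≤ r → D.character x = 1
  exists_nontrivial : ∃ z, D.character z ≠ 1
  mem_schwartz_iff : ∀ φ, φ ∈ D.schwartz ↔ IsLocallyConstant φ ∧ HasCompactSupport φ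

namespace IsUltrametricModel

variable {D : LocalData F} (h : IsUltrametricModel D)
include h

/-- Compactness of the support makes local constancy uniform. The two radii, of invariance and of
support, exchange roles under the Fourier transform. -/
theorem mem_schwartz_iff_exists {φ : F → ℂ} : φ ∈ D.schwartz ↔ ∃ δ R : ℝ, 0 < δ ∧ 0 < R ∧
    (∀ x k, ‖k‖ ≤ δ → φ (x + k) = φ x) ∧ ∀ x, φ x ≠ 0 → ‖x‖ ≤ R := by
  rw [h.mem_schwartz_iff]
  constructor
  · rintro ⟨h1, h2⟩
    obtain ⟨δ, hδ, hδ'⟩ := lebesgue_number_lemma_of_metric (c := fun z : ℂ ↦ φ ⁻¹' {z})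
      h2.isCompact (fun z ↦ h1 {z}) (fun x _ ↦ Set.mem_iUnion.2 ⟨φ x, rfl⟩)
    have h3 : ∀ x ∈ tsupport φ, ∀ y, dist y x < δ → φ y = φ x := by
      intro x hx y hy
      obtain ⟨z, hz⟩ := hδ' x hx
      exact (hz hy : φ y = z).trans (hz (mem_ball_self hδ) : φ x = z).symm
    obtain ⟨R, hR⟩ := h2.isCompact.isBounded.exists_norm_le
    refine ⟨δ / 2, |R| + 1, by positivity, by positivity, fun x k hk ↦ ?_, fun x hx ↦ ?_⟩
    · have hk' : ‖k‖ < δ := by linarith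
      by_cases hx : x ∈ tsupport φ
      · exact h3 x hx _ (by simpa)
      by_cases hy : x + k ∈ tsupport φ
      · exact (h3 _ hy x (by simpa [dist_eq_norm] using hk')).symm
      · rw [image_eq_zero_of_notMem_tsupport hx, image_eq_zero_of_notMem_tsupport hy]
    · linarith [hR x (subset_tsupport _ hx), le_abs_self R]
  · rintro ⟨δ, R, hδ, hR, h1, h2⟩
    refine ⟨(IsLocallyConstant.iff_eventually_eq _).2 fun x ↦ ?_,
      HasCompactSupport.of_support_subset_isCompact (isCompact_closedBall (0 : F) R)
        fun x hx ↦ mem_closedBall_zero_iff.2 (h2 x hx)⟩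
    filter_upwards [closedBall_mem_nhds x hδ] with y hy
    rw [mem_closedBall, dist_eq_norm] at hy
    rw [← h1 x _ hy, add_sub_cancel]

theorem indicator_closedBall_mem (x : F) {r : ℝ} (hr : 0 < r) :
    (closedBall x r).indicator (fun _ ↦ (1 : ℂ)) ∈ D.schwartz := by
  refine (h.mem_schwartz_iff _).2 ⟨?_, ?_⟩
  · exact (LocallyConstant.charFn ℂ (IsUltrametricDist.isClopen_closedBall x hr.ne')).isLocallyConstant
  · exact HasCompactSupport.of_support_subset_isCompact (isCompact_closedBall x r)
      Set.support_indicator_subset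

theorem character_zero : D.character 0 = 1 := by
  obtain ⟨r, hr, hr'⟩ := h.exists_trivial
  exact hr' 0 (by simpa using hr.le)

theorem continuous_character : Continuous D.character := by
  obtain ⟨r, hr, hr'⟩ := h.exists_trivial
  refine IsLocallyConstant.continuous ((IsLocallyConstant.iff_eventually_eq _).2 fun x ↦ ?_)
  filter_upwards [closedBall_mem_nhds x hr] with y hy
  rw [mem_closedBall, dist_eq_norm] at hy
  rw [← add_sub_cancel x y, h.character_add, hr' _ hy, mul_one]

/-- Translation by `a` leaves the integral unchanged, but also multiplies it by a number different
from `1`. -/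
theorem fourier_eq_zero_of_invariant {μ : Measure F} [μ.IsAddHaarMeasure] {φ : F → ℂ} {y a : F}
    (hφ : ∀ x, φ (x + a) = φ x) (ha : D.character (-(y * a)) ≠ 1) : D.fourier μ φ y = 0 := by
  have h1 : D.fourier μ φ y = D.character (-(y * a)) * D.fourier μ φ y := by
    simp only [LocalData.fourier]
    rw [← integral_const_mul, ← integral_add_right_eq_self _ a]
    congr 1
    ext x
    rw [hφ, mul_add, neg_add, h.character_add]
    ring
  by_contra hne
  exact ha ((mul_eq_right₀ hne).1 h1.symm)

theorem fourier_mem {μ : Measure F} [μ.IsAddHaarMeasure] {φ : F → ℂ} (hφ : φ ∈ D.schwartz) :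
    D.fourier μ φ ∈ D.schwartz := by
  obtain ⟨δ, R, hδ, hR, h1, h2⟩ := h.mem_schwartz_iff_exists.1 hφ
  obtain ⟨r, hr, hr'⟩ := h.exists_trivial
  obtain ⟨z, hz⟩ := h.exists_nontrivial
  refine h.mem_schwartz_iff_exists.2 ⟨r / R, ‖z‖ / δ + 1, by positivity, by positivity,
    fun y k hk ↦ ?_, fun y hy ↦ ?_⟩
  · simp only [LocalData.fourier]
    congr 1
    ext x
    rcases eq_or_ne (φ x) 0 with hx | hx
    · rw [hx, zero_mul, zero_mul]
    · rw [add_mul, neg_add, h.character_add, hr' (-(k * x)), mul_one]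
      rw [norm_neg, norm_mul, ← div_mul_cancel₀ r hR.ne']
      gcongr
      exact h2 x hx
  · by_contra! hlt
    have hy0 : 0 < ‖y‖ := lt_trans (by positivity) hlt
    refine hy (h.fourier_eq_zero_of_invariant (a := -z / y) (fun x ↦ h1 x _ ?_) ?_)
    · rw [norm_div, norm_neg, div_le_comm₀ hy0 hδ]
      linarith
    · rwa [mul_div_cancel₀ _ (norm_pos_iff.1 hy0), neg_neg]

/-- The ultrametric inequality makes `‖x‖` locally constant away from the origin. -/
theorem inversion_mem {φ : F → ℂ} (hφ : φ ∈ D.schwartzZero) : D.inversion φ ∈ D.schwartz := by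
  obtain ⟨r, R, hr, hR, hrR⟩ := LocalData.exists_bounds_of_mem_schwartzZero hφ
  have hloc := ((h.mem_schwartz_iff _).1 hφ.1).1
  refine (h.mem_schwartz_iff _).2 ⟨(IsLocallyConstant.iff_eventually_eq _).2 fun x ↦ ?_, ?_⟩
  · rcases eq_or_ne x 0 with rfl | hx
    · have h0 : ∀ y : F, ‖y‖ < R⁻¹ → D.inversion φ y = 0 := by
        intro y hy
        by_contra hne
        obtain ⟨h1, h2⟩ := hrR _ (right_ne_zero_of_mul hne)
        rw [one_div, norm_inv] at h1 h2
        exact absurd hy (not_lt.2 (inv_le_of_inv_le₀ (inv_pos.1 (hr.trans_le h1)) h2))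
      filter_upwards [ball_mem_nhds (0 : F) (inv_pos.2 hR)] with y hy
      rw [h0 y (by simpa using hy), h0 0 (by simpa using hR)]
    · have h1 : ContinuousAt (fun y : F ↦ 1 / y) x := continuousAt_const.div continuousAt_id hx
      have h2 := h1.eventually ((IsLocallyConstant.iff_eventually_eq _).1 hloc (1 / x))
      filter_upwards [h2, ball_mem_nhds x (norm_pos_iff.2 hx)] with y hy hyx
      have h3 : ‖y‖ = ‖x‖ := by
        rw [mem_ball, dist_eq_norm] at hyx
        rw [← sub_add_cancel y x, IsUltrametricDist.norm_add_eq_max_of_norm_ne_norm hyx.ne,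
          max_eq_right hyx.le]
      simp only [LocalData.inversion, h.module_eq]
      rw [hy, h3]
  · refine HasCompactSupport.of_support_subset_isCompact (isCompact_closedBall (0 : F) r⁻¹)
      fun x hx ↦ ?_
    obtain ⟨h1, -⟩ := hrR _ (right_ne_zero_of_mul hx)
    rw [one_div, norm_inv] at h1
    exact mem_closedBall_zero_iff.2 ((le_inv_comm₀ hr (inv_pos.1 (hr.trans_le h1))).1 h1)

/-- The indicator of a closed ball around `x` of radius less than `‖x‖` belongs to `𝒮₀`. So the
averages of `g` over small balls vanish, and they converge to `g(x)` almost everywhere. -/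
theorem separates {μ : Measure F} {n : ℕ} (hμ : HasModule μ n) {g : F → ℂ}
    (hg : LocallyIntegrable g μ) (hg0 : ∀ ψ ∈ D.schwartzZero, ∫ x, g x * ψ x ∂μ = 0) :
    g =ᵐ[μ] 0 := by
  have := hμ.isAddHaarMeasure
  have := hμ.isUnifLocDoublingMeasure
  filter_upwards [IsUnifLocDoublingMeasure.ae_tendsto_average (μ := μ) hg 1, hμ.ae_ne_zero]
    with x hx hx0
  have h1 := hx (l := 𝓝[>] (0 : ℝ)) (fun _ ↦ x) id Filter.tendsto_id (by
    filter_upwards [self_mem_nhdsWithin] with δ hδ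
    exact mem_closedBall_self (by simpa using le_of_lt hδ))
  refine tendsto_nhds_unique h1 (tendsto_const_nhds.congr' ?_)
  filter_upwards [Ioo_mem_nhdsGT (norm_pos_iff.2 hx0)] with δ hδ
  have h2 : (closedBall x δ).indicator (fun _ ↦ (1 : ℂ)) ∈ D.schwartzZero := by
    have h3 := h.indicator_closedBall_mem x hδ.1
    refine ⟨h3, ((h.mem_schwartz_iff _).1 h3).2, ?_⟩
    have h4 : (0 : F) ∈ (closedBall x δ)ᶜ := by
      simpa [dist_eq_norm] using hδ.2
    filter_upwards [isClosed_closedBall.isOpen_compl.mem_nhds h4] with y hy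
    exact Set.indicator_of_notMem hy _
  have h3 : ∫ y in closedBall x δ, g y ∂μ = 0 := by
    rw [← hg0 _ h2, ← integral_indicator measurableSet_closedBall]
    congr 1
    ext y
    by_cases hy : y ∈ closedBall x δ <;> simp [hy]
  rw [id, setAverage_eq, h3, smul_zero]
  rfl

theorem admissible {μ : Measure F} (hμ : HasModule μ 1) : D.Admissible μ 1 where
  toHasModule := hμ
  module_eq x := by rw [h.module_eq, pow_one]
  character_add := h.character_add
  norm_character := h.norm_character
  continuous_character := h.continuous_character
  add_mem φ hφ ψ hψ := by
    obtain ⟨h1, h2⟩ := (h.mem_schwartz_iff _).1 hφ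
    obtain ⟨h3, h4⟩ := (h.mem_schwartz_iff _).1 hψ
    exact (h.mem_schwartz_iff _).2 ⟨h1.add h3, h2.add h4⟩
  smul_mem c φ hφ := by
    obtain ⟨h1, h2⟩ := (h.mem_schwartz_iff _).1 hφ
    exact (h.mem_schwartz_iff _).2 ⟨h1.comp (c * ·), h2.mul_left⟩
  lipschitz φ hφ := by
    obtain ⟨δ, R, hδ, hR, h1, h2⟩ := h.mem_schwartz_iff_exists.1 hφ
    obtain ⟨h3, h4⟩ := (h.mem_schwartz_iff _).1 hφ
    obtain ⟨M, hM⟩ := h4.exists_bound_of_continuous h3.continuous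
    have hM0 : 0 ≤ M := (norm_nonneg _).trans (hM 0)
    -- Below distance `δ` the difference is zero, and beyond it the bound `2M` suffices.
    refine ⟨2 * M / δ, fun x y ↦ ?_⟩
    rcases le_total ‖x - y‖ δ with hxy | hxy
    · rw [← h1 y _ hxy, add_sub_cancel, sub_self, norm_zero]
      positivity
    · calc ‖φ x - φ y‖ ≤ M + M := (norm_sub_le _ _).trans (add_le_add (hM x) (hM y))
        _ = 2 * M / δ * δ := by field_simp; ring
        _ ≤ 2 * M / δ * ‖x - y‖ := by gcongr
  decay φ hφ N := by
    obtain ⟨δ, R, hδ, hR, h1, h2⟩ := h.mem_schwartz_iff_exists.1 hφ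
    obtain ⟨h3, h4⟩ := (h.mem_schwartz_iff _).1 hφ
    obtain ⟨M, hM⟩ := h4.exists_bound_of_continuous h3.continuous
    have hM0 : 0 ≤ M := (norm_nonneg _).trans (hM 0)
    refine ⟨R ^ N * M, fun x ↦ ?_⟩
    rcases eq_or_ne (φ x) 0 with hx | hx
    · rw [hx, norm_zero, mul_zero]
      positivity
    · gcongr
      · exact h2 x hx
      · exact hM x
  translate_mem φ hφ a := by
    obtain ⟨h1, h2⟩ := (h.mem_schwartz_iff _).1 hφ
    exact (h.mem_schwartz_iff _).2 ⟨h1.comp_continuous (continuous_add_const a),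
      h2.comp_homeomorph (Homeomorph.addRight a)⟩
  dilate_mem φ hφ a ha := by
    obtain ⟨h1, h2⟩ := (h.mem_schwartz_iff _).1 hφ
    exact (h.mem_schwartz_iff _).2 ⟨h1.comp_continuous (continuous_const_mul a),
      h2.comp_homeomorph (Homeomorph.mulLeft₀ a ha)⟩
  fourier_mem φ hφ := by
    have := hμ.isAddHaarMeasure
    exact h.fourier_mem hφ
  inversion_mem φ hφ := h.inversion_mem hφ
  separates g hg hg0 := h.separates hμ hg hg0
  exists_radial := by
    refine ⟨(closedBall 0 1).indicator (fun _ ↦ (1 : ℝ)), ?_, by simp, fun x y hxy ↦ ?_⟩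
    · convert h.indicator_closedBall_mem 0 one_pos using 2 with x
      by_cases hx : x ∈ closedBall (0 : F) 1 <;> simp [hx]
    · by_cases hy : y ∈ closedBall (0 : F) 1
      · have hx : x ∈ closedBall (0 : F) 1 := by
          rw [mem_closedBall_zero_iff] at hy ⊢
          exact hxy.trans hy
        rw [Set.indicator_of_mem hx, Set.indicator_of_mem hy]
      · rw [Set.indicator_of_notMem hy]
        exact Set.indicator_nonneg (fun _ _ ↦ zero_le_one) _

variable {μ : Measure F} (hμ : HasModule μ 1)
include hμ

/-- Orthogonality of characters: the unit ball is an additive subgroup, on which `λ(-y ·)` is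
trivial or has integral zero. -/
theorem fourier_indicator_eq (y : F) :
    D.fourier μ ((closedBall 0 1).indicator fun _ ↦ 1) y = 0 ∨
      D.fourier μ ((closedBall 0 1).indicator fun _ ↦ 1) y = μ.real (closedBall 0 1) := by
  have := hμ.isAddHaarMeasure
  by_cases hy : ∀ a : F, ‖a‖ ≤ 1 → D.character (-(y * a)) = 1
  · right
    simp only [LocalData.fourier]
    have h1 : (fun x : F ↦ (closedBall (0 : F) 1).indicator (fun _ ↦ (1 : ℂ)) x
        * D.character (-(y * x))) = (closedBall 0 1).indicator fun _ ↦ 1 := by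
      ext x
      by_cases hx : x ∈ closedBall (0 : F) 1
      · rw [hy x (mem_closedBall_zero_iff.1 hx), mul_one]
      · simp [hx]
    rw [h1, integral_indicator measurableSet_closedBall]
    simp
  · left
    push Not at hy
    obtain ⟨a, ha, ha'⟩ := hy
    refine h.fourier_eq_zero_of_invariant (fun x ↦ ?_) ha'
    have h1 : x + a ∈ closedBall (0 : F) 1 ↔ x ∈ closedBall (0 : F) 1 := by
      simp only [mem_closedBall_zero_iff]
      refine ⟨fun h2 ↦ ?_, fun h2 ↦ ?_⟩
      · have h3 := IsUltrametricDist.norm_add_le_max (x + a) (-a)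
        rw [add_neg_cancel_right, norm_neg] at h3
        exact h3.trans (max_le h2 ha)
      · exact (IsUltrametricDist.norm_add_le_max x a).trans (max_le h2 ha)
    by_cases hx : x ∈ closedBall (0 : F) 1
    · rw [Set.indicator_of_mem hx, Set.indicator_of_mem (h1.2 hx)]
    · rw [Set.indicator_of_notMem hx, Set.indicator_of_notMem (fun h2 ↦ hx (h1.1 h2))]

theorem exists_integral_fourier_indicator_eq : ∃ C : ℝ, 0 < C ∧
    ∫ y, D.fourier μ ((closedBall 0 1).indicator fun _ ↦ 1) y ∂μ = C := by
  have := hμ.isAddHaarMeasure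
  set Φ : F → ℂ := D.fourier μ ((closedBall 0 1).indicator fun _ ↦ 1) with hΦ
  have hmem : Φ ∈ D.schwartz := h.fourier_mem (h.indicator_closedBall_mem 0 one_pos)
  obtain ⟨h1, h2⟩ := (h.mem_schwartz_iff _).1 hmem
  have h3 : ∀ y, Φ y = ((Φ y).re : ℂ) ∧ 0 ≤ (Φ y).re := by
    intro y
    rcases h.fourier_indicator_eq hμ y with h4 | h4 <;> rw [← hΦ] at h4 <;> rw [h4]
    · simp
    · simp
  have h0 : (Φ 0).re ≠ 0 := by
    have h4 : Φ 0 = μ.real (closedBall 0 1) := by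
      rw [hΦ]
      simp only [LocalData.fourier, zero_mul, neg_zero, h.character_zero, mul_one]
      rw [integral_indicator measurableSet_closedBall]
      simp
    rw [h4, Complex.ofReal_re]
    exact (ENNReal.toReal_pos (measure_closedBall_pos μ 0 one_pos).ne'
      measure_closedBall_lt_top.ne).ne'
  refine ⟨∫ y, (Φ y).re ∂μ, ?_, ?_⟩
  · refine Continuous.integral_pos_of_hasCompactSupport_nonneg_nonzero (x := 0)
      (Complex.continuous_re.comp h1.continuous) (h2.comp_left Complex.zero_re)
      (fun y ↦ (h3 y).2) h0
  · exact (integral_congr_ae (Filter.Eventually.of_forall fun y ↦ (h3 y).1)).trans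
      integral_complex_ofReal

/-- In `ℱℱφ(x)` insert the indicator of a ball containing the support of `ℱφ`. By the multiplication
formula this becomes the integral of `φ` against a multiple of a translated, dilated `ℱI`, supported
so close to `-x` that `φ` is constant there. -/
theorem exists_fourier_fourier_eq : ∃ C : ℝ, 0 < C ∧ ∀ φ ∈ D.schwartz, ∀ x,
    D.fourier μ (D.fourier μ φ) x = C * φ (-x) := by
  have := hμ.isAddHaarMeasure
  have ha := h.admissible hμ
  obtain ⟨C, hC0, hC⟩ := h.exists_integral_fourier_indicator_eq hμ
  refine ⟨C, hC0, fun φ hφ x ↦ ?_⟩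
  set I : F → ℂ := (closedBall 0 1).indicator fun _ ↦ 1 with hI
  have hImem : I ∈ D.schwartz := h.indicator_closedBall_mem 0 one_pos
  obtain ⟨δ, -, hδ, -, h1, -⟩ := h.mem_schwartz_iff_exists.1 hφ
  obtain ⟨-, R, -, hR, -, h2⟩ := h.mem_schwartz_iff_exists.1 (h.fourier_mem (μ := μ) hφ)
  obtain ⟨-, S, -, hS, -, h3⟩ := h.mem_schwartz_iff_exists.1 (h.fourier_mem (μ := μ) hImem)
  -- The bound `R` makes the ball contain the support of `ℱφ`; the bound `S / δ` shrinks the support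
  -- of `u ↦ ℱI(bu)` into `‖u‖ ≤ δ`.
  obtain ⟨b, hb, hbM⟩ := hμ.exists_le_norm (max R (S / δ))
  have hb' : 0 < ‖b‖ := norm_pos_iff.2 hb
  set k : F → ℂ := fun y ↦ I (b⁻¹ * y) * D.character (-(x * y)) with hk
  have hkint : Integrable k μ := ha.integrable_mul_character
    (ha.integrable_of_mem (h.admissible hμ |>.dilate_mem I hImem _ (inv_ne_zero hb))) (by fun_prop)
  have hFk : ∀ u, D.fourier μ k u = ‖b‖ * D.fourier μ I (b * (u + x)) := by
    intro u
    have h4 := ha.fourier_dilate I (inv_ne_zero hb) (u + x)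
    rw [pow_one, norm_inv, inv_inv, div_inv_eq_mul, mul_comm _ b] at h4
    rw [← h4]
    simp only [LocalData.fourier, hk]
    congr 1
    ext y
    rw [mul_assoc, ← h.character_add]
    congr 2
    ring
  have h4 : D.fourier μ (D.fourier μ φ) x = ∫ y, D.fourier μ φ y * k y ∂μ := by
    simp only [hk]
    rw [LocalData.fourier]
    congr 1
    ext y
    rcases eq_or_ne (D.fourier μ φ y) 0 with hy | hy
    · rw [hy, zero_mul, zero_mul]
    · have h5 : b⁻¹ * y ∈ closedBall (0 : F) 1 := by
        rw [mem_closedBall_zero_iff, norm_mul, norm_inv]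
        exact inv_mul_le_one_of_le₀ ((h2 y hy).trans ((le_max_left _ _).trans hbM)) hb'.le
      rw [hI, Set.indicator_of_mem h5, one_mul]
  have h5 := hμ.integral_mul_left hb (D.fourier μ I)
  rw [hC, pow_one, Complex.real_smul] at h5
  calc D.fourier μ (D.fourier μ φ) x
      = ∫ u, φ u * (‖b‖ * D.fourier μ I (b * (u + x))) ∂μ := by
        rw [h4, ha.integral_fourier_mul (ha.integrable_of_mem hφ) hkint]
        simp_rw [hFk]
    _ = ∫ u, φ (u - x) * (‖b‖ * D.fourier μ I (b * u)) ∂μ := by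
        rw [← integral_sub_right_eq_self _ x]
        simp
    _ = ∫ u, φ (-x) * ‖b‖ * D.fourier μ I (b * u) ∂μ := by
        congr 1
        ext u
        rcases eq_or_ne (D.fourier μ I (b * u)) 0 with hu | hu
        · rw [hu, mul_zero, mul_zero, mul_zero]
        · have h6 := h3 _ hu
          have h7 : ‖u‖ ≤ δ := by
            have h8 : S ≤ ‖b‖ * δ := (div_le_iff₀ hδ).1 ((le_max_right _ _).trans hbM)
            rw [norm_mul] at h6
            exact le_of_mul_le_mul_left (h6.trans h8) hb'
          rw [sub_eq_neg_add, h1 _ u h7, mul_assoc]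
    _ = C * φ (-x) := by
        rw [integral_const_mul, h5]
        have : (‖b‖ : ℂ) ≠ 0 := by exact_mod_cast hb'.ne'
        push_cast
        field_simp

theorem exists_isSelfDual : ∃ ν : Measure F, D.IsSelfDual ν := by
  have := hμ.isAddHaarMeasure
  obtain ⟨C, hC0, hC⟩ := h.exists_fourier_fourier_eq hμ
  -- Scaling the measure by `c` multiplies `ℱℱ` by `c²`.
  set c : NNReal := Real.toNNReal (√C)⁻¹
  have hc : (c : ℝ) = (√C)⁻¹ := Real.coe_toNNReal _ (by positivity)
  have hc0 : c ≠ 0 := (Real.toNNReal_pos.2 (inv_pos.2 (Real.sqrt_pos.2 hC0))).ne'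
  have h1 : ∀ φ : F → ℂ, D.fourier (c • μ) φ = fun y ↦ (c : ℝ) * D.fourier μ φ y := by
    intro φ
    ext y
    simp only [LocalData.fourier]
    rw [integral_smul_nnreal_measure]
    exact Complex.real_smul
  refine ⟨c • μ, Measure.IsAddHaarMeasure.nnreal_smul _ hc0, fun φ hφ x ↦ ?_⟩
  rw [h1, h1]
  simp only
  rw [(h.admissible hμ).fourier_const_mul, hC φ hφ, hc, ← mul_assoc, ← mul_assoc,
    ← Complex.ofReal_mul, ← Complex.ofReal_mul, ← mul_inv, Real.mul_self_sqrt hC0.le,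
    inv_mul_cancel₀ hC0.ne', Complex.ofReal_one, one_mul]

end IsUltrametricModel

end Nonarchimedean

/-! ### Finite places -/

section FinitePlaces

open Metric WithZero

variable {K : Type*} [Field K] [NumberField K] (v : HeightOneSpectrum (𝓞 K))

/-- The image of an algebraic integer in the completion. -/
def integerHom : 𝓞 K →+* v.adicCompletion K :=
  (FinitePlace.embedding v).comp (algebraMap (𝓞 K) K)

theorem norm_integerHom_le_one (a : 𝓞 K) : ‖integerHom v a‖ ≤ 1 :=
  FinitePlace.norm_le_one K v a

theorem norm_integerHom_lt_one_iff {a : 𝓞 K} : ‖integerHom v a‖ < 1 ↔ a ∈ v.asIdeal :=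
  FinitePlace.norm_lt_one_iff_mem K v a

instance : IsUltrametricDist (v.adicCompletion K) :=
  inferInstanceAs (@IsUltrametricDist _ (Valued.toNormedField (v.adicCompletion K) ℤᵐ⁰).toDist)

theorem norm_lt_one_iff_valued (x : v.adicCompletion K) : ‖x‖ < 1 ↔ Valued.v x < 1 := by
  rw [FinitePlace.norm_def, ← NNReal.coe_one, NNReal.coe_lt_coe]
  exact WithZeroMulInt.toNNReal_lt_one_iff (HeightOneSpectrum.one_lt_absNorm_nnreal v)

theorem norm_le_one_iff_valued (x : v.adicCompletion K) : ‖x‖ ≤ 1 ↔ Valued.v x ≤ 1 := by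
  rw [FinitePlace.norm_def, ← NNReal.coe_one, NNReal.coe_le_coe]
  exact WithZeroMulInt.toNNReal_le_one_iff (HeightOneSpectrum.one_lt_absNorm_nnreal v)

theorem norm_embedding_lt_one_iff (x : K) :
    ‖FinitePlace.embedding v x‖ < 1 ↔ v.valuation K x < 1 := by
  rw [norm_lt_one_iff_valued, FinitePlace.embedding_apply,
    HeightOneSpectrum.valuedAdicCompletion_eq_valuation']

theorem norm_embedding_le_one_iff (x : K) :
    ‖FinitePlace.embedding v x‖ ≤ 1 ↔ v.valuation K x ≤ 1 := by
  rw [norm_le_one_iff_valued, FinitePlace.embedding_apply,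
    HeightOneSpectrum.valuedAdicCompletion_eq_valuation']

/-- Approximate first by an element of `K`, which is then integral at `v`, and this one by an
algebraic integer. -/
theorem exists_norm_sub_integerHom_lt {x : v.adicCompletion K} (hx : ‖x‖ ≤ 1) :
    ∃ a : 𝓞 K, ‖x - integerHom v a‖ < 1 := by
  obtain ⟨y, hy⟩ := (HeightOneSpectrum.denseRange_algebraMap K v).exists_dist_lt x one_pos
  have hy' : ‖x - FinitePlace.embedding v y‖ < 1 := by rwa [dist_eq_norm] at hy
  have hy1 : ‖FinitePlace.embedding v y‖ ≤ 1 := by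
    have := IsUltrametricDist.norm_add_le_max (FinitePlace.embedding v y - x) x
    rw [sub_add_cancel, norm_sub_rev] at this
    exact this.trans (max_le hy'.le hx)
  obtain ⟨a, ha⟩ := v.exists_valuation_sub_lt_of_integer ((norm_embedding_le_one_iff v y).1 hy1) 1
  have ha' : ‖FinitePlace.embedding v y - integerHom v a‖ < 1 := by
    rw [norm_sub_rev]
    have := (norm_embedding_lt_one_iff v _).2 ha
    rwa [map_sub] at this
  refine ⟨a, ?_⟩
  have := IsUltrametricDist.norm_add_le_max (x - FinitePlace.embedding v y)
    (FinitePlace.embedding v y - integerHom v a)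
  rw [sub_add_sub_cancel] at this
  exact this.trans_lt (max_lt hy' ha')

/-- A set of representatives of the residue field. -/
def residueRep (c : 𝓞 K ⧸ v.asIdeal) : v.adicCompletion K := integerHom v c.out

theorem norm_residueRep_le_one (c : 𝓞 K ⧸ v.asIdeal) : ‖residueRep v c‖ ≤ 1 :=
  norm_integerHom_le_one v _

theorem exists_norm_sub_residueRep_lt {x : v.adicCompletion K} (hx : ‖x‖ ≤ 1) :
    ∃ c, ‖x - residueRep v c‖ < 1 := by
  obtain ⟨a, ha⟩ := exists_norm_sub_integerHom_lt v hx
  refine ⟨Ideal.Quotient.mk _ a, ?_⟩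
  have h1 : ‖integerHom v a - residueRep v (Ideal.Quotient.mk _ a)‖ < 1 := by
    rw [residueRep, ← map_sub, norm_integerHom_lt_one_iff, ← Ideal.Quotient.eq]
    exact (Ideal.Quotient.mk_out _).symm
  have := IsUltrametricDist.norm_add_le_max (x - integerHom v a)
    (integerHom v a - residueRep v (Ideal.Quotient.mk _ a))
  rw [sub_add_sub_cancel] at this
  exact this.trans_lt (max_lt ha h1)

theorem eq_of_norm_residueRep_sub_lt {c d : 𝓞 K ⧸ v.asIdeal}
    (h : ‖residueRep v c - residueRep v d‖ < 1) : c = d := by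
  rw [residueRep, residueRep, ← map_sub, norm_integerHom_lt_one_iff, ← Ideal.Quotient.eq] at h
  rwa [Ideal.Quotient.mk_out, Ideal.Quotient.mk_out] at h

instance : Finite (𝓞 K ⧸ v.asIdeal) := v.asIdeal.finiteQuotientOfFreeOfNeBot v.ne_bot

open Valued in
theorem finite_residueField_adicCompletion : Finite 𝓀[v.adicCompletion K] := by
  have h1 : ∀ c, residueRep v c ∈ 𝒪[v.adicCompletion K] := fun c ↦
    (norm_le_one_iff_valued v _).1 (norm_residueRep_le_one v c)
  refine Finite.of_surjective (fun c : 𝓞 K ⧸ v.asIdeal ↦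
    IsLocalRing.residue 𝒪[v.adicCompletion K] ⟨_, h1 c⟩) fun y ↦ ?_
  obtain ⟨x, rfl⟩ := IsLocalRing.residue_surjective y
  obtain ⟨c, hc⟩ := exists_norm_sub_residueRep_lt v ((norm_le_one_iff_valued v _).2 x.2)
  refine ⟨c, Eq.symm (Ideal.Quotient.eq.2 ?_)⟩
  rw [IsLocalRing.mem_maximalIdeal, mem_nonunits_iff,
    Valuation.Integer.not_isUnit_iff_valuation_lt_one]
  exact (norm_lt_one_iff_valued v _).1 hc

instance : ProperSpace (v.adicCompletion K) :=
  Valued.integer.properSpace_iff_completeSpace_and_isDiscreteValuationRing_integer_and_finite_residueField.2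
    ⟨inferInstance, inferInstanceAs (IsDiscreteValuationRing (v.adicCompletionIntegers K)),
      finite_residueField_adicCompletion v⟩

theorem exists_norm_eq_inv_absNorm :
    ∃ π : v.adicCompletion K, ‖π‖ = (Ideal.absNorm v.asIdeal : ℝ)⁻¹ := by
  obtain ⟨π, hπ⟩ := v.valuation_exists_uniformizer K
  refine ⟨FinitePlace.embedding v π, ?_⟩
  rw [FinitePlace.norm_embedding', hπ, WithZeroMulInt.toNNReal_neg_apply _ WithZero.exp_ne_zero]
  have h1 : WithZero.unzero (WithZero.exp_ne_zero (a := (-1 : ℤ))) = Multiplicative.ofAdd (-1) :=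
    WithZero.unzero_coe _
  rw [h1]
  simp

theorem exists_norm_eq_zpow {x : v.adicCompletion K} (hx : x ≠ 0) :
    ∃ k : ℤ, ‖x‖ = (Ideal.absNorm v.asIdeal : ℝ) ^ k := by
  rw [FinitePlace.norm_def, WithZeroMulInt.toNNReal_neg_apply _ ((Valuation.ne_zero_iff _).2 hx)]
  exact ⟨_, by push_cast; rfl⟩

/-! #### The module -/

variable [MeasurableSpace (v.adicCompletion K)] [BorelSpace (v.adicCompletion K)]

/-- The closed ball is the disjoint union of translates of the open ball, one for each residue
class; as the value group is discrete, an open ball of radius `‖a‖` is a closed ball of radius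
`‖aπ‖`. -/
theorem measure_closedBall_eq_absNorm_mul (μ : Measure (v.adicCompletion K)) [μ.IsAddHaarMeasure]
    {π : v.adicCompletion K} (hπ : ‖π‖ = (Ideal.absNorm v.asIdeal : ℝ)⁻¹)
    {a : v.adicCompletion K} (ha : a ≠ 0) :
    μ (closedBall 0 ‖a‖) = Ideal.absNorm v.asIdeal * μ (closedBall 0 ‖a * π‖) := by
  have ha' : 0 < ‖a‖ := norm_pos_iff.2 ha
  have hq : (1 : ℝ) < Ideal.absNorm v.asIdeal := by
    exact_mod_cast HeightOneSpectrum.one_lt_absNorm v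
  have hball : ∀ x : v.adicCompletion K, ball x ‖a‖ = closedBall x ‖a * π‖ := by
    intro x
    ext y
    rw [mem_ball, mem_closedBall, dist_eq_norm, norm_mul, hπ]
    rcases eq_or_ne (y - x) 0 with h0 | h0
    · rw [h0, norm_zero]
      exact iff_of_true ha' (by positivity)
    · obtain ⟨k, hk⟩ := exists_norm_eq_zpow v h0
      obtain ⟨l, hl⟩ := exists_norm_eq_zpow v ha
      rw [hk, hl, ← zpow_sub_one₀ (by positivity), zpow_lt_zpow_iff_right₀ hq,
        zpow_le_zpow_iff_right₀ hq]
      omega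
  have h1 : closedBall (0 : v.adicCompletion K) ‖a‖
      = ⋃ c : 𝓞 K ⧸ v.asIdeal, ball (a * residueRep v c) ‖a‖ := by
    ext x
    have hx : ∀ c, ‖x - a * residueRep v c‖ = ‖a‖ * ‖x / a - residueRep v c‖ := by
      intro c
      rw [← norm_mul, mul_sub, mul_div_cancel₀ _ ha]
    simp only [Set.mem_iUnion, mem_ball, mem_closedBall_zero_iff, dist_eq_norm, hx]
    constructor
    · intro h2
      obtain ⟨c, hc⟩ := exists_norm_sub_residueRep_lt v (x := x / a)
        (by rw [norm_div]; exact (div_le_one ha').2 h2)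
      exact ⟨c, mul_lt_of_lt_one_right ha' hc⟩
    · rintro ⟨c, hc⟩
      have h2 := IsUltrametricDist.norm_add_le_max (x - a * residueRep v c) (a * residueRep v c)
      rw [sub_add_cancel, hx, norm_mul] at h2
      exact h2.trans (max_le hc.le
        (mul_le_of_le_one_right ha'.le (norm_residueRep_le_one v c)))
  have h2 : Pairwise (Function.onFun Disjoint fun c : 𝓞 K ⧸ v.asIdeal ↦
      ball (a * residueRep v c) ‖a‖) := by
    intro c d hcd
    rw [Function.onFun, Set.disjoint_left]
    intro x hxc hxd
    refine hcd (eq_of_norm_residueRep_sub_lt v ?_)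
    have h3 := IsUltrametricDist.norm_add_le_max (a * residueRep v c - x) (x - a * residueRep v d)
    rw [sub_add_sub_cancel, ← mul_sub, norm_mul, norm_sub_rev _ x] at h3
    rw [mem_ball, dist_eq_norm] at hxc hxd
    exact lt_of_mul_lt_mul_left (by rw [mul_one]; exact h3.trans_lt (max_lt hxc hxd)) ha'.le
  have := Fintype.ofFinite (𝓞 K ⧸ v.asIdeal)
  rw [h1, measure_iUnion h2 fun c ↦ measurableSet_ball, tsum_fintype]
  simp_rw [hball, Measure.addHaar_closedBall_center]
  rw [Finset.sum_const, Finset.card_univ, nsmul_eq_mul, ← Nat.card_eq_fintype_card,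
    Ideal.absNorm_apply, Submodule.cardQuot_apply]

theorem measure_closedBall_norm (μ : Measure (v.adicCompletion K)) [μ.IsAddHaarMeasure]
    {a : v.adicCompletion K} (ha : a ≠ 0) :
    μ (closedBall 0 ‖a‖) = ENNReal.ofReal ‖a‖ * μ (closedBall 0 1) := by
  obtain ⟨π, hπ⟩ := exists_norm_eq_inv_absNorm v
  have hq : (1 : ℝ) < Ideal.absNorm v.asIdeal := by
    exact_mod_cast HeightOneSpectrum.one_lt_absNorm v
  have hq0 : (0 : ℝ) < Ideal.absNorm v.asIdeal := one_pos.trans hq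
  have hπ0 : π ≠ 0 := norm_pos_iff.1 (by rw [hπ]; positivity)
  have hstep : ∀ k : ℤ, μ (closedBall 0 (‖π‖ ^ k))
      = Ideal.absNorm v.asIdeal * μ (closedBall 0 (‖π‖ ^ (k + 1))) := by
    intro k
    have := measure_closedBall_eq_absNorm_mul v μ hπ (zpow_ne_zero k hπ0)
    rwa [← zpow_add_one₀ hπ0, norm_zpow, norm_zpow] at this
  have hqE : ENNReal.ofReal ‖π‖ * (Ideal.absNorm v.asIdeal : ENNReal) = 1 := by
    rw [hπ, ← ENNReal.ofReal_natCast, ← ENNReal.ofReal_mul (by positivity),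
      inv_mul_cancel₀ hq0.ne', ENNReal.ofReal_one]
  have hstep' : ∀ k : ℤ, μ (closedBall 0 (‖π‖ ^ (k + 1)))
      = ENNReal.ofReal ‖π‖ * μ (closedBall 0 (‖π‖ ^ k)) := by
    intro k
    rw [hstep k, ← mul_assoc, hqE, one_mul]
  have key : ∀ k : ℤ, μ (closedBall 0 (‖π‖ ^ k))
      = ENNReal.ofReal (‖π‖ ^ k) * μ (closedBall 0 1) := by
    have hπ' : 0 < ‖π‖ := norm_pos_iff.2 hπ0
    intro k
    induction k with
    | zero => simp
    | succ k ih =>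
      rw [hstep', ih, ← mul_assoc, ← ENNReal.ofReal_mul hπ'.le, zpow_add_one₀ hπ'.ne', mul_comm ‖π‖]
    | pred k ih =>
      rw [hstep, sub_add_cancel, ih, ← mul_assoc, ← ENNReal.ofReal_natCast,
        ← ENNReal.ofReal_mul hq0.le, zpow_sub_one₀ hπ'.ne', hπ, inv_inv, mul_comm (Ideal.absNorm v.asIdeal : ℝ)]
  obtain ⟨k, hk⟩ := exists_norm_eq_zpow v ha
  have h1 : ‖a‖ = ‖π‖ ^ (-k) := by rw [hk, hπ, inv_zpow, zpow_neg, inv_inv]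
  rw [h1, key]

theorem hasModule_adicCompletion (μ : Measure (v.adicCompletion K)) [μ.IsAddHaarMeasure] :
    HasModule μ 1 where
  isAddHaarMeasure := inferInstance
  n_pos := one_pos
  exists_one_lt_norm := by
    obtain ⟨π, hπ⟩ := exists_norm_eq_inv_absNorm v
    refine ⟨π⁻¹, ?_⟩
    rw [norm_inv, hπ, inv_inv]
    exact_mod_cast HeightOneSpectrum.one_lt_absNorm v
  map_mul a ha := map_mul_left_eq_smul μ (fun b hb ↦ by
    rw [pow_one]; exact measure_closedBall_norm v μ hb) ha

end FinitePlaces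

/-! #### The character -/

section FiniteCharacter

open Metric

/-! ### The standard additive character of `ℚ_p`. -/

section Padic

variable (p : ℕ) [hp : Fact p.Prime]

theorem norm_sub_polarPart_le_one (a : ℚ_[p]) : ‖a - polarPart p a‖ ≤ 1 :=
  (exists_polar p a).choose_spec.2

theorem exists_polarPart_eq (a : ℚ_[p]) : ∃ m k : ℕ, polarPart p a = m / (p : ℚ) ^ k :=
  (exists_polar p a).choose_spec.1

/-- This is `ℤ[1/p] ∩ ℤ_p = ℤ`, which makes `exp(2πi{a})` independent of the chosen polar part. -/
theorem exists_int_eq_of_norm_le_one {m : ℤ} {k : ℕ} {r : ℚ} (hr : r = m / (p : ℚ) ^ k)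
    (h : ‖(r : ℚ_[p])‖ ≤ 1) : ∃ n : ℤ, r = n := by
  have hp0 : (0 : ℝ) < p := by exact_mod_cast hp.out.pos
  have hpQ : (p : ℚ) ≠ 0 := by exact_mod_cast hp.out.ne_zero
  have h1 : ‖(m : ℚ_[p])‖ ≤ (p : ℝ) ^ (-k : ℤ) := by
    rw [hr] at h
    push_cast at h
    rw [norm_div, norm_pow, Padic.norm_p, inv_pow, div_inv_eq_mul] at h
    rwa [zpow_neg, zpow_natCast, ← one_div, le_div_iff₀ (by positivity)]
  obtain ⟨n, hn⟩ := (Padic.norm_int_le_pow_iff_dvd m k).1 h1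
  refine ⟨n, ?_⟩
  rw [hr, hn]
  push_cast
  field_simp

/-- The standard character `exp(2πi{a})` of `ℚ_p`. -/
def padicCharacter (a : ℚ_[p]) : ℂ := Complex.exp (2 * Real.pi * Complex.I * (polarPart p a : ℚ))

/-- The defect `{a + b} - {a} - {b}` lies in `ℤ[1/p] ∩ ℤ_p = ℤ`. -/
theorem padicCharacter_add (a b : ℚ_[p]) :
    padicCharacter p (a + b) = padicCharacter p a * padicCharacter p b := by
  obtain ⟨m₁, k₁, h₁⟩ := exists_polarPart_eq p (a + b)
  obtain ⟨m₂, k₂, h₂⟩ := exists_polarPart_eq p a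
  obtain ⟨m₃, k₃, h₃⟩ := exists_polarPart_eq p b
  have hpQ : (p : ℚ) ≠ 0 := by exact_mod_cast hp.out.ne_zero
  have h4 : polarPart p (a + b) - polarPart p a - polarPart p b
      = ((m₁ * p ^ (k₂ + k₃) - m₂ * p ^ (k₁ + k₃) - m₃ * p ^ (k₁ + k₂) : ℤ) : ℚ)
        / (p : ℚ) ^ (k₁ + k₂ + k₃) := by
    rw [h₁, h₂, h₃]
    push_cast
    simp only [pow_add]
    field_simp
  obtain ⟨n, hn⟩ := exists_int_eq_of_norm_le_one p h4 (by
    push_cast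
    have h5 : (polarPart p (a + b) : ℚ_[p]) - polarPart p a - polarPart p b
        = ((a - polarPart p a) + (b - polarPart p b)) + -((a + b) - polarPart p (a + b)) := by ring
    rw [h5]
    refine (IsUltrametricDist.norm_add_le_max _ _).trans (max_le
      ((IsUltrametricDist.norm_add_le_max _ _).trans (max_le ?_ ?_)) ?_)
    · exact norm_sub_polarPart_le_one p a
    · exact norm_sub_polarPart_le_one p b
    · rw [norm_neg]
      exact norm_sub_polarPart_le_one p (a + b))
  have h6 : polarPart p (a + b) = polarPart p a + polarPart p b + n := by linarith
  rw [padicCharacter, padicCharacter, padicCharacter, h6, ← Complex.exp_add, ← mul_one (Complex.exp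
    (_ + _)), ← Complex.exp_int_mul_two_pi_mul_I n, ← Complex.exp_add]
  congr 1
  push_cast
  ring

theorem norm_padicCharacter (a : ℚ_[p]) : ‖padicCharacter p a‖ = 1 := by
  have h1 : (2 * Real.pi * Complex.I * (polarPart p a : ℚ) : ℂ)
      = ((2 * Real.pi * (polarPart p a : ℚ) : ℝ) : ℂ) * Complex.I := by
    push_cast
    ring
  rw [padicCharacter, h1, Complex.norm_exp_ofReal_mul_I]

theorem padicCharacter_eq_one_iff (a : ℚ_[p]) : padicCharacter p a = 1 ↔ ‖a‖ ≤ 1 := by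
  have h0 := norm_sub_polarPart_le_one p a
  rw [padicCharacter, Complex.exp_eq_one_iff]
  constructor
  · rintro ⟨n, hn⟩
    have h1 : ((polarPart p a : ℚ) : ℂ) = n := by
      have h2 : (2 * Real.pi * Complex.I : ℂ) ≠ 0 := Complex.two_pi_I_ne_zero
      exact mul_left_cancel₀ h2 (hn.trans (mul_comm _ _))
    have h2 : polarPart p a = n := by exact_mod_cast h1
    rw [h2] at h0
    have h3 := IsUltrametricDist.norm_add_le_max (a - ((n : ℚ) : ℚ_[p])) ((n : ℚ) : ℚ_[p])
    rw [sub_add_cancel] at h3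
    refine h3.trans (max_le h0 ?_)
    rw [Rat.cast_intCast]
    exact Padic.norm_int_le_one n
  · intro ha
    obtain ⟨m, k, hmk⟩ := exists_polarPart_eq p a
    obtain ⟨n, hn⟩ := exists_int_eq_of_norm_le_one p (m := m) (k := k) (r := polarPart p a)
      (by rw [hmk]; push_cast; rfl)
      (by
        have h3 := IsUltrametricDist.norm_add_le_max a (-(a - (polarPart p a : ℚ_[p])))
        rw [neg_sub, add_sub_cancel, norm_sub_rev] at h3
        exact h3.trans (max_le ha h0))
    refine ⟨n, ?_⟩
    rw [hn]
    push_cast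
    ring

end Padic

variable {K : Type*} [Field K] [NumberField K] (v : HeightOneSpectrum (𝓞 K))
variable (p : ℕ) [Fact p.Prime] (hv : (p : 𝓞 K) ∈ v.asIdeal)

theorem continuous_padicHom : Continuous (padicHom v p hv) :=
  UniformSpace.Completion.continuous_extension.comp
    (Padic.withValUniformEquiv (p := p)).symm.continuous

/-- Local compactness makes the completion finite-dimensional over `ℚ_p`, whence the trace is
continuous; in characteristic zero, scalars already show that it is surjective. -/
theorem exists_finiteTrace_isLinear : ∃ T : v.adicCompletion K →+ ℚ_[p],
    (∀ x, T x = finiteTrace v p hv x) ∧ Continuous T ∧ Function.Surjective T := by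
  let : Algebra ℚ_[p] (v.adicCompletion K) := (padicHom v p hv).toAlgebra
  have hsmul : ∀ (c : ℚ_[p]) (x : v.adicCompletion K), c • x = padicHom v p hv c * x :=
    fun _ _ ↦ rfl
  have : ContinuousSMul ℚ_[p] (v.adicCompletion K) := by
    refine ⟨?_⟩
    simp only [hsmul]
    exact ((continuous_padicHom v p hv).comp continuous_fst).mul continuous_snd
  have : FiniteDimensional ℚ_[p] (v.adicCompletion K) :=
    FiniteDimensional.of_locallyCompactSpace ℚ_[p]
  refine ⟨(Algebra.trace ℚ_[p] (v.adicCompletion K)).toAddMonoidHom, fun _ ↦ rfl,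
    LinearMap.continuous_of_finiteDimensional (Algebra.trace ℚ_[p] (v.adicCompletion K)), ?_⟩
  intro a
  have hn : (Module.finrank ℚ_[p] (v.adicCompletion K) : ℚ_[p]) ≠ 0 := by
    exact_mod_cast (Module.finrank_pos (R := ℚ_[p]) (M := v.adicCompletion K)).ne'
  refine ⟨algebraMap ℚ_[p] (v.adicCompletion K)
    (a / Module.finrank ℚ_[p] (v.adicCompletion K)), ?_⟩
  refine (Algebra.trace_algebraMap _).trans ?_
  rw [nsmul_eq_mul, mul_div_cancel₀ _ hn]

theorem isUltrametricModel_finiteData [MeasurableSpace (v.adicCompletion K)]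
    [BorelSpace (v.adicCompletion K)] : IsUltrametricModel (finiteData v p hv) := by
  obtain ⟨T, hT, hTc, hTs⟩ := exists_finiteTrace_isLinear v p hv
  have hχ : ∀ x, (finiteData v p hv).character x = padicCharacter p (T x) := fun x ↦ by
    rw [hT]
    rfl
  refine ⟨fun x ↦ rfl, fun x y ↦ ?_, fun x ↦ ?_, ?_, ?_, fun φ ↦ Iff.rfl⟩
  · rw [hχ, hχ, hχ, map_add, padicCharacter_add]
  · rw [hχ, norm_padicCharacter]
  · obtain ⟨r, hr, hr'⟩ := Metric.continuousAt_iff.1 (hTc.continuousAt (x := 0)) 1 one_pos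
    refine ⟨r / 2, by positivity, fun x hx ↦ ?_⟩
    rw [hχ, padicCharacter_eq_one_iff]
    have h1 := hr' (x := x) (by rw [dist_zero_right]; linarith)
    rw [map_zero, dist_zero_right] at h1
    exact h1.le
  -- An element of trace `1/p`, which is not in `ℤ_p`, witnesses that the character is nontrivial.
  · obtain ⟨z, hz⟩ := hTs ((p : ℚ_[p])⁻¹)
    refine ⟨z, ?_⟩
    rw [hχ, hz, ne_eq, padicCharacter_eq_one_iff, norm_inv, Padic.norm_p, inv_inv, not_le]
    exact_mod_cast (Fact.out : p.Prime).one_lt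

variable [MeasurableSpace (v.adicCompletion K)] [BorelSpace (v.adicCompletion K)]

theorem exists_isSelfDual_finiteData :
    ∃ μ : Measure (v.adicCompletion K), (finiteData v p hv).IsSelfDual μ :=
  (isUltrametricModel_finiteData v p hv).exists_isSelfDual
    (hasModule_adicCompletion v Measure.addHaar)

theorem conductorProperties_finiteData {μ : Measure (v.adicCompletion K)}
    (hμ : (finiteData v p hv).IsSelfDual μ) : ConductorProperties (finiteData v p hv) μ := by
  have := hμ.isAddHaarMeasure
  exact ((isUltrametricModel_finiteData v p hv).admissible
    (hasModule_adicCompletion v μ)).conductorProperties hμ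

end FiniteCharacter

end Conductor

end

theorem theoremE2 {K : Type*} [Field K] [NumberField K] :
    (∀ (v : InfinitePlace K) [MeasurableSpace v.Completion] [BorelSpace v.Completion],
      (∃ μ : Measure v.Completion, (Conductor.infiniteData v).IsSelfDual μ) ∧
      ∀ μ : Measure v.Completion, (Conductor.infiniteData v).IsSelfDual μ →
        Conductor.ConductorProperties (Conductor.infiniteData v) μ) ∧
    (∀ (v : HeightOneSpectrum (𝓞 K)) (p : ℕ) [Fact p.Prime] (hp : (p : 𝓞 K) ∈ v.asIdeal)
        [MeasurableSpace (v.adicCompletion K)] [BorelSpace (v.adicCompletion K)],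
      (∃ μ : Measure (v.adicCompletion K), (Conductor.finiteData v p hp).IsSelfDual μ) ∧
      ∀ μ : Measure (v.adicCompletion K), (Conductor.finiteData v p hp).IsSelfDual μ →
        Conductor.ConductorProperties (Conductor.finiteData v p hp) μ) := by
  exact ⟨fun v _ _ ↦ ⟨Conductor.exists_isSelfDual_infiniteData v,
      fun _ hμ ↦ Conductor.conductorProperties_infiniteData v hμ⟩,
    fun v p _ hp _ _ ↦ ⟨Conductor.exists_isSelfDual_finiteData v p hp,
      fun _ hμ ↦ Conductor.conductorProperties_finiteData v p hp hμ⟩⟩
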